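/- Let $\alpha_0,\alpha_1>0$ and let $\mathcal M$ be a complete (finite-dimensional, smooth) Riemannian manifold with finite Riemannian distance $d$. A geodesic is a curve of vanishing covariant acceleration; it need not be length-minimizing. For $a,b\in\mathcal M$, $t\in\mathbb R$ let $[a,b]_t$ be the set of points $\gamma(t)$, where $\gamma$ is a geodesic with $\gamma(0)=a$, $\gamma(1)=b$ that is length-minimizing on $[0,1]$ (extended as a geodesic up to $t$ if $t\notin[0,1]$). Put $$D_S([x,y],[u,v])=\inf\{d(y',y): y'\in[u,c]_2,\ c\in[x,v]_{1/2}\},$$ and for a finite sequence $u=(u_i)_{i=0}^n$ in $\mathcal M$ $$\text{S-TGV}^2_\alpha(u)=\inf_{(y_i)_{i=0}^{n-1}}\ \sum_{i=0}^{n-1}\alpha_1 d(u_{i+1},y_i)+\sum_{i=1}^{n-1}\alpha_0 D_S([u_i,y_i],[u_{i-1},y_{i-1}]),\qquad \mathrm{TV}^2_S(u)=\sum_{i=1}^{n-1}D_S([u_i,u_{i+1}],[u_{i-1},u_i]).$$ The sequence $u$ is called geodesic if for some $L\ge 0$ there is a unit speed geodesic $\gamma:[0,L]\to\mathcal M$ with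 $\gamma(iL/n)=u_i$ for $0\le i\le n$ and $d(u_i,u_{i+1})=L/n$ for $0\le i<n$ (for $n=0$ every one-point sequence is geodesic), and locally geodesic if $(u_{i-1},u_i,u_{i+1})$ is geodesic for every $1\le i\le n-1$. Then: 1. (M-P1) If $\mathcal M=\mathbb R^K$, then $\text{S-TGV}^2_\alpha(u)=\inf_{(w_i)_{i=0}^{n-1}}\sum_{i=0}^{n-1}\alpha_1|u_{i+1}-u_i-w_i|+\sum_{i=1}^{n-1}\alpha_0|w_i-w_{i-1}|$, the univariate discrete $\mathrm{TGV}^2_\alpha$. 2. (M-P3) If the infimum defining $\text{S-TGV}^2_\alpha(u)$ is attained at $y_i=u_{i+1}$ ($0\le i\le n-1$), then $\text{S-TGV}^2_\alpha(u)=\alpha_0\mathrm{TV}^2_S(u)$; and $\mathrm{TV}^2_S$ is an admissible generalization of $\mathrm{TV}^2$, i.e. $\mathrm{TV}^2_S(u)=\sum_{i=1}^{n-1}|u_{i-1}-2u_i+u_{i+1}|$ if $\mathcal M=\mathbb R^K$. 3. If $u$ is locally geodesic, then $\text{S-TGV}^2_\alpha(u)=0$. 4. If $\text{S-TGV}^2_\alpha(u)=0$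 and for every $0\le i<n$ the geodesic (parametrized on $[0,1]$) connecting $u_i$ and $u_{i+1}$ is unique, then $u$ is geodesic. -/

import Mathlib

open Set Bundle Manifold
open scoped ENNReal ContDiff Topology

noncomputable section

section Geodesics

variable (E : Type*) [NormedAddCommGroup E] [NormedSpace ℝ E]
  {M : Type*} [MetricSpace M] [ChartedSpace E M]
  [RiemannianBundle (fun x : M => TangentSpace 𝓘(ℝ, E) x)]

/-- The Riemannian metric in the coordinates of the chart around `p`: the number `g_x(v, w)`,
where `x` lies in the target of the chart and `v`, `w` are coordinate vectors. -/
def chartMetric (p : M) (x v w : E) : ℝ :=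
  inner ℝ (mfderiv 𝓘(ℝ, E) 𝓘(ℝ, E) (extChartAt 𝓘(ℝ, E) p).symm x v)
    (mfderiv 𝓘(ℝ, E) 𝓘(ℝ, E) (extChartAt 𝓘(ℝ, E) p).symm x w)

/-- The Christoffel symbols (of the first kind) of the Levi-Civita connection in the chart around
`p`: `Γ(a, b; c) = (D_a g(b, c) + D_b g(a, c) - D_c g(a, b)) / 2`, which is `g(∇_a b, c)` for
vector fields `a`, `b`, `c` that are constant in the coordinates. -/
def chartChristoffel (p : M) (x a b c : E) : ℝ :=
  (fderiv ℝ (fun y => chartMetric E p y b c) x a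
    + fderiv ℝ (fun y => chartMetric E p y a c) x b
    - fderiv ℝ (fun y => chartMetric E p y a b) x c) / 2

/-- The coordinates of the curve `γ` in the chart around `p`. -/
def chartCurve (p : M) (γ : ℝ → M) (s : ℝ) : E := extChartAt 𝓘(ℝ, E) p (γ s)

/-- The covariant acceleration `(D/dt) γ'` at time `t`, in the chart around `p`, paired through the
metric with the coordinate vector `w`: the number `g((D/dt) γ', w) = g(x'', w) + Γ(x', x'; w)`. -/
def chartAcceleration (p : M) (γ : ℝ → M) (t : ℝ) (w : E) : ℝ :=
  chartMetric E p (chartCurve E p γ t) (deriv (deriv (chartCurve E p γ)) t) w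
    + chartChristoffel E p (chartCurve E p γ t)
        (deriv (chartCurve E p γ) t) (deriv (chartCurve E p γ) t) w

/-- `γ` is a geodesic on the interval `[a, b]`: a continuous curve which, inside the interval, is
twice continuously differentiable and has vanishing covariant acceleration (in every chart).
The values of `γ` outside `[a, b]` play no role, and for `a = b` there is no condition.
A curve of this kind has constant speed, so it is automatically smooth up to the end points. -/
def IsGeodesicOn (γ : ℝ → M) (a b : ℝ) : Prop :=
  ContinuousOn γ (Icc a b) ∧
  ContMDiffOn 𝓘(ℝ, ℝ) 𝓘(ℝ, E) 2 γ (Ioo a b) ∧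
  ∀ t ∈ Ioo a b, ∀ p : M, γ t ∈ (chartAt E p).source → ∀ w : E, chartAcceleration E p γ t w = 0

/-- `[a, b]_t`: the points `γ t`, where `γ` is a geodesic with `γ 0 = a` and `γ 1 = b` that is
length-minimizing on `[0, 1]` and, if `t` is not in `[0, 1]`, extends as a geodesic up to `t`. -/
def geodesicPoints (a b : M) (t : ℝ) : Set M :=
  {z | ∃ γ : ℝ → M, IsGeodesicOn E γ (min 0 t) (max 1 t) ∧ γ 0 = a ∧ γ 1 = b ∧
    pathELength 𝓘(ℝ, E) γ 0 1 = edist a b ∧ γ t = z}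

/-- There is at most one geodesic, parametrized on `[0, 1]`, from `a` to `b`. -/
def UniqueGeodesic (a b : M) : Prop :=
  ∀ γ σ : ℝ → M, IsGeodesicOn E γ 0 1 → γ 0 = a → γ 1 = b →
    IsGeodesicOn E σ 0 1 → σ 0 = a → σ 1 = b → EqOn γ σ (Icc 0 1)

/-- The finite sequence `u 0, …, u n` is geodesic: it lies on a unit speed geodesic
`γ : [0, L] → M` with `γ (i L / n) = u i`, and `d (u i) (u (i + 1)) = L / n`.
(Only the values `u 0, …, u n` of `u` matter. Constant sequences have `L = 0`.) -/
def IsGeodesicSeq (n : ℕ) (u : ℕ → M) : Prop :=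
  ∃ (L : ℝ) (γ : ℝ → M), 0 ≤ L ∧ IsGeodesicOn E γ 0 L ∧
    (∀ t ∈ Ioo 0 L, ‖mfderiv 𝓘(ℝ, ℝ) 𝓘(ℝ, E) γ t (1 : ℝ)‖ = 1) ∧
    (∀ i ≤ n, γ (i * L / n) = u i) ∧
    ∀ i < n, dist (u i) (u (i + 1)) = L / n

/-- The finite sequence `u 0, …, u n` is locally geodesic: every three consecutive points form a
geodesic sequence. -/
def IsLocallyGeodesicSeq (n : ℕ) (u : ℕ → M) : Prop :=
  ∀ i, i + 2 ≤ n → IsGeodesicSeq E 2 (fun j => u (i + j))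

/-- `D_S([x, y], [u, v])`: the infimum of `d(y', y)` over all `y' ∈ [u, c]_2` with
`c ∈ [x, v]_{1/2}`. -/
def schildDist (x y u v : M) : ℝ≥0∞ :=
  ⨅ c ∈ geodesicPoints E x v (1 / 2), ⨅ y' ∈ geodesicPoints E u c 2, edist y' y

/-- The sum that is minimized in the definition of `S-TGV²`, for the signal `u 0, …, u n` and the
auxiliary points `y 0, …, y (n - 1)`. -/
def schildEnergy (α₀ α₁ : ℝ) (n : ℕ) (u y : ℕ → M) : ℝ≥0∞ :=
  (∑ i ∈ Finset.range n, ENNReal.ofReal α₁ * edist (u (i + 1)) (y i))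
    + ∑ i ∈ Finset.Ico 1 n, ENNReal.ofReal α₀ * schildDist E (u i) (y i) (u (i - 1)) (y (i - 1))

/-- `S-TGV²_α` of the finite sequence `u 0, …, u n`. -/
def schildTGV (α₀ α₁ : ℝ) (n : ℕ) (u : ℕ → M) : ℝ≥0∞ :=
  ⨅ y : ℕ → M, schildEnergy E α₀ α₁ n u y

/-- The second order total variation that belongs to `D_S`:
`∑ᵢ D_S([uᵢ, uᵢ₊₁], [uᵢ₋₁, uᵢ])`. -/
def schildTV2 (n : ℕ) (u : ℕ → M) : ℝ≥0∞ :=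
  ∑ i ∈ Finset.Ico 1 n, schildDist E (u i) (u (i + 1)) (u (i - 1)) (u i)

end Geodesics

section VectorSpace

variable {F : Type*} [NormedAddCommGroup F]

/-- The univariate discrete `TGV²_α` of the finite sequence `u 0, …, u n` in a vector space. -/
def vectorTGV (α₀ α₁ : ℝ) (n : ℕ) (u : ℕ → F) : ℝ :=
  ⨅ w : ℕ → F, ((∑ i ∈ Finset.range n, α₁ * ‖(u (i + 1) - u i) - w i‖)
    + ∑ i ∈ Finset.Ico 1 n, α₀ * ‖w i - w (i - 1)‖)

/-- The univariate discrete `TV²` of the finite sequence `u 0, …, u n` in a vector space. -/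
def vectorTV2 [NormedSpace ℝ F] (n : ℕ) (u : ℕ → F) : ℝ :=
  ∑ i ∈ Finset.Ico 1 n, ‖u (i - 1) - (2 : ℝ) • u i + u (i + 1)‖

end VectorSpace

end

/-! The first three assertions are short. In `ℝ^K` the geodesic equation reads `γ'' = 0`, so the
sets `[a, b]_t` are singletons, Schild's construction closes a parallelogram, and `D_S([x, y], [u,
v]) = |(y - x) - (v - u)|`; the substitution `y = u + w` turns `S-TGV²` into `TGV²`. The choice `yᵢ
= uᵢ₊₁` kills the first sum and turns the second into `α₀ TV²_S`. Each of its terms vanishes for a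
locally geodesic sequence: the midpoint `c` may be taken on the constant geodesic at `uᵢ`, and
`uᵢ₊₁` is then reached from `uᵢ₋₁` by doubling the geodesic to `uᵢ`.

The weight lies on the last assertion, since an infimum equal to `0` need not be known to be
attained. Let `yᵏ` have energy below `1 / (k + 1)`. Then `yᵏᵢ → uᵢ₊₁`, and Schild's construction
yields geodesics `γₖ` on `[0, 2]` from `uᵢ` through some `cₖ → uᵢ₊₁` to a point tending to `uᵢ₊₂`,
with speed `d(uᵢ, cₖ)`. A pointwise limit of them along an ultrafilter is a geodesic through `uᵢ,
uᵢ₊₁, uᵢ₊₂` of speed `d(uᵢ, uᵢ₊₁)` (`exists_isGeodesicOn_of_schildDist_tendsto`). Uniqueness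
identifies its two halves with minimal geodesics between neighbouring points. Hence consecutive
distances agree, and the minimal geodesics, overlapping with these limits at every joint, glue to
one geodesic (`isGeodesicOn_concatCurve`).

This needs two facts of Riemannian geometry, derived here from the distance as infimum of lengths,
without the exponential map. (a) Hopf-Rinow: closed balls are compact and any two points are joined
by a minimal geodesic (`properSpace_of_complete`, `exists_isGeodesicOn`). A limit of almost
minimizing paths is an isometric curve. It is `C¹` in charts, because the squared distance is
quadratic up to third order and the parallelogram law then controls second differences; the first
variation and du Bois-Reymond's lemma give the geodesic equation (`isGeodesicOn_of_dist_eq`). (b)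
Pointwise limits of geodesics of bounded speed are geodesics (`isGeodesicOn_of_tendsto`): in a chart
they solve `x'' = Ω(x, x')` with `Ω` continuous, and positions and velocities stay in a compact set.
-/

set_option linter.unusedSectionVars false

/-! ### The metric and the speed of a curve in a chart -/

section ChartMetric

variable {E : Type*} [NormedAddCommGroup E] [NormedSpace ℝ E] [FiniteDimensional ℝ E]
  {M : Type*} [MetricSpace M] [ChartedSpace E M]
  [RiemannianBundle (fun x : M => TangentSpace 𝓘(ℝ, E) x)]

/-- The Riemannian metric in the chart around `p`, as a continuous bilinear form. -/
noncomputable def metricForm (p : M) (x : E) : E →L[ℝ] E →L[ℝ] ℝ :=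
  (LinearMap.mk₂ ℝ (fun v w : E => chartMetric E p x v w)
    (fun a b c => by
      simp only [chartMetric]
      exact (congrArg (fun z => inner ℝ z _)
        (map_add (mfderiv 𝓘(ℝ, E) 𝓘(ℝ, E) (extChartAt 𝓘(ℝ, E) p).symm x) a b)).trans
          (inner_add_left _ _ _))
    (fun a b c => by
      simp only [chartMetric]
      exact (congrArg (fun z => inner ℝ z _)
        (map_smul (mfderiv 𝓘(ℝ, E) 𝓘(ℝ, E) (extChartAt 𝓘(ℝ, E) p).symm x) a b)).trans
          (real_inner_smul_left _ _ _))
    (fun a b c => by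
      simp only [chartMetric]
      exact (congrArg (fun z => inner ℝ _ z)
        (map_add (mfderiv 𝓘(ℝ, E) 𝓘(ℝ, E) (extChartAt 𝓘(ℝ, E) p).symm x) b c)).trans
          (inner_add_right _ _ _))
    (fun a b c => by
      simp only [chartMetric]
      exact (congrArg (fun z => inner ℝ _ z)
        (map_smul (mfderiv 𝓘(ℝ, E) 𝓘(ℝ, E) (extChartAt 𝓘(ℝ, E) p).symm x) a c)).trans
          (real_inner_smul_right _ _ _))).toContinuousBilinearMap

theorem metricForm_apply (p : M) (x v w : E) : metricForm p x v w = chartMetric E p x v w := rfl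

theorem metricForm_symm (p : M) (x v w : E) : metricForm p x v w = metricForm p x w v := by
  rw [metricForm_apply, metricForm_apply]
  unfold chartMetric
  exact real_inner_comm _ _

theorem metricForm_self_nonneg (p : M) (x v : E) : 0 ≤ metricForm p x v v := by
  rw [metricForm_apply]
  unfold chartMetric
  exact real_inner_self_nonneg

theorem metricForm_self_eq_norm (p : M) (x v : E) :
    metricForm p x v v =
      ‖mfderiv 𝓘(ℝ, E) 𝓘(ℝ, E) (extChartAt 𝓘(ℝ, E) p).symm x v‖ ^ 2 := by
  rw [metricForm_apply]
  unfold chartMetric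
  exact real_inner_self_eq_norm_sq _

/-- The speed of a curve. -/
noncomputable def curveSpeed (E : Type*) [NormedAddCommGroup E] [NormedSpace ℝ E]
    {M : Type*} [MetricSpace M] [ChartedSpace E M]
    [RiemannianBundle (fun x : M => TangentSpace 𝓘(ℝ, E) x)] (γ : ℝ → M) (t : ℝ) : ℝ :=
  ‖mfderiv 𝓘(ℝ, ℝ) 𝓘(ℝ, E) γ t (1 : ℝ)‖

theorem curveSpeed_nonneg (γ : ℝ → M) (t : ℝ) : 0 ≤ curveSpeed E γ t := norm_nonneg _

theorem pathELength_eq_lintegral_curveSpeed (γ : ℝ → M) (a b : ℝ) :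
    pathELength 𝓘(ℝ, E) γ a b = ∫⁻ t in Ioo a b, ENNReal.ofReal (curveSpeed E γ t) := by
  rw [pathELength_eq_lintegral_mfderiv_Ioo]
  refine MeasureTheory.lintegral_congr fun t => ?_
  rw [curveSpeed, ofReal_norm]
  rfl

theorem curveSpeed_congr {γ σ : ℝ → M} {t : ℝ} (h : γ =ᶠ[𝓝 t] σ) :
    curveSpeed E γ t = curveSpeed E σ t := by
  unfold curveSpeed
  rw [h.mfderiv_eq, h.self_of_nhds]

variable [IsManifold 𝓘(ℝ, E) ∞ M]

theorem metricForm_pos (p : M) {x v : E} (hx : x ∈ (extChartAt 𝓘(ℝ, E) p).target) (hv : v ≠ 0) :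
    0 < metricForm p x v v := by
  rw [metricForm_self_eq_norm]
  have h := isInvertible_mfderivWithin_extChartAt_symm (I := 𝓘(ℝ, E)) hx
  simp only [modelWithCornersSelf_coe, range_id, mfderivWithin_univ] at h
  obtain ⟨e, he⟩ := h
  have h0 : mfderiv 𝓘(ℝ, E) 𝓘(ℝ, E) (extChartAt 𝓘(ℝ, E) p).symm x v ≠ 0 := by
    rw [← he]
    intro h1
    exact hv (e.map_eq_zero_iff.1 h1)
  have := norm_pos_iff.2 h0
  positivity

/-- The coordinate vector fields are images of constant fields under the tangent map of the inverse
chart, hence smooth sections; their inner products are smooth because the bundle metric is. In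
finite dimension smoothness of a form may be checked entry by entry. -/
theorem contDiffOn_metricForm
    [IsContMDiffRiemannianBundle 𝓘(ℝ, E) ∞ E (fun x : M => TangentSpace 𝓘(ℝ, E) x)] (p : M) :
    ContDiffOn ℝ ∞ (metricForm p : E → _) (extChartAt 𝓘(ℝ, E) p).target := by
  have hT := isOpen_extChartAt_target (I := 𝓘(ℝ, E)) p
  have key : ∀ v : E, ContMDiffOn 𝓘(ℝ, E) (𝓘(ℝ, E).prod 𝓘(ℝ, E)) ∞
      (fun x : E => (⟨(extChartAt 𝓘(ℝ, E) p).symm x,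
        mfderiv 𝓘(ℝ, E) 𝓘(ℝ, E) (extChartAt 𝓘(ℝ, E) p).symm x v⟩ : TangentBundle 𝓘(ℝ, E) M))
      (extChartAt 𝓘(ℝ, E) p).target := by
    intro v
    have h1 := (contMDiffOn_extChartAt_symm (I := 𝓘(ℝ, E)) (n := ∞)
      p).contMDiffOn_tangentMapWithin (m := ∞) le_rfl hT.uniqueMDiffOn
    have h2 : ContMDiffOn 𝓘(ℝ, E) (𝓘(ℝ, E).prod 𝓘(ℝ, E)) ∞
      (fun x : E => (⟨x, v⟩ : TangentBundle 𝓘(ℝ, E) E)) (extChartAt 𝓘(ℝ, E) p).target :=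
      contMDiffOn_vectorSpace_iff_contDiffOn.2 contDiffOn_const
    refine (h1.comp h2 (fun x hx => hx)).congr fun x hx => ?_
    simp only [Function.comp, tangentMapWithin]
    rw [mfderivWithin_of_isOpen hT hx]
  refine contDiffOn_clm_apply.2 fun v => contDiffOn_clm_apply.2 fun w => ?_
  rw [← contMDiffOn_iff_contDiffOn]
  have h := ContMDiffOn.inner_bundle (E := fun x : M => TangentSpace 𝓘(ℝ, E) x) (key v) (key w)
  exact h

/-- The squared speed of a curve, in the coordinates of a chart. -/
theorem curveSpeed_sq_eq (p : M) {γ : ℝ → M} {t : ℝ}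
    (hγ : MDifferentiableAt 𝓘(ℝ, ℝ) 𝓘(ℝ, E) γ t) (ht : γ t ∈ (chartAt E p).source) :
    DifferentiableAt ℝ (chartCurve E p γ) t ∧
    curveSpeed E γ t ^ 2 =
      metricForm p (chartCurve E p γ t) (deriv (chartCurve E p γ) t)
        (deriv (chartCurve E p γ) t) := by
  have hs : γ t ∈ (extChartAt 𝓘(ℝ, E) p).source := by simpa using ht
  have h1 : MDifferentiableAt 𝓘(ℝ, E) 𝓘(ℝ, E) (extChartAt 𝓘(ℝ, E) p) (γ t) :=
    mdifferentiableAt_extChartAt ht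
  have h2 : MDifferentiableAt 𝓘(ℝ, ℝ) 𝓘(ℝ, E) (chartCurve E p γ) t := h1.comp t hγ
  refine ⟨mdifferentiableAt_iff_differentiableAt.1 h2, ?_⟩
  have hd : (mfderiv 𝓘(ℝ, ℝ) 𝓘(ℝ, E) (chartCurve E p γ) t) (1 : ℝ) =
      deriv (chartCurve E p γ) t := by
    rw [mfderiv_eq_fderiv]; exact fderiv_apply_one_eq_deriv (f := chartCurve E p γ)
  have hx : chartCurve E p γ t ∈ (extChartAt 𝓘(ℝ, E) p).target :=
    (extChartAt 𝓘(ℝ, E) p).map_source hs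
  have h3 : MDifferentiableAt 𝓘(ℝ, E) 𝓘(ℝ, E) (extChartAt 𝓘(ℝ, E) p).symm
      (chartCurve E p γ t) :=
    ((contMDiffOn_extChartAt_symm (n := 1) p).contMDiffAt
      ((isOpen_extChartAt_target (I := 𝓘(ℝ, E)) p).mem_nhds hx)).mdifferentiableAt one_ne_zero
  have h4 : mfderiv 𝓘(ℝ, ℝ) 𝓘(ℝ, E) ((extChartAt 𝓘(ℝ, E) p).symm ∘ chartCurve E p γ) t =
      (mfderiv 𝓘(ℝ, E) 𝓘(ℝ, E) (extChartAt 𝓘(ℝ, E) p).symm (chartCurve E p γ t)).comp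
        (mfderiv 𝓘(ℝ, ℝ) 𝓘(ℝ, E) (chartCurve E p γ) t) := mfderiv_comp t h3 h2
  -- Near `t` the curve is the inverse chart composed with its coordinates, so the chain rule `h4`
  -- computes its velocity.
  have h5 : (extChartAt 𝓘(ℝ, E) p).symm ∘ chartCurve E p γ =ᶠ[𝓝 t] γ := by
    have : ∀ᶠ s in 𝓝 t, γ s ∈ (extChartAt 𝓘(ℝ, E) p).source :=
      hγ.continuousAt.eventually (extChartAt_source_mem_nhds' hs)
    filter_upwards [this] with s hs
    exact (extChartAt 𝓘(ℝ, E) p).left_inv hs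
  rw [metricForm_self_eq_norm, ← hd]
  rw [← curveSpeed_congr h5, curveSpeed, h4]
  rfl

end ChartMetric

/-! ### Length and distance -/

section ChartLength

variable {E : Type*} [NormedAddCommGroup E] [NormedSpace ℝ E] [FiniteDimensional ℝ E]
  {M : Type*} [MetricSpace M] [ChartedSpace E M] [IsManifold 𝓘(ℝ, E) ∞ M]
  [RiemannianBundle (fun x : M => TangentSpace 𝓘(ℝ, E) x)]

/-- A linear functional that is dominated by the metric changes along a curve, in a chart, by at
most the length of the curve. -/
theorem ofReal_abs_sub_le_mul_pathELength (p : M) {γ : ℝ → M} {a b : ℝ} (hab : a ≤ b)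
    (hγ : ContMDiff 𝓘(ℝ, ℝ) 𝓘(ℝ, E) 1 γ) (hs : ∀ t ∈ Icc a b, γ t ∈ (chartAt E p).source)
    (f : E →L[ℝ] ℝ) {A : ℝ} (hA : 0 ≤ A)
    (hf : ∀ t ∈ Ioo a b, ∀ v, f v ^ 2 ≤ A ^ 2 * metricForm p (chartCurve E p γ t) v v) :
    ENNReal.ofReal |f (chartCurve E p γ b) - f (chartCurve E p γ a)| ≤
      ENNReal.ofReal A * pathELength 𝓘(ℝ, E) γ a b := by
  have hx : ContDiffOn ℝ 1 (chartCurve E p γ) (Icc a b) := by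
    rw [← contMDiffOn_iff_contDiffOn]
    exact (contMDiffOn_extChartAt (I := 𝓘(ℝ, E)) (x := p)).comp hγ.contMDiffOn hs
  have hfx : ContDiffOn ℝ 1 (fun t => f (chartCurve E p γ t)) (Icc a b) :=
    f.contDiff.comp_contDiffOn hx
  have h1 := enorm_sub_le_lintegral_deriv_of_contDiffOn_Icc hfx hab
  rw [← Real.enorm_eq_ofReal_abs]
  refine h1.trans ?_
  rw [pathELength_eq_lintegral_curveSpeed,
    ← MeasureTheory.lintegral_const_mul' _ _ ENNReal.ofReal_ne_top,
    ← MeasureTheory.restrict_Ioo_eq_restrict_Icc]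
  refine MeasureTheory.setLIntegral_mono' measurableSet_Ioo fun t ht => ?_
  obtain ⟨h2, h3⟩ := curveSpeed_sq_eq p (hγ.mdifferentiableAt one_ne_zero)
    (hs t (Ioo_subset_Icc_self ht))
  have h4 : deriv (fun t => f (chartCurve E p γ t)) t = f (deriv (chartCurve E p γ) t) :=
    (f.hasFDerivAt.comp_hasDerivAt t h2.hasDerivAt).deriv
  rw [h4, Real.enorm_eq_ofReal_abs, ← ENNReal.ofReal_mul hA]
  refine ENNReal.ofReal_le_ofReal (abs_le_of_sq_le_sq ?_
    (mul_nonneg hA (curveSpeed_nonneg _ _)))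
  rw [mul_pow, h3]
  exact hf t ht _

variable [IsRiemannianManifold 𝓘(ℝ, E) M]

/-- The distance is the infimum of lengths, and near-optimal paths can be made locally constant at
the end points, which makes them `C¹` on all of `ℝ`. -/
theorem exists_contMDiff_path {x y : M} {L : ℝ} (hL : dist x y < L) :
    ∃ γ : ℝ → M, γ 0 = x ∧ γ 1 = y ∧ ContMDiff 𝓘(ℝ, ℝ) 𝓘(ℝ, E) 1 γ ∧
      pathELength 𝓘(ℝ, E) γ 0 1 < ENNReal.ofReal L := by
  have h : riemannianEDist 𝓘(ℝ, E) x y < ENNReal.ofReal L := by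
    rw [← IsRiemannianManifold.out (I := 𝓘(ℝ, E)) x y, edist_dist]
    exact (ENNReal.ofReal_lt_ofReal_iff (dist_nonneg.trans_lt hL)).2 hL
  obtain ⟨γ, h0, h1, h2, h3, -⟩ := exists_lt_locally_constant_of_riemannianEDist_lt h zero_lt_one
  exact ⟨γ, h0, h1, h2, h3⟩

theorem ofReal_dist_le_pathELength {γ : ℝ → M} {a b : ℝ}
    (hγ : ContMDiffOn 𝓘(ℝ, ℝ) 𝓘(ℝ, E) 1 γ (Icc a b)) (hab : a ≤ b) :
    ENNReal.ofReal (dist (γ a) (γ b)) ≤ pathELength 𝓘(ℝ, E) γ a b := by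
  rw [← edist_dist, IsRiemannianManifold.out (I := 𝓘(ℝ, E))]
  exact riemannianEDist_le_pathELength hγ rfl rfl hab

/-- The distance of the end points of a `C¹` curve in a chart is at most its length. -/
theorem dist_le_integral_sqrt (p : M)
    [IsContMDiffRiemannianBundle 𝓘(ℝ, E) ∞ E (fun x : M => TangentSpace 𝓘(ℝ, E) x)]
    {y : ℝ → E} {a b : ℝ} {O : Set ℝ} (hab : a ≤ b)
    (hO : IsOpen O) (hsubO : Icc a b ⊆ O) (hy : ContDiffOn ℝ 1 y O)
    (hT : ∀ t ∈ O, y t ∈ (extChartAt 𝓘(ℝ, E) p).target) :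
    dist ((extChartAt 𝓘(ℝ, E) p).symm (y a)) ((extChartAt 𝓘(ℝ, E) p).symm (y b)) ≤
      ∫ t in a..b, √(metricForm p (y t) (deriv y t) (deriv y t)) := by
  set γ : ℝ → M := fun t => (extChartAt 𝓘(ℝ, E) p).symm (y t) with hγdef
  have hγ : ContMDiffOn 𝓘(ℝ, ℝ) 𝓘(ℝ, E) 1 γ O :=
    (contMDiffOn_extChartAt_symm p).comp hy.contMDiffOn hT
  have h1 := ofReal_dist_le_pathELength (hγ.mono hsubO) hab
  have hyc : ∀ t ∈ O, chartCurve E p γ t = y t := fun t ht =>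
    (extChartAt 𝓘(ℝ, E) p).right_inv (hT t ht)
  have hcont : ContinuousOn (fun t => √(metricForm p (y t) (deriv y t) (deriv y t))) O := by
    have hd : ContinuousOn (deriv y) O := hy.continuousOn_deriv_of_isOpen hO le_rfl
    have hG : ContinuousOn (fun t => metricForm p (y t)) O :=
      (contDiffOn_metricForm p).continuousOn.comp hy.continuousOn hT
    exact ((hG.clm_apply hd).clm_apply hd).sqrt
  have hint : MeasureTheory.IntegrableOn
      (fun t => √(metricForm p (y t) (deriv y t) (deriv y t))) (Icc a b) :=
    (hcont.mono hsubO).integrableOn_Icc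
  have h2 : pathELength 𝓘(ℝ, E) γ a b =
      ENNReal.ofReal (∫ t in a..b, √(metricForm p (y t) (deriv y t) (deriv y t))) := by
    rw [intervalIntegral.integral_of_le hab, ← MeasureTheory.integral_Icc_eq_integral_Ioc,
      MeasureTheory.ofReal_integral_eq_lintegral_ofReal hint
        (Filter.Eventually.of_forall fun t => Real.sqrt_nonneg _),
      pathELength_eq_lintegral_curveSpeed, MeasureTheory.restrict_Ioo_eq_restrict_Icc]
    refine MeasureTheory.setLIntegral_congr_fun measurableSet_Icc fun t ht => ?_
    have htO := hsubO ht
    have hev : chartCurve E p γ =ᶠ[𝓝 t] y := by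
      filter_upwards [hO.mem_nhds htO] with s hs using hyc s hs
    have h3 := (curveSpeed_sq_eq p
      ((hγ.contMDiffAt (hO.mem_nhds htO)).mdifferentiableAt one_ne_zero)
      (by simpa [hγdef] using (extChartAt 𝓘(ℝ, E) p).map_target (hT t htO))).2
    rw [hev.deriv_eq, hev.self_of_nhds] at h3
    rw [← h3, Real.sqrt_sq (curveSpeed_nonneg _ _)]
  rw [h2] at h1
  exact (ENNReal.ofReal_le_ofReal_iff
    (intervalIntegral.integral_nonneg hab fun t _ => Real.sqrt_nonneg _)).1 h1

end ChartLength

/-! ### Instances for the space of bilinear forms -/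

section BilinearForms

variable {E : Type*} [NormedAddCommGroup E] [NormedSpace ℝ E]

noncomputable instance instNormedAddCommGroupBilinearForm :
    NormedAddCommGroup (E →L[ℝ] E →L[ℝ] ℝ) :=
  ContinuousLinearMap.toNormedAddCommGroup

instance instContinuousSubBilinearForm : ContinuousSub (E →L[ℝ] E →L[ℝ] ℝ) :=
  IsTopologicalAddGroup.to_continuousSub

end BilinearForms

/-! ### Uniform bounds for the metric on small coordinate balls -/

section ChartBounds

/-- A positive definite form on a finite-dimensional space is bounded below. -/
theorem exists_mul_norm_sq_le {E : Type*} [NormedAddCommGroup E] [NormedSpace ℝ E]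
    [FiniteDimensional ℝ E] (B : E →L[ℝ] E →L[ℝ] ℝ) (hB : ∀ v, v ≠ 0 → 0 < B v v) :
    ∃ c > 0, ∀ v, c * ‖v‖ ^ 2 ≤ B v v := by
  rcases subsingleton_or_nontrivial E with h | h
  · exact ⟨1, one_pos, fun v => by simp [Subsingleton.elim v 0]⟩
  obtain ⟨v₀, hv₀, hmin⟩ := (isCompact_sphere (0 : E) 1).exists_isMinOn
    (NormedSpace.sphere_nonempty.2 zero_le_one)
    (f := fun v => B v v) (B.continuous.clm_apply continuous_id).continuousOn
  have hv₀' : v₀ ≠ 0 := by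
    rintro rfl
    simp at hv₀
  refine ⟨B v₀ v₀, hB _ hv₀', fun v => ?_⟩
  rcases eq_or_ne v 0 with rfl | hv
  · simp
  have hn : 0 < ‖v‖ := norm_pos_iff.2 hv
  have h1 : B v₀ v₀ ≤ B (‖v‖⁻¹ • v) (‖v‖⁻¹ • v) := hmin (by
    simp [norm_smul, hn.ne'])
  simp only [map_smul, smul_apply, smul_eq_mul] at h1
  calc B v₀ v₀ * ‖v‖ ^ 2 ≤ (‖v‖⁻¹ * (‖v‖⁻¹ * B v v)) * ‖v‖ ^ 2 := by gcongr
    _ = B v v := by field_simp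

variable {E : Type*} [NormedAddCommGroup E] [NormedSpace ℝ E] [FiniteDimensional ℝ E]
  {M : Type*} [MetricSpace M] [ChartedSpace E M] [IsManifold 𝓘(ℝ, E) ∞ M]
  [RiemannianBundle (fun x : M => TangentSpace 𝓘(ℝ, E) x)]

/-- On the closed ball of radius `r` around `x₀`, in the chart around `p`, the metric is bounded
below by `c`, bounded above by `C`, and Lipschitz with constant `C`. -/
structure ChartBounds (p : M) (x₀ : E) (r c C : ℝ) : Prop where
  r_pos : 0 < r
  c_pos : 0 < c
  C_pos : 0 < C
  subset : Metric.closedBall x₀ r ⊆ (extChartAt 𝓘(ℝ, E) p).target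
  lower : ∀ x ∈ Metric.closedBall x₀ r, ∀ v, c * ‖v‖ ^ 2 ≤ metricForm p x v v
  upper : ∀ x ∈ Metric.closedBall x₀ r, ‖metricForm p x‖ ≤ C
  lip : ∀ x ∈ Metric.closedBall x₀ r, ∀ y ∈ Metric.closedBall x₀ r,
    ‖metricForm p x - metricForm p y‖ ≤ C * ‖x - y‖

namespace ChartBounds

variable {p : M} {x₀ : E} {r c C : ℝ}

theorem mono (h : ChartBounds p x₀ r c C) {r' : ℝ} (hr' : 0 < r') (hr : r' ≤ r) :
    ChartBounds p x₀ r' c C where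
  r_pos := hr'
  c_pos := h.c_pos
  C_pos := h.C_pos
  subset := (Metric.closedBall_subset_closedBall hr).trans h.subset
  lower x hx := h.lower x (Metric.closedBall_subset_closedBall hr hx)
  upper x hx := h.upper x (Metric.closedBall_subset_closedBall hr hx)
  lip x hx y hy := h.lip x (Metric.closedBall_subset_closedBall hr hx) y
    (Metric.closedBall_subset_closedBall hr hy)

theorem le_norm_sq (h : ChartBounds p x₀ r c C) {x : E} (hx : x ∈ Metric.closedBall x₀ r) (v : E) :
    metricForm p x v v ≤ C * ‖v‖ ^ 2 := by
  have h1 := (metricForm p x).le_opNorm₂ v v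
  have h2 := h.upper x hx
  rw [Real.norm_eq_abs] at h1
  calc metricForm p x v v ≤ ‖metricForm p x‖ * ‖v‖ * ‖v‖ := (le_abs_self _).trans h1
    _ ≤ C * ‖v‖ * ‖v‖ := by gcongr
    _ = _ := by ring

theorem abs_sub_le (h : ChartBounds p x₀ r c C) {x y : E} (hx : x ∈ Metric.closedBall x₀ r)
    (hy : y ∈ Metric.closedBall x₀ r) (v : E) :
    |metricForm p x v v - metricForm p y v v| ≤ C * ‖x - y‖ * ‖v‖ ^ 2 := by
  have h1 := (metricForm p x - metricForm p y).le_opNorm₂ v v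
  have h2 := h.lip x hx y hy
  simp only [sub_apply, Real.norm_eq_abs] at h1
  calc _ ≤ ‖metricForm p x - metricForm p y‖ * ‖v‖ * ‖v‖ := h1
    _ ≤ C * ‖x - y‖ * ‖v‖ * ‖v‖ := by gcongr
    _ = _ := by ring

end ChartBounds

/-- Positive definiteness at `x₀` gives a lower bound `c` by compactness of the sphere, and
continuity preserves half of it nearby. The Lipschitz bound comes from local `C¹` regularity. -/
theorem exists_chartBounds (p : M)
    [IsContMDiffRiemannianBundle 𝓘(ℝ, E) ∞ E (fun x : M => TangentSpace 𝓘(ℝ, E) x)]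
    {x₀ : E} (hx₀ : x₀ ∈ (extChartAt 𝓘(ℝ, E) p).target) :
    ∃ r c C : ℝ, ChartBounds p x₀ r c C := by
  have hT := (isOpen_extChartAt_target (I := 𝓘(ℝ, E)) p).mem_nhds hx₀
  obtain ⟨c, hc, hlow⟩ := exists_mul_norm_sq_le (metricForm p x₀)
    fun v hv => metricForm_pos p hx₀ hv
  have hsm := (contDiffOn_metricForm p).contDiffAt hT
  obtain ⟨K, t, ht, hK⟩ := (hsm.of_le (m := 1) (by norm_num)).exists_lipschitzOnWith
  have hcont : ∀ᶠ x in 𝓝 x₀, ‖metricForm p x - metricForm p x₀‖ < min 1 (c / 2) := by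
    have := hsm.continuousAt.sub (continuousAt_const (y := metricForm p x₀))
    have := this.norm
    have h0 : ‖metricForm p x₀ - metricForm p x₀‖ < min 1 (c / 2) := by
      rw [sub_self, norm_zero]
      positivity
    exact this.eventually_lt continuousAt_const h0
  obtain ⟨r, hr, hrs⟩ := Metric.nhds_basis_closedBall.mem_iff.1
    (Filter.inter_mem hT (Filter.inter_mem ht hcont))
  refine ⟨r, c / 2, K + (‖metricForm p x₀‖ + 1), hr, by positivity, by positivity,
    fun x hx => (hrs hx).1, fun x hx v => ?_, fun x hx => ?_, fun x hx y hy => ?_⟩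
  · have h1 : ‖metricForm p x - metricForm p x₀‖ < min 1 (c / 2) := (hrs hx).2.2
    have h2 := (metricForm p x - metricForm p x₀).le_opNorm₂ v v
    simp only [sub_apply, Real.norm_eq_abs] at h2
    have h3 := (abs_le.1 h2).1
    have h4 : ‖metricForm p x - metricForm p x₀‖ * ‖v‖ * ‖v‖ ≤ (c / 2) * ‖v‖ * ‖v‖ := by
      gcongr
      exact (h1.trans_le (min_le_right _ _)).le
    have h5 := hlow v
    nlinarith
  · have h1 : ‖metricForm p x - metricForm p x₀‖ < min 1 (c / 2) := (hrs hx).2.2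
    have h2 : ‖metricForm p x‖ ≤ ‖metricForm p x - metricForm p x₀‖ + ‖metricForm p x₀‖ := by
      simpa using norm_add_le (metricForm p x - metricForm p x₀) (metricForm p x₀)
    have h3 := (h1.trans_le (min_le_left _ _)).le
    have := K.coe_nonneg
    linarith
  · have h1 := hK.dist_le_mul x (hrs hx).2.1 y (hrs hy).2.1
    rw [dist_eq_norm, dist_eq_norm] at h1
    refine h1.trans ?_
    have : 0 ≤ ‖metricForm p x₀‖ + 1 := by positivity
    gcongr
    linarith

end ChartBounds

/-! ### Comparison of the distance with the metric at a nearby point -/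

section ChartDistance

variable {E : Type*} [NormedAddCommGroup E] [NormedSpace ℝ E] [FiniteDimensional ℝ E]
  {M : Type*} [MetricSpace M] [ChartedSpace E M] [IsManifold 𝓘(ℝ, E) ∞ M]
  [RiemannianBundle (fun x : M => TangentSpace 𝓘(ℝ, E) x)]

theorem metricForm_cauchySchwarz (p : M) (x v w : E) :
    metricForm p x v w ^ 2 ≤ metricForm p x v v * metricForm p x w w := by
  rw [metricForm_self_eq_norm, metricForm_self_eq_norm, metricForm_apply, chartMetric, ← mul_pow]
  exact sq_le_sq' (by linarith [(abs_le.1 (abs_real_inner_le_norm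
    (mfderiv 𝓘(ℝ, E) 𝓘(ℝ, E) (extChartAt 𝓘(ℝ, E) p).symm x v)
    (mfderiv 𝓘(ℝ, E) 𝓘(ℝ, E) (extChartAt 𝓘(ℝ, E) p).symm x w))).1]) (real_inner_le_norm _ _)

variable [IsRiemannianManifold 𝓘(ℝ, E) M]

namespace ChartBounds

variable {p : M} {x₀ : E} {r c C : ℝ}

/-- The straight coordinate segment from `x` to `y` is a competitor whose speed is at most `S`. -/
theorem dist_le_of_forall_le
    [IsContMDiffRiemannianBundle 𝓘(ℝ, E) ∞ E (fun x : M => TangentSpace 𝓘(ℝ, E) x)]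
    (h : ChartBounds p x₀ r c C) {x y : E} (hx : x ∈ Metric.ball x₀ r) (hy : y ∈ Metric.ball x₀ r)
    {S : ℝ} (hS : 0 ≤ S)
    (hGS : ∀ t ∈ Icc (0 : ℝ) 1, metricForm p (x + t • (y - x)) (y - x) (y - x) ≤ S ^ 2) :
    dist ((extChartAt 𝓘(ℝ, E) p).symm x) ((extChartAt 𝓘(ℝ, E) p).symm y) ≤ S := by
  set l : ℝ → E := fun t => x + t • (y - x) with hl
  have hls : ContDiff ℝ 1 l := by fun_prop
  have hO : IsOpen (l ⁻¹' Metric.ball x₀ r) := Metric.isOpen_ball.preimage hls.continuous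
  have hI : Icc (0 : ℝ) 1 ⊆ l ⁻¹' Metric.ball x₀ r := fun t ht =>
    (convex_ball x₀ r).add_smul_sub_mem hx hy ht
  have hd : ∀ t, deriv l t = y - x := by
    intro t
    have h1 : HasDerivAt l ((1 : ℝ) • (y - x)) t :=
      ((hasDerivAt_id t).smul_const (y - x)).const_add x
    simpa using h1.deriv
  have h1 := dist_le_integral_sqrt p zero_le_one hO hI hls.contDiffOn
    (fun t ht => h.subset (Metric.ball_subset_closedBall ht))
  have h2 : ∫ t in (0 : ℝ)..1, √(metricForm p (l t) (deriv l t) (deriv l t)) ≤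
      ∫ t in (0 : ℝ)..1, S := by
    rw [intervalIntegral.integral_of_le zero_le_one, intervalIntegral.integral_of_le zero_le_one]
    refine MeasureTheory.integral_mono_of_nonneg
      (Filter.Eventually.of_forall fun t => Real.sqrt_nonneg _) (by simp) ?_
    filter_upwards [MeasureTheory.self_mem_ae_restrict measurableSet_Ioc] with t ht
    rw [hd]
    exact Real.sqrt_le_iff.2 ⟨hS, hGS t (Ioc_subset_Icc_self ht)⟩
  have h3 : l 0 = x := by simp [hl]
  have h4 : l 1 = y := by simp [hl]
  rw [h3, h4] at h1
  simpa using h1.trans h2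

/-- A short curve starting in a chart stays in the chart. -/
theorem path_mem (h : ChartBounds p x₀ r c C) {ρ : ℝ}
    (hρ : ∀ z, dist z ((extChartAt 𝓘(ℝ, E) p).symm x₀) < ρ → z ∈ (chartAt E p).source ∧
      extChartAt 𝓘(ℝ, E) p z ∈ Metric.closedBall x₀ r)
    {x : E} (hx : x ∈ Metric.closedBall x₀ r) {L : ℝ}
    (hL : dist ((extChartAt 𝓘(ℝ, E) p).symm x) ((extChartAt 𝓘(ℝ, E) p).symm x₀) + L ≤ ρ)
    {γ : ℝ → M} (hγ : ContMDiff 𝓘(ℝ, ℝ) 𝓘(ℝ, E) 1 γ)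
    (hγ0 : γ 0 = (extChartAt 𝓘(ℝ, E) p).symm x)
    (hγL : pathELength 𝓘(ℝ, E) γ 0 1 < ENNReal.ofReal L) {t : ℝ} (ht : t ∈ Icc (0 : ℝ) 1) :
    γ t ∈ (chartAt E p).source ∧ chartCurve E p γ t ∈ Metric.closedBall x₀ r ∧
      ‖chartCurve E p γ t - x‖ ≤ √c⁻¹ * L := by
  have hL0 : 0 < L := by
    by_contra hcon
    rw [ENNReal.ofReal_of_nonpos (not_lt.1 hcon)] at hγL
    exact not_lt_bot hγL
  have key : ∀ s ∈ Icc (0 : ℝ) 1, γ s ∈ (chartAt E p).source ∧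
      chartCurve E p γ s ∈ Metric.closedBall x₀ r := by
    intro s hs
    have h1 := ofReal_dist_le_pathELength (hγ.contMDiffOn (s := Icc 0 s)) hs.1
    have h2 : ENNReal.ofReal (dist (γ 0) (γ s)) < ENNReal.ofReal L :=
      h1.trans_lt ((pathELength_mono le_rfl hs.2).trans_lt hγL)
    rw [ENNReal.ofReal_lt_ofReal_iff hL0] at h2
    refine hρ _ ?_
    have h3 := dist_triangle (γ s) (γ 0) ((extChartAt 𝓘(ℝ, E) p).symm x₀)
    rw [dist_comm (γ s) (γ 0), hγ0] at h3
    rw [hγ0] at h2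
    linarith
  refine ⟨(key t ht).1, (key t ht).2, ?_⟩
  -- A norming functional for the displacement is dominated by the metric with constant `√c⁻¹`, so
  -- its growth along the path is controlled by length.
  obtain ⟨f, hf1, hf2⟩ := exists_dual_vector'' ℝ (chartCurve E p γ t - x)
  have hc := h.c_pos
  have h1 := ofReal_abs_sub_le_mul_pathELength p ht.1 hγ
    (fun s hs => (key s ⟨hs.1, hs.2.trans ht.2⟩).1) f (A := √c⁻¹) (Real.sqrt_nonneg _)
    (fun s hs v => by
      rw [Real.sq_sqrt (by positivity)]
      have h1 := h.lower _ (key s ⟨hs.1.le, hs.2.le.trans ht.2⟩).2 v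
      have h2 : |f v| ≤ ‖v‖ := (f.le_opNorm v).trans (by nlinarith [norm_nonneg v])
      have h3 : f v ^ 2 ≤ ‖v‖ ^ 2 := by
        rw [← sq_abs]
        gcongr
      rw [inv_mul_eq_div, le_div_iff₀ hc]
      nlinarith)
  have hx0 : chartCurve E p γ 0 = x := by
    rw [chartCurve, hγ0]
    exact (extChartAt 𝓘(ℝ, E) p).right_inv (h.subset hx)
  rw [hx0, ← map_sub, hf2] at h1
  have h2 := h1.trans (mul_le_mul_right ((pathELength_mono le_rfl ht.2).trans hγL.le) _)
  rw [← ENNReal.ofReal_mul (Real.sqrt_nonneg _), ENNReal.ofReal_le_ofReal_iff (by positivity)] at h2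
  exact (le_abs_self _).trans h2

/-- A path of length below `L` from `x` to `y` stays in the ball, where the form at `m` exceeds the
form on the path by a factor of at most `B = 1 + C c⁻¹ (δ + √c⁻¹ L)`. Put `g = g_m(y - x, y - x)`.
By Cauchy-Schwarz the functional `g_m(y - x, ·)` is at most `√(g B)` times the speed, so `g ≤ √(g B)
L` and hence `g ≤ B L²`. Finally `L` decreases to `d`. -/
theorem metricForm_le_dist_sq (h : ChartBounds p x₀ r c C) {ρ : ℝ}
    (hρ : ∀ z, dist z ((extChartAt 𝓘(ℝ, E) p).symm x₀) < ρ → z ∈ (chartAt E p).source ∧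
      extChartAt 𝓘(ℝ, E) p z ∈ Metric.closedBall x₀ r)
    {m x y : E} (hm : m ∈ Metric.closedBall x₀ r) (hx : x ∈ Metric.closedBall x₀ r)
    (hy : y ∈ Metric.closedBall x₀ r) {δ d : ℝ} (hδ : ‖x - m‖ ≤ δ)
    (hd : d = dist ((extChartAt 𝓘(ℝ, E) p).symm x) ((extChartAt 𝓘(ℝ, E) p).symm y))
    (hdρ : dist ((extChartAt 𝓘(ℝ, E) p).symm x) ((extChartAt 𝓘(ℝ, E) p).symm x₀) + d < ρ) :
    ‖y - x‖ ≤ √c⁻¹ * d ∧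
    metricForm p m (y - x) (y - x) ≤ (1 + C * c⁻¹ * (δ + √c⁻¹ * d)) * d ^ 2 := by
  have hc := h.c_pos
  have hC := h.C_pos
  have hd0 : 0 ≤ d := hd ▸ dist_nonneg
  have hδ0 : 0 ≤ δ := (norm_nonneg _).trans hδ
  have key : ∀ L, d < L →
      dist ((extChartAt 𝓘(ℝ, E) p).symm x) ((extChartAt 𝓘(ℝ, E) p).symm x₀) + L ≤ ρ →
      ‖y - x‖ ≤ √c⁻¹ * L ∧
      metricForm p m (y - x) (y - x) ≤ (1 + C * c⁻¹ * (δ + √c⁻¹ * L)) * L ^ 2 := by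
    intro L hL hLρ
    have hL0 : 0 < L := hd0.trans_lt hL
    obtain ⟨γ, hγ0, hγ1, hγ, hγL⟩ := exists_contMDiff_path (E := E) (hd ▸ hL)
    have hmem := fun t ht => h.path_mem hρ hx hLρ hγ hγ0 hγL (t := t) ht
    have hx0 : chartCurve E p γ 0 = x := by
      rw [chartCurve, hγ0]
      exact (extChartAt 𝓘(ℝ, E) p).right_inv (h.subset hx)
    have hy1 : chartCurve E p γ 1 = y := by
      rw [chartCurve, hγ1]
      exact (extChartAt 𝓘(ℝ, E) p).right_inv (h.subset hy)
    have h1 := (hmem 1 (by simp)).2.2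
    rw [hy1] at h1
    refine ⟨h1, ?_⟩
    set g := metricForm p m (y - x) (y - x) with hg
    have hg0 : 0 ≤ g := metricForm_self_nonneg _ _ _
    set B := 1 + C * c⁻¹ * (δ + √c⁻¹ * L) with hB
    have hB0 : 0 ≤ B := by positivity
    have h2 := ofReal_abs_sub_le_mul_pathELength p zero_le_one hγ
      (fun s hs => (hmem s hs).1) (metricForm p m (y - x)) (A := √(g * B)) (Real.sqrt_nonneg _)
      (fun s hs v => by
        rw [Real.sq_sqrt (by positivity)]
        obtain ⟨-, h3, h4⟩ := hmem s (Ioo_subset_Icc_self hs)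
        have h5 := metricForm_cauchySchwarz p m (y - x) v
        have h6 := (abs_le.1 (h.abs_sub_le hm h3 v)).2
        have h7 : ‖m - chartCurve E p γ s‖ ≤ δ + √c⁻¹ * L := by
          rw [norm_sub_rev]
          calc _ = ‖(chartCurve E p γ s - x) + (x - m)‖ := by abel_nf
            _ ≤ ‖chartCurve E p γ s - x‖ + ‖x - m‖ := norm_add_le _ _
            _ ≤ _ := by linarith
        have h8 := h.lower _ h3 v
        have h9 : ‖v‖ ^ 2 ≤ c⁻¹ * metricForm p (chartCurve E p γ s) v v := by
          rw [inv_mul_eq_div, le_div_iff₀ hc]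
          linarith
        have h10 : C * ‖m - chartCurve E p γ s‖ * ‖v‖ ^ 2 ≤
            C * (δ + √c⁻¹ * L) * (c⁻¹ * metricForm p (chartCurve E p γ s) v v) := by
          gcongr
        have h11 : metricForm p m v v ≤ B * metricForm p (chartCurve E p γ s) v v := by
          rw [hB]
          linarith
        calc _ ≤ g * metricForm p m v v := h5
          _ ≤ g * (B * metricForm p (chartCurve E p γ s) v v) := by gcongr
          _ = _ := by ring)
    rw [hx0, hy1, ← map_sub] at h2
    have h3 := h2.trans (mul_le_mul_right hγL.le _)
    rw [← ENNReal.ofReal_mul (Real.sqrt_nonneg _), ENNReal.ofReal_le_ofReal_iff (by positivity)]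
      at h3
    have h4 : g ≤ √(g * B) * L := (le_abs_self _).trans h3
    have h5 : g ^ 2 ≤ g * B * L ^ 2 := by
      calc g ^ 2 ≤ (√(g * B) * L) ^ 2 := by gcongr
        _ = _ := by rw [mul_pow, Real.sq_sqrt (by positivity)]
    rcases hg0.eq_or_lt with h0 | h0
    · rw [← h0]
      positivity
    · nlinarith
  have hev : ∀ᶠ L in 𝓝[>] d, d < L ∧
      dist ((extChartAt 𝓘(ℝ, E) p).symm x) ((extChartAt 𝓘(ℝ, E) p).symm x₀) + L ≤ ρ := by
    have := Ioo_mem_nhdsGT (show d < ρ -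
      dist ((extChartAt 𝓘(ℝ, E) p).symm x) ((extChartAt 𝓘(ℝ, E) p).symm x₀) by linarith)
    filter_upwards [this] with L hL
    exact ⟨hL.1, by linarith [hL.2]⟩
  constructor
  · have ht : Filter.Tendsto (fun L => √c⁻¹ * L) (𝓝[>] d) (𝓝 (√c⁻¹ * d)) :=
      (Continuous.tendsto (by fun_prop) d).mono_left nhdsWithin_le_nhds
    exact ge_of_tendsto ht (hev.mono fun L hL => (key L hL.1 hL.2).1)
  · have ht : Filter.Tendsto (fun L => (1 + C * c⁻¹ * (δ + √c⁻¹ * L)) * L ^ 2) (𝓝[>] d)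
        (𝓝 ((1 + C * c⁻¹ * (δ + √c⁻¹ * d)) * d ^ 2)) :=
      (Continuous.tendsto (by fun_prop) d).mono_left nhdsWithin_le_nhds
    exact ge_of_tendsto ht (hev.mono fun L hL => (key L hL.1 hL.2).2)

end ChartBounds

/-- The distance of points in a chart: the chart is Lipschitz near `x₀`, and the squared
distance agrees with the metric at a nearby point, up to an error of third order. -/
structure ChartDistBounds (p : M) (x₀ : E) (r c C K : ℝ) : Prop extends
    ChartBounds p x₀ r c C where
  K_pos : 0 < K
  norm_le : ∀ x ∈ Metric.closedBall x₀ r, ∀ y ∈ Metric.closedBall x₀ r,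
    ‖y - x‖ ≤ K * dist ((extChartAt 𝓘(ℝ, E) p).symm x) ((extChartAt 𝓘(ℝ, E) p).symm y)
  abs_le : ∀ m ∈ Metric.closedBall x₀ r, ∀ x ∈ Metric.closedBall x₀ r,
    ∀ y ∈ Metric.closedBall x₀ r, ∀ δ, ‖x - m‖ ≤ δ → ‖y - m‖ ≤ δ →
    |dist ((extChartAt 𝓘(ℝ, E) p).symm x) ((extChartAt 𝓘(ℝ, E) p).symm y) ^ 2 -
      metricForm p m (y - x) (y - x)| ≤ K * δ ^ 3

/-- The segment bounds the distance from above, `ChartBounds.metricForm_le_dist_sq` bounds it from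
below. In both estimates the metric varies by `O(δ)` while the squared length is `O(δ²)`, whence the
third order error. -/
theorem exists_chartDistBounds
    [IsContMDiffRiemannianBundle 𝓘(ℝ, E) ∞ E (fun x : M => TangentSpace 𝓘(ℝ, E) x)]
    (p : M) {x₀ : E} (hx₀ : x₀ ∈ (extChartAt 𝓘(ℝ, E) p).target) :
    ∃ r c C K : ℝ, ChartDistBounds p x₀ r c C K := by
  obtain ⟨r, c, C, h⟩ := exists_chartBounds p hx₀
  have hc := h.c_pos
  have hC := h.C_pos
  have hz₀ : (extChartAt 𝓘(ℝ, E) p).symm x₀ ∈ (extChartAt 𝓘(ℝ, E) p).source :=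
    (extChartAt 𝓘(ℝ, E) p).map_target hx₀
  obtain ⟨ρ, hρ0, hρ⟩ : ∃ ρ > 0, ∀ z, dist z ((extChartAt 𝓘(ℝ, E) p).symm x₀) < ρ →
      z ∈ (chartAt E p).source ∧ extChartAt 𝓘(ℝ, E) p z ∈ Metric.closedBall x₀ r := by
    have h1 : ∀ᶠ z in 𝓝 ((extChartAt 𝓘(ℝ, E) p).symm x₀), z ∈ (chartAt E p).source := by
      simpa using extChartAt_source_mem_nhds' hz₀
    have h2 : ∀ᶠ z in 𝓝 ((extChartAt 𝓘(ℝ, E) p).symm x₀),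
        extChartAt 𝓘(ℝ, E) p z ∈ Metric.closedBall x₀ r := by
      refine (continuousAt_extChartAt' hz₀).eventually ?_
      rw [(extChartAt 𝓘(ℝ, E) p).right_inv hx₀]
      exact Metric.closedBall_mem_nhds _ h.r_pos
    obtain ⟨ρ, hρ0, hρ⟩ := Metric.eventually_nhds_iff.1 (h1.and h2)
    exact ⟨ρ, hρ0, fun z hz => hρ hz⟩
  -- With `ρ / 4` here, `d(x, x₀) + d(x, y) < ρ / 4 + ρ / 2`, so nearly shortest paths between
  -- points of the small ball cannot leave the chart ball.
  obtain ⟨r₁, hr₁, hr₁ρ⟩ : ∃ r₁ > 0, ∀ x ∈ Metric.closedBall x₀ r₁,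
      dist ((extChartAt 𝓘(ℝ, E) p).symm x) ((extChartAt 𝓘(ℝ, E) p).symm x₀) < ρ / 4 := by
    have h1 := (continuousAt_extChartAt_symm'' hx₀).eventually (Metric.ball_mem_nhds _
      (show 0 < ρ / 4 by positivity))
    obtain ⟨r₁, hr₁, h2⟩ := Metric.nhds_basis_closedBall.mem_iff.1 h1
    exact ⟨r₁, hr₁, fun x hx => h2 hx⟩
  set r₂ := min r₁ (r / 2) with hr₂
  have hr := h.r_pos
  have hr₂0 : 0 < r₂ := by positivity
  have hr₂r : r₂ < r := (min_le_right _ _).trans_lt (by linarith)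
  have hsub : Metric.closedBall x₀ r₂ ⊆ Metric.closedBall x₀ r :=
    Metric.closedBall_subset_closedBall hr₂r.le
  have hsub' : Metric.closedBall x₀ r₂ ⊆ Metric.ball x₀ r := Metric.closedBall_subset_ball hr₂r
  have hdρ : ∀ x ∈ Metric.closedBall x₀ r₂, ∀ y ∈ Metric.closedBall x₀ r₂,
      dist ((extChartAt 𝓘(ℝ, E) p).symm x) ((extChartAt 𝓘(ℝ, E) p).symm x₀) +
        dist ((extChartAt 𝓘(ℝ, E) p).symm x) ((extChartAt 𝓘(ℝ, E) p).symm y) < ρ := by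
    intro x hx y hy
    have h1 := hr₁ρ x (Metric.closedBall_subset_closedBall (min_le_left _ _) hx)
    have h2 := hr₁ρ y (Metric.closedBall_subset_closedBall (min_le_left _ _) hy)
    have h3 := dist_triangle_right ((extChartAt 𝓘(ℝ, E) p).symm x)
      ((extChartAt 𝓘(ℝ, E) p).symm y) ((extChartAt 𝓘(ℝ, E) p).symm x₀)
    linarith
  have hup : ∀ x ∈ Metric.closedBall x₀ r₂, ∀ y ∈ Metric.closedBall x₀ r₂,
      dist ((extChartAt 𝓘(ℝ, E) p).symm x) ((extChartAt 𝓘(ℝ, E) p).symm y) ≤ √C * ‖y - x‖ := by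
    intro x hx y hy
    refine h.dist_le_of_forall_le (hsub' hx) (hsub' hy) (by positivity) fun t ht => ?_
    rw [mul_pow, Real.sq_sqrt hC.le]
    exact h.le_norm_sq ((convex_closedBall x₀ r).add_smul_sub_mem (hsub hx) (hsub hy) ht) _
  -- `K` is a sum of nonnegative constants: `√c⁻¹` serves `norm_le`, `4 C` the upper and the last
  -- term the lower estimate of the squared distance.
  refine ⟨r₂, c, C, √c⁻¹ + √C + (4 * C + C * c⁻¹ * (1 + √c⁻¹ * (√C * 2)) * (√C * 2) ^ 2),
    { toChartBounds := h.mono hr₂0 hr₂r.le, K_pos := by positivity, norm_le := ?_,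
      abs_le := ?_ }⟩
  · intro x hx y hy
    have h1 := (h.metricForm_le_dist_sq hρ (hsub hx) (hsub hx) (hsub hy) le_rfl rfl
      (hdρ x hx y hy)).1
    refine h1.trans (mul_le_mul_of_nonneg_right ?_ dist_nonneg)
    have : 0 ≤ √C + (4 * C + C * c⁻¹ * (1 + √c⁻¹ * (√C * 2)) * (√C * 2) ^ 2) := by positivity
    linarith
  · intro m hm x hx y hy δ hxδ hyδ
    have hδ0 : 0 ≤ δ := (norm_nonneg _).trans hxδ
    set d := dist ((extChartAt 𝓘(ℝ, E) p).symm x) ((extChartAt 𝓘(ℝ, E) p).symm y) with hd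
    have hyx : ‖y - x‖ ≤ 2 * δ := by
      calc ‖y - x‖ = ‖(y - m) - (x - m)‖ := by abel_nf
        _ ≤ ‖y - m‖ + ‖x - m‖ := norm_sub_le _ _
        _ ≤ _ := by linarith
    have hd2 : d ≤ (√C * 2) * δ := by
      calc d ≤ √C * ‖y - x‖ := hup x hx y hy
        _ ≤ √C * (2 * δ) := by gcongr
        _ = _ := by ring
    have hd0 : 0 ≤ d := dist_nonneg
    have h1 := (h.metricForm_le_dist_sq hρ (hsub hm) (hsub hx) (hsub hy) hxδ hd
      (hdρ x hx y hy)).2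
    have h2 : d ^ 2 ≤ metricForm p m (y - x) (y - x) + 4 * C * δ ^ 3 := by
      have hnn : 0 ≤ metricForm p m (y - x) (y - x) + 4 * C * δ ^ 3 := by
        have := metricForm_self_nonneg p m (y - x)
        positivity
      have h3 : d ≤ √(metricForm p m (y - x) (y - x) + 4 * C * δ ^ 3) := by
        refine h.dist_le_of_forall_le (hsub' hx) (hsub' hy) (by positivity) fun t ht => ?_
        rw [Real.sq_sqrt hnn]
        have h4 := (convex_closedBall x₀ r).add_smul_sub_mem (hsub hx) (hsub hy) ht
        have h5 := (abs_le.1 (h.abs_sub_le h4 (hsub hm) (y - x))).2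
        have h6 : ‖x + t • (y - x) - m‖ ≤ δ := by
          have := (convex_closedBall m δ).add_smul_sub_mem
            (mem_closedBall_iff_norm.2 hxδ) (mem_closedBall_iff_norm.2 hyδ) ht
          exact mem_closedBall_iff_norm.1 this
        have h7 : C * ‖x + t • (y - x) - m‖ * ‖y - x‖ ^ 2 ≤ C * δ * (2 * δ) ^ 2 := by gcongr
        linarith
      calc d ^ 2 ≤ √(metricForm p m (y - x) (y - x) + 4 * C * δ ^ 3) ^ 2 := by gcongr
        _ = _ := Real.sq_sqrt hnn
    have h8 : C * c⁻¹ * (δ + √c⁻¹ * d) * d ^ 2 ≤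
        C * c⁻¹ * (1 + √c⁻¹ * (√C * 2)) * (√C * 2) ^ 2 * δ ^ 3 := by
      calc _ ≤ C * c⁻¹ * (δ + √c⁻¹ * ((√C * 2) * δ)) * ((√C * 2) * δ) ^ 2 := by gcongr
        _ = _ := by ring
    have h9 : 0 ≤ (√c⁻¹ + √C) * δ ^ 3 := by positivity
    have h10 : 0 ≤ 4 * C * δ ^ 3 := by positivity
    have h11 : 0 ≤ C * c⁻¹ * (1 + √c⁻¹ * (√C * 2)) * (√C * 2) ^ 2 * δ ^ 3 := by positivity
    rw [_root_.abs_le]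
    constructor
    · linarith
    · linarith

end ChartDistance

/-! ### From second differences to differentiability -/

section SecondDifference

variable {E : Type*} [NormedAddCommGroup E] [NormedSpace ℝ E] [CompleteSpace E]

theorem exists_primitive_of_continuousOn_Ioo {f : ℝ → E} {a b : ℝ}
    (hf : ContinuousOn f (Ioo a b)) : ∃ F : ℝ → E, ∀ s ∈ Ioo a b, HasDerivAt F (f s) s := by
  refine ⟨fun s => ∫ t in ((a + b) / 2)..s, f t, fun s hs => ?_⟩
  have hmid : (a + b) / 2 ∈ Ioo a b := by
    have := hs.1.trans hs.2
    constructor <;> linarith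
  refine intervalIntegral.integral_hasDerivAt_right ?_
    (hf.stronglyMeasurableAtFilter isOpen_Ioo s hs) (hf.continuousAt (isOpen_Ioo.mem_nhds hs))
  exact (hf.mono (ordConnected_Ioo.uIcc_subset hmid hs)).intervalIntegrable

/-- A continuous curve whose second differences are of order `h ^ (3 / 2)` is continuously
differentiable. -/
theorem exists_hasDerivAt_of_second_difference_le {x : ℝ → E} {a b η C : ℝ} (hη : 0 < η)
    (hC : 0 ≤ C) (hx : ContinuousOn x (Ioo (a - η) (b + η)))
    (hxC : ∀ s h, 0 < h → s - h ∈ Ioo (a - η) (b + η) → s + h ∈ Ioo (a - η) (b + η) →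
      ‖x (s + h) + x (s - h) - (2 : ℝ) • x s‖ ≤ C * (h * √h)) :
    ∃ v : ℝ → E, ContinuousOn v (Ioo a b) ∧ ∀ s ∈ Ioo a b, HasDerivAt x (v s) s := by
  -- Dyadic steps: consecutive difference quotients differ by a second difference centred at the
  -- midpoint, divided by the step. The exponent `3 / 2` leaves `√(h k)`, a geometric sequence of
  -- ratio `r = √(1 / 2)`.
  set h : ℕ → ℝ := fun k => η * (1 / 2) ^ (k + 1) with hh
  have hpos : ∀ k, 0 < h k := fun k => by positivity
  have hlt : ∀ k, h k < η := fun k => by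
    have : ((1 : ℝ) / 2) ^ (k + 1) < 1 := pow_lt_one₀ (by norm_num) (by norm_num) (by simp)
    calc h k < η * 1 := by simp only [hh]; gcongr
      _ = η := mul_one _
  have hsucc : ∀ k, h k = 2 * h (k + 1) := fun k => by simp only [hh, pow_succ]; ring
  have hlim : Filter.Tendsto h Filter.atTop (𝓝 0) := by
    have h1 := (tendsto_pow_atTop_nhds_zero_of_lt_one (r := (1 : ℝ) / 2) (by norm_num)
      (by norm_num)).comp (Filter.tendsto_add_atTop_nat 1)
    simpa [hh] using h1.const_mul η
  set q : ℕ → ℝ → E := fun k s => (h k)⁻¹ • (x (s + h k) - x s) with hq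
  set r : ℝ := √(1 / 2) with hr
  have hr0 : 0 ≤ r := Real.sqrt_nonneg _
  have hr1 : r < 1 := by
    rw [hr, Real.sqrt_lt' one_pos]
    norm_num
  have hsqrt : ∀ k, √(h k) = √η * r ^ (k + 1) := fun k => by
    have h1 : h k = (√η * r ^ (k + 1)) ^ 2 := by
      rw [mul_pow, Real.sq_sqrt hη.le, ← pow_mul, mul_comm (k + 1) 2, pow_mul, hr,
        Real.sq_sqrt (by norm_num)]
    rw [h1, Real.sqrt_sq (by positivity)]
  have hcauchy : ∀ s ∈ Ioo a b, ∀ k, dist (q k s) (q (k + 1) s) ≤ (C * √η) * r ^ k := by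
    intro s hs k
    set l := h (k + 1) with hl
    have hl0 : 0 < l := hpos _
    have h2l : h k = 2 * l := hsucc k
    have hlη : 2 * l < η := h2l ▸ hlt k
    have h1 := hxC (s + l) l hl0 ⟨by linarith [hs.1], by linarith [hs.2]⟩
      ⟨by linarith [hs.1], by linarith [hs.2]⟩
    have h2 : q k s - q (k + 1) s =
        (2 * l)⁻¹ • (x (s + l + l) + x (s + l - l) - (2 : ℝ) • x (s + l)) := by
      simp only [hq]
      rw [h2l, ← hl, show s + 2 * l = s + l + l by ring, show s + l - l = s by ring]
      have h3 : l⁻¹ = (2 * l)⁻¹ * 2 := by field_simp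
      rw [h3]
      module
    rw [dist_eq_norm, h2, norm_smul, Real.norm_of_nonneg (by positivity)]
    calc (2 * l)⁻¹ * ‖x (s + l + l) + x (s + l - l) - (2 : ℝ) • x (s + l)‖
        ≤ (2 * l)⁻¹ * (C * (l * √l)) := by gcongr
      _ = C * √l / 2 := by field_simp
      _ = (C * √η) * r ^ k * (r ^ 2 / 2) := by rw [hl, hsqrt]; ring
      _ ≤ (C * √η) * r ^ k * 1 := by
        gcongr
        rw [hr, Real.sq_sqrt (by norm_num)]
        norm_num
      _ = _ := mul_one _
  have hlimq : ∀ s, ∃ v, s ∈ Ioo a b → Filter.Tendsto (fun k => q k s) Filter.atTop (𝓝 v) := by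
    intro s
    by_cases hs : s ∈ Ioo a b
    · obtain ⟨v, hv⟩ := cauchySeq_tendsto_of_complete
        (cauchySeq_of_le_geometric r _ hr1 (hcauchy s hs))
      exact ⟨v, fun _ => hv⟩
    · exact ⟨0, fun h => absurd h hs⟩
  choose v hv using hlimq
  have hunif : TendstoUniformlyOn q v Filter.atTop (Ioo a b) := by
    rw [Metric.tendstoUniformlyOn_iff]
    intro ε hε
    have h1 : Filter.Tendsto (fun k => (C * √η) * r ^ k / (1 - r)) Filter.atTop (𝓝 0) := by
      have := ((tendsto_pow_atTop_nhds_zero_of_lt_one hr0 hr1).const_mul (C * √η)).div_const (1 - r)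
      simpa using this
    filter_upwards [h1.eventually (gt_mem_nhds hε)] with k hk s hs
    rw [dist_comm]
    exact (dist_le_of_le_geometric_of_tendsto r _ hr1 (hcauchy s hs) (hv s hs) k).trans_lt hk
  have hshift : ∀ k, ∀ s ∈ Ioo a b, s + h k ∈ Ioo (a - η) (b + η) := fun k s hs =>
    ⟨by linarith [hs.1, hpos k], by linarith [hs.2, hlt k]⟩
  have hin : ∀ s ∈ Ioo a b, s ∈ Ioo (a - η) (b + η) := fun s hs =>
    ⟨by linarith [hs.1], by linarith [hs.2]⟩
  have hqc : ∀ k, ContinuousOn (q k) (Ioo a b) := fun k =>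
    ((hx.comp (by fun_prop) (hshift k)).sub (hx.mono hin)).const_smul _
  refine ⟨v, hunif.continuousOn (Filter.Eventually.of_forall hqc).frequently, fun s hs => ?_⟩
  -- Only quotients along the sequence `h k` are known to converge. The averages `(F(s + h) - F(s))
  -- / h` of `x` have derivatives `q k`, which converge uniformly to `v`, and they converge
  -- pointwise to `x`; therefore `x' = v`.
  obtain ⟨F, hF⟩ := exists_primitive_of_continuousOn_Ioo hx
  refine hasDerivAt_of_tendstoUniformlyOn (f := fun k s => (h k)⁻¹ • (F (s + h k) - F s))
    isOpen_Ioo hunif (Filter.Eventually.of_forall fun k s hs => ?_) (fun s hs => ?_) hs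
  · have h1 := (hF _ (hshift k s hs)).comp_add_const s (h k)
    exact (h1.sub (hF s (hin s hs))).const_smul _
  · have h1 := (hF s (hin s hs)).tendsto_slope_zero
    exact h1.comp (tendsto_nhdsWithin_iff.2 ⟨hlim, Filter.Eventually.of_forall fun k =>
      (hpos k).ne'⟩)

end SecondDifference

/-! ### Isometric curves are continuously differentiable in charts -/

section MetricGeodesic

variable {E : Type*} [NormedAddCommGroup E] [NormedSpace ℝ E] [FiniteDimensional ℝ E]
  {M : Type*} [MetricSpace M] [ChartedSpace E M] [IsManifold 𝓘(ℝ, E) ∞ M]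
  [RiemannianBundle (fun x : M => TangentSpace 𝓘(ℝ, E) x)]

theorem exists_chartCurve_mem {z : ℝ → M} {t₀ : ℝ} (hz : ContinuousAt z t₀) {p : M}
    (hp : z t₀ ∈ (chartAt E p).source) {r : ℝ} (hr : 0 < r) :
    ∀ᶠ t in 𝓝 t₀, z t ∈ (chartAt E p).source ∧
      chartCurve E p z t ∈ Metric.ball (chartCurve E p z t₀) r := by
  have hs : z t₀ ∈ (extChartAt 𝓘(ℝ, E) p).source := by simpa using hp
  have h1 : ContinuousAt (chartCurve E p z) t₀ :=
    ContinuousAt.comp (g := extChartAt 𝓘(ℝ, E) p) (continuousAt_extChartAt' hs) hz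
  exact (hz.eventually ((chartAt E p).open_source.mem_nhds hp)).and
    (h1.eventually (Metric.ball_mem_nhds _ hr))

theorem chart_symm_chartCurve {p : M} {z : ℝ → M} {t : ℝ} (h : z t ∈ (chartAt E p).source) :
    (extChartAt 𝓘(ℝ, E) p).symm (chartCurve E p z t) = z t :=
  (extChartAt 𝓘(ℝ, E) p).left_inv (by simpa using h)

variable [IsRiemannianManifold 𝓘(ℝ, E) M]

/-- A curve parametrized by arc length that minimizes distances is continuously differentiable. -/
theorem exists_hasDerivAt_chartCurve {z : ℝ → M} {α β : ℝ}
    (hz : ∀ s ∈ Ioo α β, ∀ t ∈ Ioo α β, dist (z s) (z t) = |s - t|) {t₀ : ℝ} (ht₀ : t₀ ∈ Ioo α β)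
    {p : M} (hp : z t₀ ∈ (chartAt E p).source) {r c C K : ℝ}
    (h : ChartDistBounds p (chartCurve E p z t₀) r c C K) :
    ∃ ε > 0, ∃ v : ℝ → E, Ioo (t₀ - ε) (t₀ + ε) ⊆ Ioo α β ∧
      (∀ t ∈ Ioo (t₀ - ε) (t₀ + ε), z t ∈ (chartAt E p).source ∧
        chartCurve E p z t ∈ Metric.ball (chartCurve E p z t₀) r) ∧
      ContinuousOn v (Ioo (t₀ - ε) (t₀ + ε)) ∧
      ∀ t ∈ Ioo (t₀ - ε) (t₀ + ε), HasDerivAt (chartCurve E p z) (v t) t ∧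
        metricForm p (chartCurve E p z t) (v t) (v t) = 1 := by
  have hzc : ContinuousAt z t₀ := by
    have h1 : LipschitzOnWith 1 z (Ioo α β) := LipschitzOnWith.of_dist_le_mul fun s hs t ht => by
      rw [hz s hs t ht, Real.dist_eq, NNReal.coe_one, one_mul]
    exact h1.continuousOn.continuousAt (isOpen_Ioo.mem_nhds ht₀)
  set x := chartCurve E p z with hx
  set x₀ := x t₀ with hx₀
  have hc := h.c_pos
  have hK := h.K_pos
  obtain ⟨η, hη, hηs⟩ : ∃ η > 0, ∀ t ∈ Ioo (t₀ - η) (t₀ + η), t ∈ Ioo α β ∧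
      z t ∈ (chartAt E p).source ∧ x t ∈ Metric.ball x₀ r := by
    have h0 : ∀ᶠ t in 𝓝 t₀, t ∈ Ioo α β := Ioo_mem_nhds ht₀.1 ht₀.2
    have h1 := h0.and (exists_chartCurve_mem hzc hp h.r_pos)
    obtain ⟨η, hη, h2⟩ := Metric.eventually_nhds_iff_ball.1 h1
    exact ⟨η, hη, fun t ht => h2 t (by rwa [Real.ball_eq_Ioo])⟩
  have hball : ∀ t ∈ Ioo (t₀ - η) (t₀ + η), x t ∈ Metric.closedBall x₀ r := fun t ht =>
    Metric.ball_subset_closedBall (hηs t ht).2.2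
  have hdist : ∀ s ∈ Ioo (t₀ - η) (t₀ + η), ∀ t ∈ Ioo (t₀ - η) (t₀ + η),
      dist ((extChartAt 𝓘(ℝ, E) p).symm (x s)) ((extChartAt 𝓘(ℝ, E) p).symm (x t)) =
        |s - t| := by
    intro s hs t ht
    rw [chart_symm_chartCurve (hηs s hs).2.1, chart_symm_chartCurve (hηs t ht).2.1,
      hz s (hηs s hs).1 t (hηs t ht).1]
  have hlip : ∀ s ∈ Ioo (t₀ - η) (t₀ + η), ∀ t ∈ Ioo (t₀ - η) (t₀ + η),
      ‖x t - x s‖ ≤ K * |s - t| := by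
    intro s hs t ht
    rw [← hdist s hs t ht]
    exact h.norm_le _ (hball s hs) _ (hball t ht)
  have hxc : ContinuousOn x (Ioo (t₀ - η) (t₀ + η)) := by
    have h1 : LipschitzOnWith K.toNNReal x (Ioo (t₀ - η) (t₀ + η)) :=
      LipschitzOnWith.of_dist_le_mul fun s hs t ht => by
        rw [dist_eq_norm, Real.dist_eq, Real.coe_toNNReal _ hK.le, abs_sub_comm]
        exact hlip t ht s hs
    exact h1.continuousOn
  have hsd : ∀ s l, 0 < l → s - l ∈ Ioo (t₀ - η) (t₀ + η) → s + l ∈ Ioo (t₀ - η) (t₀ + η) →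
      ‖x (s + l) + x (s - l) - (2 : ℝ) • x s‖ ≤ √(5 * K ^ 4 / c) * (l * √l) := by
    intro s l hl h1 h2
    have hs : s ∈ Ioo (t₀ - η) (t₀ + η) := ⟨by linarith [h1.1], by linarith [h2.2]⟩
    have e1 := hlip s hs _ h2
    have e2 := hlip s hs _ h1
    rw [show s - (s + l) = -l by ring, abs_neg, abs_of_pos hl] at e1
    rw [show s - (s - l) = l by ring, abs_of_pos hl] at e2
    have e0 : ‖x s - x s‖ ≤ K * l := by
      rw [sub_self, norm_zero]
      positivity
    have g1 := h.abs_le _ (hball s hs) _ (hball s hs) _ (hball _ h2) _ e0 e1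
    have g2 := h.abs_le _ (hball s hs) _ (hball s hs) _ (hball _ h1) _ e0 e2
    have g3 := h.abs_le _ (hball s hs) _ (hball _ h1) _ (hball _ h2) _ e2 e1
    rw [hdist _ hs _ h2, show s - (s + l) = -l by ring, sq_abs] at g1
    rw [hdist _ hs _ h1, show s - (s - l) = l by ring, sq_abs] at g2
    rw [hdist _ h1 _ h2, show s - l - (s + l) = -(2 * l) by ring, sq_abs] at g3
    set A := x (s + l) - x s with hA
    set B := x (s - l) - x s with hB
    have hAB : x (s + l) - x (s - l) = A - B := by rw [hA, hB]; abel
    have hAB' : x (s + l) + x (s - l) - (2 : ℝ) • x s = A + B := by rw [hA, hB]; module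
    rw [hAB] at g3
    rw [hAB']
    -- The parallelogram law for the form at `x s`. Up to errors `K ⁴ l³`, the three terms on the
    -- right are `2 l²`, `2 l²` and `(2 l)²`: the quadratic parts cancel, and `2 + 2 + 1 = 5` errors
    -- remain.
    have par : metricForm p (x s) (A + B) (A + B) = 2 * metricForm p (x s) A A +
        2 * metricForm p (x s) B B - metricForm p (x s) (A - B) (A - B) := by
      simp only [map_add, map_sub, add_apply, sub_apply]
      ring
    have low := h.lower _ (hball s hs) (A + B)
    rw [_root_.abs_le] at g1 g2 g3
    have sq : ‖A + B‖ ^ 2 ≤ 5 * K ^ 4 / c * l ^ 3 := by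
      rw [div_mul_eq_mul_div, le_div_iff₀ hc]
      linarith [g1.1, g2.1, g3.2]
    have h3 : √(5 * K ^ 4 / c * l ^ 3) = √(5 * K ^ 4 / c) * (l * √l) := by
      rw [Real.sqrt_mul (by positivity), show l ^ 3 = l ^ 2 * l by ring,
        Real.sqrt_mul (by positivity), Real.sqrt_sq hl.le]
    rw [← h3]
    exact Real.le_sqrt_of_sq_le sq
  obtain ⟨v, hvc, hv⟩ := exists_hasDerivAt_of_second_difference_le (x := x) (a := t₀ - η / 2)
    (b := t₀ + η / 2) (η := η / 2) (by positivity) (Real.sqrt_nonneg _)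
    (by convert hxc using 2 <;> ring)
    (fun s l hl h1 h2 => hsd s l hl
      (by convert h1 using 2 <;> ring) (by convert h2 using 2 <;> ring))
  have hsub : Ioo (t₀ - η / 2) (t₀ + η / 2) ⊆ Ioo (t₀ - η) (t₀ + η) :=
    Ioo_subset_Ioo (by linarith) (by linarith)
  refine ⟨η / 2, by positivity, v, fun t ht => (hηs t (hsub ht)).1,
    fun t ht => (hηs t (hsub ht)).2, hvc, fun t ht => ⟨hv t ht, ?_⟩⟩
  have ht' := hsub ht
  set q : ℝ → E := fun l => l⁻¹ • (x (t + l) - x t) with hq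
  have hqlim : Filter.Tendsto q (𝓝[>] 0) (𝓝 (v t)) := (hv t ht).tendsto_slope_zero_right
  have hlim1 : Filter.Tendsto (fun l => metricForm p (x t) (q l) (q l)) (𝓝[>] 0)
      (𝓝 (metricForm p (x t) (v t) (v t))) := by
    have h1 : Continuous fun w => metricForm p (x t) w w :=
      (metricForm p (x t)).continuous.clm_apply continuous_id
    exact (h1.tendsto _).comp hqlim
  -- `d(z t, z (t + l))² = l²` differs from the form by `O(l³)`; division by `l²` gives unit speed.
  have hlim2 : Filter.Tendsto (fun l => metricForm p (x t) (q l) (q l)) (𝓝[>] 0) (𝓝 1) := by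
    rw [tendsto_iff_dist_tendsto_zero]
    have h0 : Filter.Tendsto (fun l : ℝ => K ^ 4 * l) (𝓝[>] 0) (𝓝 0) := by
      have : Filter.Tendsto (fun l : ℝ => K ^ 4 * l) (𝓝 0) (𝓝 (K ^ 4 * 0)) :=
        Continuous.tendsto (by fun_prop) 0
      rw [mul_zero] at this
      exact this.mono_left nhdsWithin_le_nhds
    refine squeeze_zero' (Filter.Eventually.of_forall fun l => dist_nonneg) ?_ h0
    have hev : ∀ᶠ l in 𝓝[>] (0 : ℝ), l ∈ Ioo 0 (t₀ + η - t) :=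
      Ioo_mem_nhdsGT (by linarith [ht'.2])
    filter_upwards [hev] with l hl
    have h1 : t + l ∈ Ioo (t₀ - η) (t₀ + η) := ⟨by linarith [hl.1, ht'.1], by linarith [hl.2]⟩
    have e1 := hlip t ht' _ h1
    rw [show t - (t + l) = -l by ring, abs_neg, abs_of_pos hl.1] at e1
    have e0 : ‖x t - x t‖ ≤ K * l := by
      rw [sub_self, norm_zero]
      exact mul_nonneg hK.le hl.1.le
    have g1 := h.abs_le _ (hball t ht') _ (hball t ht') _ (hball _ h1) _ e0 e1
    rw [hdist _ ht' _ h1, show t - (t + l) = -l by ring, sq_abs] at g1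
    have h2 : metricForm p (x t) (q l) (q l) - 1 =
        -((l ^ 2)⁻¹ * ((-l) ^ 2 - metricForm p (x t) (x (t + l) - x t) (x (t + l) - x t))) := by
      have hl0 := hl.1.ne'
      simp only [hq, map_smul, smul_apply, smul_eq_mul]
      field_simp
      ring
    rw [Real.dist_eq, h2, abs_neg, abs_mul, abs_of_pos (by have := hl.1; positivity)]
    have hl0 := hl.1
    calc _ ≤ (l ^ 2)⁻¹ * (K * (K * l) ^ 3) := by gcongr
      _ = K ^ 4 * l := by field_simp
  exact tendsto_nhds_unique hlim1 hlim2

end MetricGeodesic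

/-! ### The first variation -/

section EulerLagrange

variable {E : Type*} [NormedAddCommGroup E] [NormedSpace ℝ E]

/-- The derivative of `G (f e) (g e) (h e)` for a field `G` of bilinear forms. -/
theorem HasFDerivAt.hasDerivAt_bilin {G : E → E →L[ℝ] E →L[ℝ] ℝ}
    {f g h : ℝ → E} {f' g' h' : E} {e : ℝ} {G' : E →L[ℝ] E →L[ℝ] E →L[ℝ] ℝ}
    (hG : HasFDerivAt G G' (f e)) (hf : HasDerivAt f f' e) (hg : HasDerivAt g g' e)
    (hh : HasDerivAt h h' e) :
    HasDerivAt (fun e => G (f e) (g e) (h e))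
      (G' f' (g e) (h e) + (G (f e) g' (h e) + G (f e) (g e) h')) e := by
  have h1 : HasDerivAt (fun e => G (f e)) (G' f') e :=
    HasFDerivAt.comp_hasDerivAt (E := E →L[ℝ] E →L[ℝ] ℝ) e hG hf
  have h2 : HasDerivAt (fun e => G (f e) (g e)) (G' f' (g e) + G (f e) g') e := h1.clm_apply hg
  refine (h2.clm_apply hh).congr_deriv ?_
  rw [add_apply]
  ring

/-- The first variation of the energy vanishes along a curve that minimizes length and has unit
speed, for variations in a constant direction `w`. -/
theorem integral_first_variation_eq_zero {G : E → E →L[ℝ] E →L[ℝ] ℝ} {U : Set E}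
    (hU : IsOpen U) (hG : ContDiffOn ℝ 1 G U) (hG0 : ∀ x v, 0 ≤ G x v v)
    {x v : ℝ → E} {I : Set ℝ} (hI : IsOpen I) {s₀ s₁ : ℝ} (hs : s₀ < s₁) (hsI : Icc s₀ s₁ ⊆ I)
    (hx : ∀ t ∈ I, HasDerivAt x (v t) t) (hv : ContinuousOn v I) (hxU : ∀ t ∈ I, x t ∈ U)
    (hx1 : ∀ t ∈ I, G (x t) (v t) (v t) = 1)
    (hmin : ∀ (y : ℝ → E) (O : Set ℝ), IsOpen O → Icc s₀ s₁ ⊆ O → ContDiffOn ℝ 1 y O →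
      (∀ t ∈ O, y t ∈ U) → y s₀ = x s₀ → y s₁ = x s₁ →
      s₁ - s₀ ≤ ∫ t in s₀..s₁, √(G (y t) (deriv y t) (deriv y t)))
    {φ φ' : ℝ → ℝ} (hφ : ∀ t, HasDerivAt φ (φ' t) t) (hφ' : Continuous φ')
    (hφ₀ : φ s₀ = 0) (hφ₁ : φ s₁ = 0) (w : E) :
    ∫ t in s₀..s₁, (φ t * fderiv ℝ G (x t) w (v t) (v t) +
      φ' t * (G (x t) w (v t) + G (x t) (v t) w)) = 0 := by
  have hφc : Continuous φ := continuous_iff_continuousAt.2 fun t => (hφ t).continuousAt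
  have hxc : ContinuousOn x I := fun t ht => (hx t ht).continuousAt.continuousWithinAt
  -- the varied curve stays in `U` for small parameters
  obtain ⟨e₁, he₁, htube⟩ : ∃ e₁ > 0, ∀ e ∈ Metric.closedBall (0 : ℝ) e₁, ∀ t ∈ Icc s₀ s₁,
      x t + (e * φ t) • w ∈ U := by
    -- Composition with the projection extends `x` continuously to `ℝ`, so that the tube lemma can
    -- be applied to an open set.
    have hcl : Continuous fun t : ℝ => x (projIcc s₀ s₁ hs.le t) :=
      (hxc.mono hsI).domRestrict.comp continuous_projIcc
    have hopen : IsOpen ((fun q : ℝ × ℝ => x (projIcc s₀ s₁ hs.le q.2) + (q.1 * φ q.2) • w) ⁻¹' U) :=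
      hU.preimage ((hcl.comp continuous_snd).add
        ((continuous_fst.mul (hφc.comp continuous_snd)).smul continuous_const))
    obtain ⟨A, B, hA, -, h0A, hJB, hAB⟩ := generalized_tube_lemma (isCompact_singleton (x := (0 : ℝ)))
      (isCompact_Icc (a := s₀) (b := s₁)) hopen (by
        rintro ⟨e, t⟩ ⟨he, ht⟩
        rw [mem_singleton_iff] at he
        subst he
        simp only [mem_preimage, zero_mul, zero_smul, add_zero]
        rw [projIcc_of_mem hs.le ht]
        exact hxU t (hsI ht))
    obtain ⟨e₁, he₁, h1⟩ := Metric.nhds_basis_closedBall.mem_iff.1 (hA.mem_nhds (h0A rfl))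
    refine ⟨e₁, he₁, fun e he t ht => ?_⟩
    have h2 := hAB (mk_mem_prod (h1 he) (hJB ht))
    simp only [mem_preimage] at h2
    rwa [projIcc_of_mem hs.le ht] at h2
  set W : ℝ → ℝ → E := fun e t => v t + (e * φ' t) • w with hW
  set Ψ : ℝ → ℝ → ℝ := fun e t => G (x t + (e * φ t) • w) (W e t) (W e t) with hΨ
  set D : ℝ → ℝ → ℝ := fun e t => fderiv ℝ G (x t + (e * φ t) • w) (φ t • w) (W e t) (W e t) +
    (G (x t + (e * φ t) • w) (φ' t • w) (W e t) +
      G (x t + (e * φ t) • w) (W e t) (φ' t • w)) with hD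
  have hder : ∀ e ∈ Metric.closedBall (0 : ℝ) e₁, ∀ t ∈ Icc s₀ s₁,
      HasDerivAt (fun e => Ψ e t) (D e t) e := by
    intro e he t ht
    have h1 : HasDerivAt (fun e : ℝ => x t + (e * φ t) • w) (φ t • w) e := by
      have := (((hasDerivAt_id e).mul_const (φ t)).smul_const w).const_add (x t)
      simpa using this
    have h2 : HasDerivAt (fun e : ℝ => W e t) (φ' t • w) e := by
      have := (((hasDerivAt_id e).mul_const (φ' t)).smul_const w).const_add (v t)
      simpa [hW] using this
    have h3 : HasFDerivAt G (fderiv ℝ G (x t + (e * φ t) • w)) (x t + (e * φ t) • w) :=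
      ((hG.contDiffAt (hU.mem_nhds (htube e he t ht))).differentiableAt one_ne_zero).hasFDerivAt
    refine (h3.hasDerivAt_bilin h1 h2 h2).congr_deriv ?_
    simp only [hD]
  set Q : Set (ℝ × ℝ) := Metric.closedBall (0 : ℝ) e₁ ×ˢ Icc s₀ s₁ with hQ
  have cx : ContinuousOn (fun q : ℝ × ℝ => x q.2 + (q.1 * φ q.2) • w) Q :=
    ((hxc.mono hsI).comp continuous_snd.continuousOn fun q hq => hq.2).add
      (Continuous.continuousOn (by fun_prop))
  have mx : MapsTo (fun q : ℝ × ℝ => x q.2 + (q.1 * φ q.2) • w) Q U := fun q hq =>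
    htube q.1 hq.1 q.2 hq.2
  have cW : ContinuousOn (fun q : ℝ × ℝ => W q.1 q.2) Q :=
    ((hv.mono hsI).comp continuous_snd.continuousOn fun q hq => hq.2).add
      (Continuous.continuousOn (by fun_prop))
  have cG : ContinuousOn (fun q : ℝ × ℝ => G (x q.2 + (q.1 * φ q.2) • w)) Q :=
    hG.continuousOn.comp cx mx
  have cdG : ContinuousOn (fun q : ℝ × ℝ => fderiv ℝ G (x q.2 + (q.1 * φ q.2) • w)) Q :=
    (hG.continuousOn_fderiv_of_isOpen hU le_rfl).comp cx mx
  have cΨ : ContinuousOn (fun q : ℝ × ℝ => Ψ q.1 q.2) Q := (cG.clm_apply cW).clm_apply cW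
  have cφw : ContinuousOn (fun q : ℝ × ℝ => φ q.2 • w) Q :=
    Continuous.continuousOn (by fun_prop)
  have cφw' : ContinuousOn (fun q : ℝ × ℝ => φ' q.2 • w) Q :=
    Continuous.continuousOn (by fun_prop)
  have cD : ContinuousOn (fun q : ℝ × ℝ => D q.1 q.2) Q :=
    (((cdG.clm_apply cφw).clm_apply cW).clm_apply cW).add
      (((cG.clm_apply cφw').clm_apply cW).add ((cG.clm_apply cW).clm_apply cφw'))
  have slice : ∀ {f : ℝ → ℝ → ℝ}, ContinuousOn (fun q : ℝ × ℝ => f q.1 q.2) Q →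
      ∀ e ∈ Metric.closedBall (0 : ℝ) e₁, ContinuousOn (f e) (Icc s₀ s₁) := fun hf e he =>
    hf.comp (f := fun t => (e, t)) (by fun_prop) fun t ht => ⟨he, ht⟩
  have hmeas : ∀ {f : ℝ → ℝ}, ContinuousOn f (Icc s₀ s₁) →
      MeasureTheory.AEStronglyMeasurable f (MeasureTheory.volume.restrict (uIoc s₀ s₁)) := by
    intro f hf
    rw [uIoc_of_le hs.le]
    exact (hf.mono Ioc_subset_Icc_self).aestronglyMeasurable measurableSet_Ioc
  have hint : ∀ {f : ℝ → ℝ}, ContinuousOn f (Icc s₀ s₁) →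
      IntervalIntegrable f MeasureTheory.volume s₀ s₁ := fun hf =>
    ContinuousOn.intervalIntegrable (by rwa [uIcc_of_le hs.le])
  obtain ⟨Bd, hBd⟩ := ((isCompact_closedBall (0 : ℝ) e₁).prod
    (isCompact_Icc (a := s₀) (b := s₁))).exists_bound_of_continuousOn cD
  have h0 : (0 : ℝ) ∈ Metric.closedBall (0 : ℝ) e₁ := Metric.mem_closedBall_self he₁.le
  have hcb : Metric.closedBall (0 : ℝ) e₁ ∈ 𝓝 (0 : ℝ) := Metric.closedBall_mem_nhds _ he₁
  have hderF := (intervalIntegral.hasDerivAt_integral_of_dominated_loc_of_deriv_le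
    (F := Ψ) (F' := D) (x₀ := (0 : ℝ)) (bound := fun _ => Bd) (a := s₀) (b := s₁)
    (μ := MeasureTheory.volume) hcb
    (by filter_upwards [hcb] with e he using hmeas (slice cΨ e he))
    (hint (slice cΨ 0 h0)) (hmeas (slice cD 0 h0))
    (Filter.Eventually.of_forall fun t ht e he => by
      rw [uIoc_of_le hs.le] at ht
      exact hBd (e, t) ⟨he, Ioc_subset_Icc_self ht⟩)
    intervalIntegrable_const
    (Filter.Eventually.of_forall fun t ht e he => by
      rw [uIoc_of_le hs.le] at ht
      exact hder e he t (Ioc_subset_Icc_self ht))).2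
  have hF0 : ∫ t in s₀..s₁, Ψ 0 t = s₁ - s₀ := by
    have : ∫ t in s₀..s₁, Ψ 0 t = ∫ t in s₀..s₁, (1 : ℝ) := by
      refine intervalIntegral.integral_congr fun t ht => ?_
      rw [uIcc_of_le hs.le] at ht
      simp only [hΨ, hW, zero_mul, zero_smul, add_zero]
      exact hx1 t (hsI ht)
    rw [this]
    simp
  have hlocmin : IsLocalMin (fun e => ∫ t in s₀..s₁, Ψ e t) 0 := by
    filter_upwards [hcb] with e he
    rw [hF0]
    set y : ℝ → E := fun t => x t + (e * φ t) • w with hy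
    have hyd : ∀ t ∈ I, HasDerivAt y (W e t) t := fun t ht =>
      (hx t ht).add (((hφ t).const_mul e).smul_const w)
    have hyc : ContinuousOn y I := fun t ht => (hyd t ht).continuousAt.continuousWithinAt
    have hWc : ContinuousOn (W e) I := hv.add (Continuous.continuousOn (by fun_prop))
    have hO : IsOpen (I ∩ y ⁻¹' U) := hyc.isOpen_inter_preimage hI hU
    have hyC : ContDiffOn ℝ 1 y I := by
      rw [show (1 : ℕ∞ω) = 0 + 1 by simp, contDiffOn_succ_iff_deriv_of_isOpen hI]
      refine ⟨fun t ht => (hyd t ht).differentiableAt.differentiableWithinAt, by simp, ?_⟩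
      rw [contDiffOn_zero]
      exact hWc.congr fun t ht => (hyd t ht).deriv
    have h1 := hmin y _ hO (fun t ht => ⟨hsI ht, htube e he t ht⟩) (hyC.mono inter_subset_left)
      (fun t ht => ht.2) (by simp [hy, hφ₀]) (by simp [hy, hφ₁])
    -- From length to energy: `√Ψ ≤ (1 + Ψ) / 2`, with equality for unit speed. The lower bound for
    -- lengths thus makes the energy minimal at `e = 0`, and the energy is differentiable under the
    -- integral.
    have h2 : ∫ t in s₀..s₁, √(G (y t) (deriv y t) (deriv y t)) ≤
        ∫ t in s₀..s₁, (1 + Ψ e t) / 2 := by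
      have hc : ContinuousOn (fun t => √(Ψ e t)) (Icc s₀ s₁) := (slice cΨ e he).sqrt
      rw [intervalIntegral.integral_congr (g := fun t => √(Ψ e t)) (fun t ht => by
        rw [uIcc_of_le hs.le] at ht
        simp only [hΨ]
        rw [(hyd t (hsI ht)).deriv])]
      refine intervalIntegral.integral_mono_on hs.le (hint hc)
        (hint ((continuousOn_const.add (slice cΨ e he)).div_const 2)) fun t ht => ?_
      have h3 : 0 ≤ Ψ e t := hG0 _ _
      nlinarith [Real.sq_sqrt h3, sq_nonneg (√(Ψ e t) - 1)]
    have h3 : ∫ t in s₀..s₁, (1 + Ψ e t) / 2 = ((s₁ - s₀) + ∫ t in s₀..s₁, Ψ e t) / 2 := by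
      rw [intervalIntegral.integral_div, intervalIntegral.integral_add intervalIntegrable_const
        (hint (slice cΨ e he))]
      simp
    linarith
  have h1 := hlocmin.hasDerivAt_eq_zero hderF
  rw [← h1]
  refine intervalIntegral.integral_congr fun t ht => ?_
  have e1 : fderiv ℝ G (x t) (φ t • w) = φ t • fderiv ℝ G (x t) w :=
    ContinuousLinearMap.map_smul (M₂ := E →L[ℝ] E →L[ℝ] ℝ) _ _ _
  have e2 : G (x t) (φ' t • w) = φ' t • G (x t) w := ContinuousLinearMap.map_smul _ _ _
  have e3 : G (x t) (v t) (φ' t • w) = φ' t • G (x t) (v t) w :=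
    ContinuousLinearMap.map_smul _ _ _
  simp only [hD, hW, zero_mul, zero_smul, add_zero, e1, e2, e3, smul_apply, smul_eq_mul]
  ring

end EulerLagrange

/-! ### The lemma of du Bois-Reymond and the Euler-Lagrange equation -/

section EulerLagrange

variable {E : Type*} [NormedAddCommGroup E] [NormedSpace ℝ E]

/-- The lemma of du Bois-Reymond: a continuous function that is orthogonal to all derivatives of
`C¹` functions vanishing at the end points is constant. -/
theorem exists_eq_const_of_integral_mul_eq_zero {f : ℝ → ℝ} {s₀ s₁ : ℝ} (hs : s₀ < s₁)
    (hf : ContinuousOn f (Icc s₀ s₁))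
    (h : ∀ φ φ' : ℝ → ℝ, (∀ t, HasDerivAt φ (φ' t) t) → Continuous φ' → φ s₀ = 0 → φ s₁ = 0 →
      ∫ t in s₀..s₁, φ' t * f t = 0) :
    ∃ k, ∀ t ∈ Icc s₀ s₁, f t = k := by
  set k := (∫ t in s₀..s₁, f t) / (s₁ - s₀) with hk
  have hint : ∀ {g : ℝ → ℝ}, ContinuousOn g (Icc s₀ s₁) →
      IntervalIntegrable g MeasureTheory.volume s₀ s₁ := fun hg =>
    ContinuousOn.intervalIntegrable (by rwa [uIcc_of_le hs.le])
  -- The test function has derivative `f - k` with `k` the mean of `f`, so its primitive vanishes at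
  -- both ends; testing yields `∫ (f - k)² = 0`.
  set φ' : ℝ → ℝ := fun t => f (projIcc s₀ s₁ hs.le t) - k with hφ'
  have hφ'c : Continuous φ' := (hf.domRestrict.comp continuous_projIcc).sub continuous_const
  have hφ'e : ∀ t ∈ Icc s₀ s₁, φ' t = f t - k := fun t ht => by
    simp only [hφ']
    rw [projIcc_of_mem hs.le ht]
  have hφ'0 : ∫ t in s₀..s₁, φ' t = 0 := by
    rw [intervalIntegral.integral_congr (g := fun t => f t - k) (fun t ht => by
      rw [uIcc_of_le hs.le] at ht
      exact hφ'e t ht), intervalIntegral.integral_sub (hint hf) intervalIntegrable_const, hk]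
    simp only [intervalIntegral.integral_const, smul_eq_mul]
    rw [mul_div_cancel₀ _ (sub_pos.2 hs).ne', sub_self]
  have h1 := h (fun t => ∫ s in s₀..t, φ' s) φ'
    (fun t => hφ'c.integral_hasStrictDerivAt s₀ t |>.hasDerivAt) hφ'c (by simp) hφ'0
  have h2 : ∫ t in s₀..s₁, φ' t * φ' t = 0 := by
    have h3 : ∫ t in s₀..s₁, (φ' t * f t - φ' t * k) = 0 := by
      have c1 : ContinuousOn (fun t => φ' t * f t) (Icc s₀ s₁) := hφ'c.continuousOn.mul hf
      have c2 : ContinuousOn (fun t => φ' t * k) (Icc s₀ s₁) :=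
        (hφ'c.mul continuous_const).continuousOn
      rw [intervalIntegral.integral_sub (hint c1) (hint c2), h1,
        intervalIntegral.integral_mul_const, hφ'0]
      simp
    rw [← h3]
    refine intervalIntegral.integral_congr fun t ht => ?_
    rw [uIcc_of_le hs.le] at ht
    rw [hφ'e t ht]
    ring
  refine ⟨k, fun t ht => ?_⟩
  by_contra hne
  have h4 : φ' t ≠ 0 := by rw [hφ'e t ht]; exact sub_ne_zero.2 hne
  have := intervalIntegral.integral_pos hs (f := fun t => φ' t * φ' t)
    (hφ'c.mul hφ'c).continuousOn (fun s _ => mul_self_nonneg _)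
    ⟨t, ht, mul_self_pos.2 h4⟩
  exact this.ne' h2

/-- A positive definite bilinear form on a finite-dimensional space is invertible. -/
theorem isInvertible_of_pos [FiniteDimensional ℝ E] (B : E →L[ℝ] E →L[ℝ] ℝ)
    (hB : ∀ v, v ≠ 0 → 0 < B v v) : B.IsInvertible := by
  have hinj : Function.Injective B.toLinearMap := by
    rw [← LinearMap.ker_eq_bot, LinearMap.ker_eq_bot']
    intro v hv
    by_contra hne
    have h1 := hB v hne
    have h2 : B v = 0 := hv
    rw [h2] at h1
    simp at h1
  have hdim : Module.finrank ℝ E = Module.finrank ℝ (E →L[ℝ] ℝ) := by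
    rw [← (LinearMap.toContinuousLinearMap : (E →ₗ[ℝ] ℝ) ≃ₗ[ℝ] _).finrank_eq,
      ← Subspace.dual_finrank_eq (K := ℝ) (V := E)]
  refine ⟨(LinearEquiv.ofInjectiveOfFinrankEq B.toLinearMap hinj hdim).toContinuousLinearEquiv, ?_⟩
  ext v w
  rfl

/-- `v = B⁻¹ (B v)`, and inversion is smooth at invertible maps. This recovers the regularity of the
velocity from that of the momentum. -/
theorem contDiffWithinAt_of_apply {F : Type*} [NormedAddCommGroup F] [NormedSpace ℝ F]
    [CompleteSpace E] {B : ℝ → E →L[ℝ] F} {v : ℝ → E} {S : Set ℝ} {t : ℝ}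
    (ht : t ∈ S) (hB : ∀ s ∈ S, (B s).IsInvertible) (hBc : ContDiffWithinAt ℝ 1 B S t)
    (hv : ContDiffWithinAt ℝ 1 (fun s => B s (v s)) S t) : ContDiffWithinAt ℝ 1 v S t := by
  have h3 : ContDiffWithinAt ℝ 1 (fun t => (B t).inverse) S t :=
    (hB t ht).contDiffAt_map_inverse.comp_contDiffWithinAt t hBc
  refine (h3.clm_apply hv).congr_of_eventuallyEq_of_mem ?_ ht
  filter_upwards [self_mem_nhdsWithin] with s hs
  exact ((hB s hs).inverse_apply_eq.2 rfl).symm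

/-- The Euler-Lagrange equation of a curve that minimizes length and has unit speed. -/
theorem euler_lagrange_of_minimal [FiniteDimensional ℝ E] {G : E → E →L[ℝ] E →L[ℝ] ℝ} {U : Set E}
    (hU : IsOpen U) (hG : ContDiffOn ℝ 1 G U) (hG0 : ∀ x v, 0 ≤ G x v v)
    (hGs : ∀ x v w, G x v w = G x w v) (hGp : ∀ x ∈ U, ∀ v, v ≠ 0 → 0 < G x v v)
    {x v : ℝ → E} {α β s₀ s₁ : ℝ} (hs : s₀ < s₁) (hα : α < s₀) (hβ : s₁ < β)
    (hx : ∀ t ∈ Ioo α β, HasDerivAt x (v t) t) (hv : ContinuousOn v (Ioo α β))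
    (hxU : ∀ t ∈ Ioo α β, x t ∈ U) (hx1 : ∀ t ∈ Ioo α β, G (x t) (v t) (v t) = 1)
    (hmin : ∀ (y : ℝ → E) (O : Set ℝ), IsOpen O → Icc s₀ s₁ ⊆ O → ContDiffOn ℝ 1 y O →
      (∀ t ∈ O, y t ∈ U) → y s₀ = x s₀ → y s₁ = x s₁ →
      s₁ - s₀ ≤ ∫ t in s₀..s₁, √(G (y t) (deriv y t) (deriv y t))) :
    ContDiffOn ℝ 1 v (Ioo s₀ s₁) ∧ ∀ t ∈ Ioo s₀ s₁, ∀ w,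
      G (x t) (deriv v t) w + fderiv ℝ G (x t) (v t) (v t) w -
        fderiv ℝ G (x t) w (v t) (v t) / 2 = 0 := by
  have hsI : Icc s₀ s₁ ⊆ Ioo α β := Icc_subset_Ioo hα hβ
  have hsI' : Ioo s₀ s₁ ⊆ Ioo α β := Ioo_subset_Icc_self.trans hsI
  have hxc : ContinuousOn x (Ioo α β) := fun t ht => (hx t ht).continuousAt.continuousWithinAt
  have cG : ContinuousOn (fun t => G (x t)) (Ioo α β) := hG.continuousOn.comp hxc hxU
  have cdG : ContinuousOn (fun t => fderiv ℝ G (x t)) (Ioo α β) :=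
    (hG.continuousOn_fderiv_of_isOpen hU le_rfl).comp hxc hxU
  have cq : ∀ w, ContinuousOn (fun t => fderiv ℝ G (x t) w (v t) (v t) / 2) (Ioo α β) := fun w =>
    (((cdG.clm_apply continuousOn_const).clm_apply hv).clm_apply hv).div_const 2
  have cp : ∀ w, ContinuousOn (fun t => G (x t) (v t) w) (Ioo α β) := fun w =>
    (cG.clm_apply hv).clm_apply continuousOn_const
  have hmom : ∀ w, ∀ t ∈ Ioo s₀ s₁, HasDerivAt (fun t => G (x t) (v t) w)
      (fderiv ℝ G (x t) w (v t) (v t) / 2) t := by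
    intro w
    obtain ⟨Q, hQ⟩ := exists_primitive_of_continuousOn_Ioo (cq w)
    have cQ : ContinuousOn Q (Ioo α β) := fun t ht => (hQ t ht).continuousAt.continuousWithinAt
    -- Integrating the first variation by parts, with `Q` a primitive of the force `dG(w)(v, v) /
    -- 2`, shows that the momentum minus `Q` is orthogonal to every `φ'`. No derivative of `v` is
    -- used up to here.
    obtain ⟨k, hk⟩ := exists_eq_const_of_integral_mul_eq_zero
      (f := fun t => G (x t) (v t) w - Q t) hs (((cp w).sub cQ).mono hsI)
      fun φ φ' hφ hφ' h0 h1 => by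
        have hφc : Continuous φ := continuous_iff_continuousAt.2 fun t => (hφ t).continuousAt
        have hint : ∀ {g : ℝ → ℝ}, ContinuousOn g (Ioo α β) →
            IntervalIntegrable g MeasureTheory.volume s₀ s₁ := fun hg =>
          ContinuousOn.intervalIntegrable (by rw [uIcc_of_le hs.le]; exact hg.mono hsI)
        have h2 := integral_first_variation_eq_zero hU hG hG0 isOpen_Ioo hs hsI hx hv hxU hx1 hmin
          hφ hφ' h0 h1 w
        have cA : ContinuousOn (fun t => φ' t * Q t + φ t * (fderiv ℝ G (x t) w (v t) (v t) / 2))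
          (Ioo α β) := (hφ'.continuousOn.mul cQ).add (hφc.continuousOn.mul (cq w))
        have h3 : ∫ t in s₀..s₁, (φ' t * Q t + φ t * (fderiv ℝ G (x t) w (v t) (v t) / 2)) = 0 := by
          rw [intervalIntegral.integral_eq_sub_of_hasDerivAt (f := fun t => φ t * Q t)
            (fun t ht => ?_) (hint cA)]
          · simp only [h0, h1, zero_mul, sub_self]
          · rw [uIcc_of_le hs.le] at ht
            exact (hφ t).mul (hQ t (hsI ht))
        have cB : ContinuousOn (fun t => φ t * fderiv ℝ G (x t) w (v t) (v t) +
            φ' t * (G (x t) w (v t) + G (x t) (v t) w)) (Ioo α β) := by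
          have c1 : ContinuousOn (fun t => φ t * (fderiv ℝ G (x t) w (v t) (v t) / 2) * 2 +
              φ' t * (G (x t) (v t) w + G (x t) (v t) w)) (Ioo α β) :=
            ((hφc.continuousOn.mul (cq w)).mul (continuousOn_const (c := 2))).add
              (hφ'.continuousOn.mul ((cp w).add (cp w)))
          refine c1.congr fun t ht => ?_
          rw [hGs _ w]
          ring
        have cA2 : ContinuousOn (fun t => 2 * (φ' t * Q t +
            φ t * (fderiv ℝ G (x t) w (v t) (v t) / 2))) (Ioo α β) :=
          (continuousOn_const (c := 2)).mul cA
        have h4 : ∫ t in s₀..s₁, ((φ t * fderiv ℝ G (x t) w (v t) (v t) +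
            φ' t * (G (x t) w (v t) + G (x t) (v t) w)) -
            2 * (φ' t * Q t + φ t * (fderiv ℝ G (x t) w (v t) (v t) / 2))) = 0 := by
          rw [intervalIntegral.integral_sub (hint cB) (hint cA2),
            intervalIntegral.integral_const_mul, h2, h3]
          simp
        have h5 : ∫ t in s₀..s₁, 2 * (φ' t * (G (x t) (v t) w - Q t)) = 0 := by
          rw [← h4]
          refine intervalIntegral.integral_congr fun t _ => ?_
          rw [hGs _ w]
          ring
        rw [intervalIntegral.integral_const_mul] at h5
        linarith
    intro t ht
    have h1 := (hQ t (hsI' ht)).add_const k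
    refine h1.congr_of_eventuallyEq ?_
    filter_upwards [Ioo_mem_nhds ht.1 ht.2] with s hs'
    have := hk s (Ioo_subset_Icc_self hs')
    linarith
  have hC1x : ContDiffOn ℝ 1 x (Ioo s₀ s₁) := by
    rw [show (1 : ℕ∞ω) = 0 + 1 by simp, contDiffOn_succ_iff_deriv_of_isOpen isOpen_Ioo]
    refine ⟨fun t ht => (hx t (hsI' ht)).differentiableAt.differentiableWithinAt, by simp, ?_⟩
    rw [contDiffOn_zero]
    exact (hv.mono hsI').congr fun t ht => (hx t (hsI' ht)).deriv
  have hC1p : ContDiffOn ℝ 1 (fun t => G (x t) (v t)) (Ioo s₀ s₁) := by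
    refine contDiffOn_clm_apply.2 fun w => ?_
    rw [show (1 : ℕ∞ω) = 0 + 1 by simp, contDiffOn_succ_iff_deriv_of_isOpen isOpen_Ioo]
    refine ⟨fun t ht => (hmom w t ht).differentiableAt.differentiableWithinAt, by simp, ?_⟩
    rw [contDiffOn_zero]
    exact ((cq w).mono hsI').congr fun t ht => (hmom w t ht).deriv
  have hC1v : ContDiffOn ℝ 1 v (Ioo s₀ s₁) := by
    have h1 : ContDiffOn ℝ 1 (fun t => G (x t)) (Ioo s₀ s₁) :=
      hG.comp hC1x fun t ht => hxU t (hsI' ht)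
    intro t ht
    exact contDiffWithinAt_of_apply ht
      (fun s hs' => isInvertible_of_pos (G (x s)) (hGp _ (hxU s (hsI' hs')))) (h1 t ht) (hC1p t ht)
  refine ⟨hC1v, fun t ht w => ?_⟩
  have hvd : HasDerivAt v (deriv v t) t :=
    ((hC1v.contDiffAt (isOpen_Ioo.mem_nhds ht)).differentiableAt one_ne_zero).hasDerivAt
  have h3 : HasFDerivAt G (fderiv ℝ G (x t)) (x t) :=
    ((hG.contDiffAt (hU.mem_nhds (hxU t (hsI' ht)))).differentiableAt one_ne_zero).hasFDerivAt
  -- Now that `v` is `C¹`, the momentum can also be differentiated by the product rule; equating the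
  -- two derivatives is the equation.
  have h4 := h3.hasDerivAt_bilin (hx t (hsI' ht)) hvd (hasDerivAt_const t w)
  have h5 := h4.unique (hmom w t ht)
  simp only [map_zero, add_zero] at h5
  linarith

end EulerLagrange

/-! ### Minimizing curves are geodesics -/

section ChartGeodesic

theorem fderiv_clm_apply_const {E F H : Type*} [NormedAddCommGroup E] [NormedSpace ℝ E]
    [NormedAddCommGroup F] [NormedSpace ℝ F] [NormedAddCommGroup H] [NormedSpace ℝ H]
    {A : E → F →L[ℝ] H} {x : E} (hA : DifferentiableAt ℝ A x) (a : E) (b : F) :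
    DifferentiableAt ℝ (fun y => A y b) x ∧ fderiv ℝ (fun y => A y b) x a = fderiv ℝ A x a b := by
  refine ⟨hA.clm_apply (differentiableAt_const b), ?_⟩
  rw [fderiv_clm_apply hA (differentiableAt_const b)]
  simp

variable {E : Type*} [NormedAddCommGroup E] [NormedSpace ℝ E] [FiniteDimensional ℝ E]
  {M : Type*} [MetricSpace M] [ChartedSpace E M] [IsManifold 𝓘(ℝ, E) ∞ M]
  [RiemannianBundle (fun x : M => TangentSpace 𝓘(ℝ, E) x)]
  [IsContMDiffRiemannianBundle 𝓘(ℝ, E) ∞ E (fun x : M => TangentSpace 𝓘(ℝ, E) x)]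

theorem differentiableAt_metricForm {p : M} {x : E}
    (hx : x ∈ (extChartAt 𝓘(ℝ, E) p).target) : DifferentiableAt ℝ (metricForm p : E → _) x :=
  ((contDiffOn_metricForm p).contDiffAt
    ((isOpen_extChartAt_target (I := 𝓘(ℝ, E)) p).mem_nhds hx)).differentiableAt (by simp)

theorem fderiv_chartMetric {p : M} {x : E} (hx : x ∈ (extChartAt 𝓘(ℝ, E) p).target)
    (a b c : E) :
    fderiv ℝ (fun y => chartMetric E p y b c) x a = fderiv ℝ (metricForm p) x a b c := by
  obtain ⟨h1, h2⟩ := fderiv_clm_apply_const (H := E →L[ℝ] ℝ) (differentiableAt_metricForm hx) a b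
  obtain ⟨-, h3⟩ := fderiv_clm_apply_const h1 a c
  rw [← h2, ← h3]
  rfl

/-- The covariant acceleration, paired with `w`, in terms of the derivative of the metric. -/
theorem chartAcceleration_eq {p : M} {γ : ℝ → M} {t : ℝ} (ht : γ t ∈ (chartAt E p).source)
    (w : E) :
    chartAcceleration E p γ t w =
      metricForm p (chartCurve E p γ t) (deriv (deriv (chartCurve E p γ)) t) w +
      fderiv ℝ (metricForm p) (chartCurve E p γ t) (deriv (chartCurve E p γ) t)
        (deriv (chartCurve E p γ) t) w -
      fderiv ℝ (metricForm p) (chartCurve E p γ t) w (deriv (chartCurve E p γ) t)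
        (deriv (chartCurve E p γ) t) / 2 := by
  have hx : chartCurve E p γ t ∈ (extChartAt 𝓘(ℝ, E) p).target :=
    (extChartAt 𝓘(ℝ, E) p).map_source (by simpa using ht)
  rw [chartAcceleration, chartChristoffel, fderiv_chartMetric hx, fderiv_chartMetric hx,
    ← metricForm_apply]
  ring

theorem contMDiffAt_of_chartCurve {p : M} {γ : ℝ → M} {t : ℝ} (hγ : ContinuousAt γ t)
    (ht : γ t ∈ (chartAt E p).source) {n : ℕ∞} (hx : ContDiffAt ℝ n (chartCurve E p γ) t) :
    ContMDiffAt 𝓘(ℝ, ℝ) 𝓘(ℝ, E) n γ t := by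
  have hT : chartCurve E p γ t ∈ (extChartAt 𝓘(ℝ, E) p).target :=
    (extChartAt 𝓘(ℝ, E) p).map_source (by simpa using ht)
  have h1 : ContMDiffAt 𝓘(ℝ, E) 𝓘(ℝ, E) n (extChartAt 𝓘(ℝ, E) p).symm (chartCurve E p γ t) :=
    ((contMDiffOn_extChartAt_symm (n := ∞) p).contMDiffAt
      ((isOpen_extChartAt_target (I := 𝓘(ℝ, E)) p).mem_nhds hT)).of_le (by exact_mod_cast le_top)
  refine (h1.comp t hx.contMDiffAt).congr_of_eventuallyEq ?_
  filter_upwards [hγ.eventually ((chartAt E p).open_source.mem_nhds ht)] with s hs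
  exact (chart_symm_chartCurve hs).symm

theorem contDiffAt_chartCurve {p : M} {γ : ℝ → M} {t : ℝ} {n : ℕ∞}
    (hγ : ContMDiffAt 𝓘(ℝ, ℝ) 𝓘(ℝ, E) n γ t) (ht : γ t ∈ (chartAt E p).source) :
    ContDiffAt ℝ n (chartCurve E p γ) t := by
  rw [← contMDiffAt_iff_contDiffAt]
  have h1 : ContMDiffAt 𝓘(ℝ, E) 𝓘(ℝ, E) n (extChartAt 𝓘(ℝ, E) p) (γ t) :=
    (contMDiffAt_extChartAt' (n := ∞) ht).of_le (by exact_mod_cast le_top)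
  exact h1.comp t hγ

/-- A criterion for geodesics: near each time, in each chart, the coordinates of the curve have
a continuously differentiable derivative, and satisfy the geodesic equation. -/
theorem isGeodesicOn_of_chart {γ : ℝ → M} {a b : ℝ} (hγ : ContinuousOn γ (Icc a b))
    (h : ∀ t ∈ Ioo a b, ∀ p : M, γ t ∈ (chartAt E p).source → ∃ v : ℝ → E,
      (∀ᶠ s in 𝓝 t, HasDerivAt (chartCurve E p γ) (v s) s) ∧ ContDiffAt ℝ 1 v t ∧
      ∀ w, metricForm p (chartCurve E p γ t) (deriv v t) w +
        fderiv ℝ (metricForm p) (chartCurve E p γ t) (v t) (v t) w -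
        fderiv ℝ (metricForm p) (chartCurve E p γ t) w (v t) (v t) / 2 = 0) :
    IsGeodesicOn E γ a b := by
  refine ⟨hγ, fun t ht => ?_, fun t ht p hp w => ?_⟩
  · have hγt : ContinuousAt γ t := hγ.continuousAt (Icc_mem_nhds ht.1 ht.2)
    obtain ⟨v, hv, hvC, -⟩ := h t ht (γ t) (mem_chart_source E (γ t))
    refine ContMDiffAt.contMDiffWithinAt (contMDiffAt_of_chartCurve (n := 2) hγt
      (mem_chart_source E (γ t)) ?_)
    have h2 : deriv (chartCurve E (γ t) γ) =ᶠ[𝓝 t] v := hv.mono fun s hs => hs.deriv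
    have h3 : ContDiffAt ℝ 1 (deriv (chartCurve E (γ t) γ)) t := hvC.congr_of_eventuallyEq h2
    obtain ⟨O, hO, hO', htO⟩ := eventually_nhds_iff.1
      (hv.and (h3.eventually (by simp)))
    have h4 : ContDiffOn ℝ (1 + 1) (chartCurve E (γ t) γ) O := by
      rw [contDiffOn_succ_iff_deriv_of_isOpen hO']
      exact ⟨fun s hs => (hO s hs).1.differentiableAt.differentiableWithinAt, by simp,
        fun s hs => (hO s hs).2.contDiffWithinAt⟩
    have h5 := h4.contDiffAt (hO'.mem_nhds htO)
    convert h5 using 1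
    rw [one_add_one_eq_two]
    rfl
  · obtain ⟨v, hv, hvC, hve⟩ := h t ht p hp
    have h2 : deriv (chartCurve E p γ) =ᶠ[𝓝 t] v := hv.mono fun s hs => hs.deriv
    rw [chartAcceleration_eq hp, h2.deriv_eq, h2.self_of_nhds]
    exact hve w

variable [IsRiemannianManifold 𝓘(ℝ, E) M]

/-- A curve that is parametrized by arc length and minimizes distances is a geodesic. -/
theorem isGeodesicOn_of_dist_eq {z : ℝ → M} {a b : ℝ}
    (hz : ∀ s ∈ Icc a b, ∀ t ∈ Icc a b, dist (z s) (z t) = |s - t|) :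
    IsGeodesicOn E z a b ∧ ∀ t ∈ Ioo a b, curveSpeed E z t = 1 := by
  have hz' : ∀ s ∈ Ioo a b, ∀ t ∈ Ioo a b, dist (z s) (z t) = |s - t| := fun s hs t ht =>
    hz s (Ioo_subset_Icc_self hs) t (Ioo_subset_Icc_self ht)
  have hzc : ContinuousOn z (Icc a b) := by
    have h1 : LipschitzOnWith 1 z (Icc a b) := LipschitzOnWith.of_dist_le_mul fun s hs t ht => by
      rw [hz s hs t ht, Real.dist_eq, NNReal.coe_one, one_mul]
    exact h1.continuousOn
  have hT : ∀ {t : ℝ} {p : M}, z t ∈ (chartAt E p).source →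
      chartCurve E p z t ∈ (extChartAt 𝓘(ℝ, E) p).target := fun {t p} hp =>
    (extChartAt 𝓘(ℝ, E) p).map_source (by simpa using hp)
  have key : ∀ t ∈ Ioo a b, ∀ p : M, z t ∈ (chartAt E p).source → ∃ v : ℝ → E,
      (∀ᶠ s in 𝓝 t, HasDerivAt (chartCurve E p z) (v s) s) ∧ ContDiffAt ℝ 1 v t ∧
      (∀ w, metricForm p (chartCurve E p z t) (deriv v t) w +
        fderiv ℝ (metricForm p) (chartCurve E p z t) (v t) (v t) w -
        fderiv ℝ (metricForm p) (chartCurve E p z t) w (v t) (v t) / 2 = 0) ∧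
      metricForm p (chartCurve E p z t) (v t) (v t) = 1 := by
    intro t ht p hp
    obtain ⟨r, c, C, K, h⟩ := exists_chartDistBounds p (hT hp)
    obtain ⟨ε, hε, v, hsub, hmem, hvc, hv⟩ := exists_hasDerivAt_chartCurve hz' ht hp h
    set U := Metric.ball (chartCurve E p z t) r with hU
    have hUT : U ⊆ (extChartAt 𝓘(ℝ, E) p).target :=
      Metric.ball_subset_closedBall.trans h.subset
    -- Half the interval, so that its end points are interior times. A competitor in the chart is at
    -- least as long as the distance of its end points, which is `ε` along `z`.
    have hs0 : t - ε / 2 < t + ε / 2 := by linarith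
    obtain ⟨h1, h2⟩ := euler_lagrange_of_minimal (G := metricForm p) (U := U) Metric.isOpen_ball
      (((contDiffOn_metricForm p).mono hUT).of_le (by simp)) (metricForm_self_nonneg p)
      (metricForm_symm p) (fun x hx v hv => metricForm_pos p (hUT hx) hv)
      (x := chartCurve E p z) (v := v) (α := t - ε) (β := t + ε) hs0
      (by linarith) (by linarith) (fun s hs => (hv s hs).1) hvc (fun s hs => (hmem s hs).2)
      (fun s hs => (hv s hs).2) (fun y O hO hsubO hy hyU hy0 hy1 => by
        have h3 := dist_le_integral_sqrt p hs0.le hO hsubO hy fun s hs => hUT (hyU s hs)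
        have m0 : t - ε / 2 ∈ Ioo (t - ε) (t + ε) := by constructor <;> linarith
        have m1 : t + ε / 2 ∈ Ioo (t - ε) (t + ε) := by constructor <;> linarith
        rw [hy0, hy1, chart_symm_chartCurve (hmem _ m0).1, chart_symm_chartCurve (hmem _ m1).1,
          hz' _ (hsub m0) _ (hsub m1), abs_sub_comm, abs_of_pos (by linarith)] at h3
        exact h3)
    have ht' : t ∈ Ioo (t - ε / 2) (t + ε / 2) := by constructor <;> linarith
    refine ⟨v, ?_, h1.contDiffAt (isOpen_Ioo.mem_nhds ht'), h2 t ht',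
      (hv t (by constructor <;> linarith)).2⟩
    filter_upwards [Ioo_mem_nhds (show t - ε < t by linarith) (show t < t + ε by linarith)]
      with s hs using (hv s hs).1
  have hgeo : IsGeodesicOn E z a b := isGeodesicOn_of_chart hzc fun t ht p hp => by
    obtain ⟨v, h1, h2, h3, -⟩ := key t ht p hp
    exact ⟨v, h1, h2, h3⟩
  refine ⟨hgeo, fun t ht => ?_⟩
  obtain ⟨v, h1, -, -, h4⟩ := key t ht (z t) (mem_chart_source E (z t))
  have h5 := (curveSpeed_sq_eq (z t) ((hgeo.2.1.contMDiffAt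
    (isOpen_Ioo.mem_nhds ht)).mdifferentiableAt (by simp)) (mem_chart_source E (z t))).2
  rw [h1.self_of_nhds.deriv, h4] at h5
  nlinarith [curveSpeed_nonneg (E := E) z t]

end ChartGeodesic

/-! ### Compactness of balls and existence of minimizing curves -/

section HopfRinow

/-- An almost minimizing curve from `p` to `q`, parametrized by the distance from `p`. -/
theorem exists_almost_minimizing (E : Type*) [NormedAddCommGroup E] [NormedSpace ℝ E] [FiniteDimensional ℝ E]
    {M : Type*} [MetricSpace M] [ChartedSpace E M] [IsManifold 𝓘(ℝ, E) ∞ M]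
    [RiemannianBundle (fun x : M => TangentSpace 𝓘(ℝ, E) x)]
    [IsContMDiffRiemannianBundle 𝓘(ℝ, E) ∞ E (fun x : M => TangentSpace 𝓘(ℝ, E) x)]
    [IsRiemannianManifold 𝓘(ℝ, E) M]
    (p q : M) {ε : ℝ} (hε : 0 < ε) :
    ∃ ζ : ℝ → M, (∀ s ∈ Icc 0 (dist p q), dist p (ζ s) = s) ∧
      (∀ s ∈ Icc 0 (dist p q), dist (ζ s) q < dist p q - s + ε) ∧
      ∀ s ∈ Icc 0 (dist p q), ∀ s' ∈ Icc 0 (dist p q), s ≤ s' →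
        dist (ζ s) (ζ s') < s' - s + ε := by
  obtain ⟨γ, h0, h1, hγ, hL⟩ := exists_contMDiff_path (E := E) (x := p) (y := q)
    (L := dist p q + ε) (by linarith)
  set f : ℝ → ℝ := fun t => dist p (γ t) with hf
  have hfc : Continuous f := continuous_const.dist hγ.continuous
  -- `τ s` is the first time at which the path is at distance `s` from `p`. First times are monotone
  -- in `s`, which keeps the points in order along the path.
  have hτ : ∀ s, ∃ τ, s ∈ Icc 0 (dist p q) → IsLeast {t | t ∈ Icc (0 : ℝ) 1 ∧ s ≤ f t} τ := by
    intro s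
    by_cases hs : s ∈ Icc 0 (dist p q)
    · have hcomp : IsCompact (Icc (0 : ℝ) 1 ∩ f ⁻¹' Ici s) :=
        isCompact_Icc.inter_right (isClosed_Ici.preimage hfc)
      obtain ⟨τ, h⟩ := hcomp.exists_isLeast ⟨1, by simp, by simpa [hf, h1] using hs.2⟩
      exact ⟨τ, fun _ => h⟩
    · exact ⟨0, fun h => absurd h hs⟩
  choose τ hτ using hτ
  have hτI : ∀ s ∈ Icc 0 (dist p q), τ s ∈ Icc (0 : ℝ) 1 := fun s hs => (hτ s hs).1.1
  have hτf : ∀ s ∈ Icc 0 (dist p q), dist p (γ (τ s)) = s := by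
    intro s hs
    obtain ⟨t, ht, hts⟩ := intermediate_value_Icc (hτI s hs).1 hfc.continuousOn
      (show s ∈ Icc (f 0) (f (τ s)) from ⟨by simpa [hf, h0] using hs.1, (hτ s hs).1.2⟩)
    have h2 := (hτ s hs).2 (show t ∈ {t | t ∈ Icc (0 : ℝ) 1 ∧ s ≤ f t} from
      ⟨⟨ht.1, ht.2.trans (hτI s hs).2⟩, hts.ge⟩)
    rw [le_antisymm ht.2 h2] at hts
    exact hts
  have hmono : ∀ s ∈ Icc 0 (dist p q), ∀ s' ∈ Icc 0 (dist p q), s ≤ s' → τ s ≤ τ s' :=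
    fun s hs s' hs' hss' => (hτ s hs).2 ⟨hτI s' hs', hss'.trans (hτ s' hs').1.2⟩
  -- Additivity of length: any two intermediate points waste less than `ε` in the triangle
  -- inequality.
  have hsum : ∀ t₁ t₂, 0 ≤ t₁ → t₁ ≤ t₂ → t₂ ≤ 1 →
      dist p (γ t₁) + dist (γ t₁) (γ t₂) + dist (γ t₂) q < dist p q + ε := by
    intro t₁ t₂ ht₁ ht₁₂ ht₂
    have e1 := ofReal_dist_le_pathELength (hγ.contMDiffOn (s := Icc 0 t₁)) ht₁
    have e2 := ofReal_dist_le_pathELength (hγ.contMDiffOn (s := Icc t₁ t₂)) ht₁₂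
    have e3 := ofReal_dist_le_pathELength (hγ.contMDiffOn (s := Icc t₂ 1)) ht₂
    have e4 := (add_le_add (add_le_add e1 e2) e3)
    rw [pathELength_add ht₁ ht₁₂, pathELength_add (ht₁.trans ht₁₂) ht₂, h0, h1] at e4
    have e5 := e4.trans_lt hL
    rw [← ENNReal.ofReal_add dist_nonneg dist_nonneg, ← ENNReal.ofReal_add (by positivity)
      dist_nonneg, ENNReal.ofReal_lt_ofReal_iff (by positivity)] at e5
    exact e5
  refine ⟨fun s => γ (τ s), hτf, fun s hs => ?_, fun s hs s' hs' hss' => ?_⟩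
  · have := hsum (τ s) (τ s) (hτI s hs).1 le_rfl (hτI s hs).2
    rw [hτf s hs, dist_self] at this
    linarith
  · have h2 := hsum (τ s) (τ s') (hτI s hs).1 (hmono s hs s' hs' hss') (hτI s' hs').2
    have h3 := dist_triangle p (γ (τ s')) q
    rw [hτf s' hs'] at h3
    rw [hτf s hs] at h2
    linarith

theorem exists_dist_eq_of_le (E : Type*) [NormedAddCommGroup E] [NormedSpace ℝ E] [FiniteDimensional ℝ E]
    {M : Type*} [MetricSpace M] [ChartedSpace E M] [IsManifold 𝓘(ℝ, E) ∞ M]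
    [RiemannianBundle (fun x : M => TangentSpace 𝓘(ℝ, E) x)]
    [IsContMDiffRiemannianBundle 𝓘(ℝ, E) ∞ E (fun x : M => TangentSpace 𝓘(ℝ, E) x)]
    [IsRiemannianManifold 𝓘(ℝ, E) M]
    {p q : M} {s ε : ℝ} (hs0 : 0 ≤ s) (hs : s ≤ dist p q) (hε : 0 < ε) :
    ∃ z, dist p z = s ∧ dist z q < dist p q - s + ε := by
  obtain ⟨ζ, h1, h2, -⟩ := exists_almost_minimizing E p q hε
  exact ⟨ζ s, h1 s ⟨hs0, hs⟩, h2 s ⟨hs0, hs⟩⟩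

/-- A complete Riemannian manifold of finite dimension is a proper metric space. -/
theorem properSpace_of_complete (E : Type*) [NormedAddCommGroup E] [NormedSpace ℝ E] [FiniteDimensional ℝ E]
    {M : Type*} [MetricSpace M] [ChartedSpace E M] [IsManifold 𝓘(ℝ, E) ∞ M]
    [RiemannianBundle (fun x : M => TangentSpace 𝓘(ℝ, E) x)]
    [IsContMDiffRiemannianBundle 𝓘(ℝ, E) ∞ E (fun x : M => TangentSpace 𝓘(ℝ, E) x)]
    [IsRiemannianManifold 𝓘(ℝ, E) M]
    [CompleteSpace M] : ProperSpace M := by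
  have : LocallyCompactSpace M := ChartedSpace.locallyCompactSpace E M
  refine ⟨fun p R => ?_⟩
  rcases lt_or_ge R 0 with hR | hR
  · rw [Metric.closedBall_eq_empty.2 hR]
    exact isCompact_empty
  -- Continuous induction on the radius. `S` is closed because a ball is covered by an `ε /
  -- 2`-neighbourhood of a slightly smaller one, and completeness upgrades total boundedness to
  -- compactness; it is open to the right by local compactness. Both use that a point beyond a
  -- sphere is almost reached from it.
  set S : Set ℝ := {r | IsCompact (Metric.closedBall p r)} with hS
  suffices Icc 0 R ⊆ S from this ⟨hR, le_rfl⟩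
  have hclosed : IsClosed (S ∩ Icc 0 R) := by
    refine isClosed_of_closure_subset fun r hr => ?_
    have hrI : r ∈ Icc 0 R := closure_minimal inter_subset_right isClosed_Icc hr
    refine ⟨?_, hrI⟩
    refine TotallyBounded.isCompact_of_isClosed (Metric.totallyBounded_iff.2 fun ε hε => ?_)
      Metric.isClosed_closedBall
    obtain ⟨r', hr', hd⟩ := Metric.mem_closure_iff.1 hr (ε / 4) (by positivity)
    obtain ⟨t, ht, hcov⟩ := Metric.totallyBounded_iff.1 hr'.1.totallyBounded (ε / 2)
      (by positivity)
    refine ⟨t, ht, fun x hx => ?_⟩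
    have hx' : dist p x ≤ r := by rw [dist_comm]; exact hx
    have hd' := (abs_lt.1 (by rwa [Real.dist_eq] at hd)).2
    obtain ⟨z, hz, hzx⟩ : ∃ z ∈ Metric.closedBall p r', dist x z < ε / 2 := by
      rcases le_total (dist p x) r' with h | h
      · exact ⟨x, by rwa [Metric.mem_closedBall, dist_comm], by rw [dist_self]; positivity⟩
      · obtain ⟨z, h1, h2⟩ := exists_dist_eq_of_le E hr'.2.1 h (ε := ε / 4) (by positivity)
        refine ⟨z, by rw [Metric.mem_closedBall, dist_comm, h1], ?_⟩
        rw [dist_comm]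
        linarith
    obtain ⟨y, hy, hzy⟩ := mem_iUnion₂.1 (hcov hz)
    refine mem_iUnion₂.2 ⟨y, hy, ?_⟩
    rw [Metric.mem_ball] at hzy ⊢
    have := dist_triangle x z y
    linarith
  refine hclosed.Icc_subset_of_forall_exists_gt ?_ fun r hr y hy => ?_
  · simp only [hS, mem_ofPred_eq, Metric.closedBall_zero]
    exact isCompact_singleton
  · obtain ⟨K, hK, hsub⟩ := exists_compact_superset hr.1
    obtain ⟨δ, hδ, hδK⟩ := hr.1.exists_thickening_subset_open isOpen_interior hsub
    have hy' : r < y := hy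
    have hm : min y (r + δ / 2) ∈ Ioc r y := by
      refine ⟨lt_min hy' (by linarith), min_le_left _ _⟩
    refine ⟨min y (r + δ / 2), ?_, hm⟩
    refine hK.of_isClosed_subset Metric.isClosed_closedBall fun x hx => ?_
    refine interior_subset (hδK ?_)
    have hx' : dist p x ≤ r + δ / 2 := by
      rw [dist_comm]
      exact (Metric.mem_closedBall.1 hx).trans (min_le_right _ _)
    rw [Metric.mem_thickening_iff]
    rcases le_total (dist p x) r with h | h
    · exact ⟨x, by rwa [Metric.mem_closedBall, dist_comm], by rwa [dist_self]⟩
    · obtain ⟨z, h1, h2⟩ := exists_dist_eq_of_le E hr.2.1 h (ε := δ / 4) (by positivity)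
      refine ⟨z, by rw [Metric.mem_closedBall, dist_comm, h1], ?_⟩
      rw [dist_comm]
      linarith

/-- In a proper space, bounded sequences converge along an ultrafilter. -/
theorem exists_tendsto_ultrafilter {X ι : Type*} [PseudoMetricSpace X] [ProperSpace X]
    (U : Ultrafilter ι) (u : ι → X) (p : X) (R : ℝ) (hu : ∀ᶠ k in U, dist (u k) p ≤ R) :
    ∃ x, Filter.Tendsto u U (𝓝 x) := by
  obtain ⟨x, -, hx⟩ := (isCompact_closedBall p R).ultrafilter_le_nhds (U.map u)
    (Filter.le_principal_iff.2 (Filter.mem_map.2 hu))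
  exact ⟨x, hx⟩

/-- In a complete Riemannian manifold, any two points are joined by a curve that is parametrized
by arc length and minimizes distances. -/
theorem exists_minimizing_curve (E : Type*) [NormedAddCommGroup E] [NormedSpace ℝ E] [FiniteDimensional ℝ E]
    {M : Type*} [MetricSpace M] [ChartedSpace E M] [IsManifold 𝓘(ℝ, E) ∞ M]
    [RiemannianBundle (fun x : M => TangentSpace 𝓘(ℝ, E) x)]
    [IsContMDiffRiemannianBundle 𝓘(ℝ, E) ∞ E (fun x : M => TangentSpace 𝓘(ℝ, E) x)]
    [IsRiemannianManifold 𝓘(ℝ, E) M]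
    [CompleteSpace M] (p q : M) :
    ∃ z : ℝ → M, z 0 = p ∧ z (dist p q) = q ∧
      ∀ s ∈ Icc 0 (dist p q), ∀ t ∈ Icc 0 (dist p q), dist (z s) (z t) = |s - t| := by
  have := properSpace_of_complete E (M := M)
  choose ζ hζ1 hζ2 hζ3 using fun k : ℕ => exists_almost_minimizing E p q
    (ε := 1 / ((k : ℝ) + 1)) (by positivity)
  -- An ultrafilter gives limits at all parameters `s` simultaneously, with no extraction of
  -- subsequences.
  set U := Filter.hyperfilter ℕ
  have hU : (U : Filter ℕ) ≤ Filter.atTop := Nat.hyperfilter_le_atTop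
  have hε : Filter.Tendsto (fun k : ℕ => 1 / ((k : ℝ) + 1)) U (𝓝 0) :=
    tendsto_one_div_add_atTop_nhds_zero_nat.mono_left hU
  have hlim : ∀ s, ∃ x, s ∈ Icc 0 (dist p q) → Filter.Tendsto (fun k => ζ k s) U (𝓝 x) := by
    intro s
    by_cases hs : s ∈ Icc 0 (dist p q)
    · obtain ⟨x, hx⟩ := exists_tendsto_ultrafilter U (fun k => ζ k s) p s
        (Filter.Eventually.of_forall fun k => by rw [dist_comm, hζ1 k s hs])
      exact ⟨x, fun _ => hx⟩
    · exact ⟨p, fun h => absurd h hs⟩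
  choose z hz using hlim
  have hzp : ∀ s ∈ Icc 0 (dist p q), dist p (z s) = s := by
    intro s hs
    have h1 := tendsto_const_nhds (x := p).dist (hz s hs)
    simp only [hζ1 _ s hs] at h1
    exact tendsto_nhds_unique h1 tendsto_const_nhds
  have hle : ∀ s ∈ Icc 0 (dist p q), ∀ t ∈ Icc 0 (dist p q), s ≤ t → dist (z s) (z t) = t - s := by
    intro s hs t ht hst
    refine le_antisymm ?_ ?_
    · have h1 := (hz s hs).dist (hz t ht)
      have h2 := hε.const_add (t - s)
      rw [add_zero] at h2
      exact le_of_tendsto_of_tendsto h1 h2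
        (Filter.Eventually.of_forall fun k => (hζ3 k s hs t ht hst).le)
    -- Distances cannot shrink in the limit, since `z s` and `z t` lie at distances exactly `s` and
    -- `t` from `p`.
    · have := dist_triangle p (z s) (z t)
      rw [hzp s hs, hzp t ht] at this
      linarith
  refine ⟨z, ?_, ?_, fun s hs t ht => ?_⟩
  · exact (dist_eq_zero.1 (hzp 0 ⟨le_rfl, dist_nonneg⟩)).symm
  · have hq : dist p q ∈ Icc 0 (dist p q) := ⟨dist_nonneg, le_rfl⟩
    have h1 := (hz _ hq).dist (tendsto_const_nhds (x := q))
    have h2 := hε.const_add (dist p q - dist p q)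
    rw [sub_self, zero_add] at h2
    have h3 := le_of_tendsto_of_tendsto h1 h2 (Filter.Eventually.of_forall fun k => by
      have := (hζ2 k _ hq).le
      linarith)
    exact dist_le_zero.1 h3
  · rcases le_total s t with h | h
    · rw [hle s hs t ht h, abs_sub_comm, abs_of_nonneg (sub_nonneg.2 h)]
    · rw [dist_comm, hle t ht s hs h, abs_of_nonneg (sub_nonneg.2 h)]

end HopfRinow

/-! ### Reparametrization, constant speed, existence of minimal geodesics -/

section GeodesicBasics

variable {E : Type*} [NormedAddCommGroup E] [NormedSpace ℝ E] [FiniteDimensional ℝ E]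
  {M : Type*} [MetricSpace M] [ChartedSpace E M] [IsManifold 𝓘(ℝ, E) ∞ M]
  [RiemannianBundle (fun x : M => TangentSpace 𝓘(ℝ, E) x)]
  [IsContMDiffRiemannianBundle 𝓘(ℝ, E) ∞ E (fun x : M => TangentSpace 𝓘(ℝ, E) x)]

theorem IsGeodesicOn.mono {γ : ℝ → M} {a b a' b' : ℝ} (h : IsGeodesicOn E γ a b) (ha : a ≤ a')
    (hb : b' ≤ b) : IsGeodesicOn E γ a' b' :=
  ⟨h.1.mono (Icc_subset_Icc ha hb), h.2.1.mono (Ioo_subset_Ioo ha hb),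
    fun t ht => h.2.2 t (Ioo_subset_Ioo ha hb ht)⟩

theorem IsGeodesicOn.mdifferentiableAt {γ : ℝ → M} {a b : ℝ} (h : IsGeodesicOn E γ a b) {t : ℝ}
    (ht : t ∈ Ioo a b) : MDifferentiableAt 𝓘(ℝ, ℝ) 𝓘(ℝ, E) γ t :=
  (h.2.1.contMDiffAt (isOpen_Ioo.mem_nhds ht)).mdifferentiableAt (by simp)

theorem deriv_comp_mul_add {F : Type*} [NormedAddCommGroup F] [NormedSpace ℝ F] (f : ℝ → F)
    (c d t : ℝ) : deriv (fun t => f (c * t + d)) t = c • deriv f (c * t + d) := by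
  rw [deriv_comp_mul_left c (fun s => f (s + d)) t, deriv_comp_add_const]

theorem chartMetric_smul_smul (p : M) (x : E) (c d : ℝ) (v w : E) :
    metricForm p x (c • v) (d • w) = c * (d * metricForm p x v w) := by
  simp only [map_smul, smul_apply, smul_eq_mul]
  ring

theorem chartAcceleration_comp_mul_add {p : M} {γ : ℝ → M} {c d t : ℝ}
    (ht : γ (c * t + d) ∈ (chartAt E p).source) (w : E) :
    chartAcceleration E p (fun t => γ (c * t + d)) t w =
      c ^ 2 * chartAcceleration E p γ (c * t + d) w := by
  have h1 : deriv (chartCurve E p fun t => γ (c * t + d)) =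
      fun t => c • deriv (chartCurve E p γ) (c * t + d) :=
    funext fun s => deriv_comp_mul_add (chartCurve E p γ) c d s
  have h2 : deriv (deriv (chartCurve E p fun t => γ (c * t + d))) t =
      (c ^ 2) • deriv (deriv (chartCurve E p γ)) (c * t + d) := by
    rw [h1, deriv_fun_const_smul_field, deriv_comp_mul_add, smul_smul, sq]
  have h3 : ∀ a b e : E, fderiv ℝ (metricForm p) (chartCurve E p γ (c * t + d)) e (c • a) (c • b) =
      c ^ 2 * fderiv ℝ (metricForm p) (chartCurve E p γ (c * t + d)) e a b := by
    intro a b e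
    rw [ContinuousLinearMap.map_smul (M₂ := E →L[ℝ] ℝ), smul_apply, ContinuousLinearMap.map_smul,
      smul_smul, smul_eq_mul, sq]
  have h4 : ∀ a b e : E, fderiv ℝ (metricForm p) (chartCurve E p γ (c * t + d)) (c • e) a b =
      c * fderiv ℝ (metricForm p) (chartCurve E p γ (c * t + d)) e a b := by
    intro a b e
    rw [ContinuousLinearMap.map_smul (M₂ := E →L[ℝ] E →L[ℝ] ℝ), smul_apply, smul_apply,
      smul_eq_mul]
  have h5 : ∀ a b e : E, fderiv ℝ (metricForm p) (chartCurve E p γ (c * t + d)) e (c • a) b =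
      c * fderiv ℝ (metricForm p) (chartCurve E p γ (c * t + d)) e a b := by
    intro a b e
    rw [ContinuousLinearMap.map_smul (M₂ := E →L[ℝ] ℝ), smul_apply, smul_eq_mul]
  rw [chartAcceleration_eq (γ := fun t => γ (c * t + d)) ht, chartAcceleration_eq ht, h2, h1]
  change metricForm p (chartCurve E p γ (c * t + d)) _ w +
    fderiv ℝ (metricForm p) (chartCurve E p γ (c * t + d)) _ _ _ -
    fderiv ℝ (metricForm p) (chartCurve E p γ (c * t + d)) _ _ _ / 2 = _
  rw [h3, h4, h5, map_smul, smul_apply, smul_eq_mul]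
  ring

/-- Affine reparametrizations of geodesics are geodesics. -/
theorem IsGeodesicOn.comp_mul_add {γ : ℝ → M} {a b c d : ℝ} (hc : 0 < c)
    (h : IsGeodesicOn E γ (c * a + d) (c * b + d)) :
    IsGeodesicOn E (fun t => γ (c * t + d)) a b := by
  have h1 : MapsTo (fun t => c * t + d) (Icc a b) (Icc (c * a + d) (c * b + d)) := fun t ht =>
    ⟨add_le_add_left (mul_le_mul_of_nonneg_left ht.1 hc.le) d,
      add_le_add_left (mul_le_mul_of_nonneg_left ht.2 hc.le) d⟩
  have h2 : MapsTo (fun t => c * t + d) (Ioo a b) (Ioo (c * a + d) (c * b + d)) := fun t ht =>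
    ⟨add_lt_add_left (mul_lt_mul_of_pos_left ht.1 hc) d,
      add_lt_add_left (mul_lt_mul_of_pos_left ht.2 hc) d⟩
  refine ⟨h.1.comp (by fun_prop) h1, h.2.1.comp ?_ h2, fun t ht p hp w => ?_⟩
  · exact ContDiff.contMDiff (by fun_prop) |>.contMDiffOn
  · rw [chartAcceleration_comp_mul_add hp, h.2.2 _ (h2 ht) p hp w, mul_zero]

theorem curveSpeed_comp_mul_add {γ : ℝ → M} {c d t : ℝ} (hc : 0 ≤ c)
    (h : MDifferentiableAt 𝓘(ℝ, ℝ) 𝓘(ℝ, E) γ (c * t + d)) :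
    curveSpeed E (fun t => γ (c * t + d)) t = c * curveSpeed E γ (c * t + d) := by
  have hd : DifferentiableAt ℝ (fun t => c * t + d) t := by fun_prop
  have h1 : MDifferentiableAt 𝓘(ℝ, ℝ) 𝓘(ℝ, E) (fun t => γ (c * t + d)) t :=
    MDifferentiableAt.comp t h hd.mdifferentiableAt
  have hs := mem_chart_source E (γ (c * t + d))
  have h2 := (curveSpeed_sq_eq (γ (c * t + d)) h1 hs).2
  have h3 := (curveSpeed_sq_eq (γ (c * t + d)) h hs).2
  have h4 : deriv (chartCurve E (γ (c * t + d)) fun t => γ (c * t + d)) t =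
      c • deriv (chartCurve E (γ (c * t + d)) γ) (c * t + d) :=
    deriv_comp_mul_add (chartCurve E (γ (c * t + d)) γ) c d t
  rw [h4] at h2
  change _ = metricForm (γ (c * t + d)) (chartCurve E (γ (c * t + d)) γ (c * t + d)) _ _ at h2
  rw [chartMetric_smul_smul, ← h3] at h2
  have h5 := curveSpeed_nonneg (E := E) γ (c * t + d)
  rw [← sq_eq_sq₀ (curveSpeed_nonneg _ _) (by positivity), h2]
  ring

theorem isGeodesicOn_const (x : M) (a b : ℝ) : IsGeodesicOn E (fun _ => x) a b := by
  refine ⟨continuousOn_const (c := x), contMDiffOn_const, fun t ht p hp w => ?_⟩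
  -- A constant curve is its own reparametrization by the factor `c = 0`, and the acceleration
  -- scales by `c ^ 2`.
  have h1 := chartAcceleration_comp_mul_add (γ := fun _ => x) (c := 0) (d := 0) (t := t) (p := p)
    hp w
  simpa using h1

theorem curveSpeed_const (x : M) (t : ℝ) : curveSpeed E (fun _ => x) t = 0 := by
  rw [curveSpeed, mfderiv_const]
  exact norm_zero

/-- The coordinates of a geodesic are twice differentiable and satisfy the geodesic equation. -/
theorem IsGeodesicOn.hasDerivAt_chartCurve {γ : ℝ → M} {a b t : ℝ} (h : IsGeodesicOn E γ a b)
    (ht : t ∈ Ioo a b) {p : M} (hp : γ t ∈ (chartAt E p).source) :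
    HasDerivAt (chartCurve E p γ) (deriv (chartCurve E p γ) t) t ∧
    HasDerivAt (deriv (chartCurve E p γ)) (deriv (deriv (chartCurve E p γ)) t) t ∧
    ∀ w, metricForm p (chartCurve E p γ t) (deriv (deriv (chartCurve E p γ)) t) w +
      fderiv ℝ (metricForm p) (chartCurve E p γ t) (deriv (chartCurve E p γ) t)
        (deriv (chartCurve E p γ) t) w -
      fderiv ℝ (metricForm p) (chartCurve E p γ t) w (deriv (chartCurve E p γ) t)
        (deriv (chartCurve E p γ) t) / 2 = 0 := by
  have h1 : ContDiffAt ℝ 2 (chartCurve E p γ) t :=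
    contDiffAt_chartCurve (n := 2) (h.2.1.contMDiffAt (isOpen_Ioo.mem_nhds ht)) hp
  refine ⟨(h1.differentiableAt (by simp)).hasDerivAt, ?_, fun w => ?_⟩
  · have h2 : ContDiffAt ℝ (1 + 1) (chartCurve E p γ) t := by
      rw [one_add_one_eq_two]
      exact h1
    have h3 : ContDiffAt ℝ 1 (fderiv ℝ (chartCurve E p γ)) t :=
      h2.fderiv_right le_rfl
    have h4 : DifferentiableAt ℝ (fun s => fderiv ℝ (chartCurve E p γ) s 1) t :=
      (h3.differentiableAt (by simp)).clm_apply (differentiableAt_const 1)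
    have h5 : deriv (chartCurve E p γ) = fun s => fderiv ℝ (chartCurve E p γ) s 1 :=
      funext fun s => fderiv_apply_one_eq_deriv.symm
    rw [h5]
    exact h4.hasDerivAt
  · rw [← chartAcceleration_eq hp]
    exact h.2.2 t ht p hp w

/-- Geodesics have constant speed. -/
theorem IsGeodesicOn.curveSpeed_eq {γ : ℝ → M} {a b : ℝ} (h : IsGeodesicOn E γ a b) {s t : ℝ}
    (hs : s ∈ Ioo a b) (ht : t ∈ Ioo a b) : curveSpeed E γ s = curveSpeed E γ t := by
  have key : ∀ t ∈ Ioo a b, HasDerivAt (fun s => curveSpeed E γ s ^ 2) 0 t := by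
    intro t ht
    have hp := mem_chart_source E (γ t)
    obtain ⟨h1, h2, h3⟩ := h.hasDerivAt_chartCurve ht hp
    have hT : chartCurve E (γ t) γ t ∈ (extChartAt 𝓘(ℝ, E) (γ t)).target :=
      (extChartAt 𝓘(ℝ, E) (γ t)).map_source (by simp)
    -- The derivative of `g(x', x')` is `dg(x')(x', x') + 2 g(x'', x')`, twice the geodesic equation
    -- paired with `w = x'`.
    have h4 := (differentiableAt_metricForm hT).hasFDerivAt.hasDerivAt_bilin h1 h2 h2
    have h5 := h3 (deriv (chartCurve E (γ t) γ) t)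
    have h6 := metricForm_symm (γ t) (chartCurve E (γ t) γ t)
      (deriv (chartCurve E (γ t) γ) t) (deriv (deriv (chartCurve E (γ t) γ)) t)
    refine (h4.congr_deriv (by linarith)).congr_of_eventuallyEq ?_
    have hO : ∀ᶠ s in 𝓝 t, s ∈ Ioo a b := isOpen_Ioo.mem_nhds ht
    have hC : ∀ᶠ s in 𝓝 t, γ s ∈ (chartAt E (γ t)).source :=
      (h.mdifferentiableAt ht).continuousAt.eventually ((chartAt E (γ t)).open_source.mem_nhds hp)
    filter_upwards [hO, hC] with s hs hs'
    exact (curveSpeed_sq_eq (γ t) (h.mdifferentiableAt hs) hs').2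
  have h1 := isOpen_Ioo.is_const_of_deriv_eq_zero isPreconnected_Ioo
    (fun t ht => (key t ht).differentiableAt.differentiableWithinAt)
    (fun t ht => (key t ht).deriv) hs ht
  rwa [sq_eq_sq₀ (curveSpeed_nonneg _ _) (curveSpeed_nonneg _ _)] at h1

theorem pathELength_eq_of_curveSpeed {γ : ℝ → M} {a b v : ℝ}
    (h : ∀ t ∈ Ioo a b, curveSpeed E γ t = v) (hv : 0 ≤ v) :
    pathELength 𝓘(ℝ, E) γ a b = ENNReal.ofReal (v * (b - a)) := by
  rw [pathELength_eq_lintegral_curveSpeed, MeasureTheory.setLIntegral_congr_fun measurableSet_Ioo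
    (fun t ht => by rw [h t ht]), MeasureTheory.setLIntegral_const, Real.volume_Ioo,
    ENNReal.ofReal_mul hv]

variable [IsRiemannianManifold 𝓘(ℝ, E) M]

/-- Length bounds distance inside the interval. A geodesic is only required to be continuous at the
end points, so these are reached by closure, one variable at a time. -/
theorem IsGeodesicOn.dist_le {γ : ℝ → M} {a b v : ℝ} (h : IsGeodesicOn E γ a b)
    (hv : 0 ≤ v) (hv' : ∀ t ∈ Ioo a b, curveSpeed E γ t = v) {s t : ℝ}
    (hs : s ∈ Icc a b) (ht : t ∈ Icc a b) : dist (γ s) (γ t) ≤ v * |s - t| := by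
  rcases eq_or_lt_of_le (hs.1.trans hs.2) with rfl | hab
  · rw [Icc_self, mem_singleton_iff] at hs ht
    rw [hs, ht]
    simp
  have h1 : ∀ s ∈ Ioo a b, ∀ t ∈ Ioo a b, s ≤ t → dist (γ s) (γ t) ≤ v * |s - t| := by
    intro s hs t ht hst
    have hsub : Icc s t ⊆ Ioo a b := Icc_subset_Ioo hs.1 ht.2
    have h2 := ofReal_dist_le_pathELength
      ((h.2.1.mono hsub).of_le (by norm_num : (1 : WithTop ℕ∞) ≤ 2)) hst
    rw [pathELength_eq_of_curveSpeed
      (fun r hr => hv' r (hsub (Ioo_subset_Icc_self hr))) hv,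
      ENNReal.ofReal_le_ofReal_iff (mul_nonneg hv (sub_nonneg.2 hst))] at h2
    rwa [abs_sub_comm, abs_of_nonneg (sub_nonneg.2 hst)]
  have h2 : ∀ s ∈ Ioo a b, ∀ t ∈ Ioo a b, dist (γ s) (γ t) ≤ v * |s - t| := by
    intro s hs t ht
    rcases le_total s t with hst | hst
    · exact h1 s hs t ht hst
    · rw [dist_comm, abs_sub_comm]
      exact h1 t ht s hs hst
  have hcl : closure (Ioo a b) = Icc a b := closure_Ioo hab.ne
  have h3 : ∀ s ∈ Ioo a b, ∀ t ∈ Icc a b, dist (γ s) (γ t) ≤ v * |s - t| := by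
    intro s hs t ht
    refine le_on_closure (f := fun t => dist (γ s) (γ t)) (g := fun t => v * |s - t|)
      (h2 s hs) ?_ ?_ (by rwa [hcl])
    · rw [hcl]
      exact fun r hr => Filter.Tendsto.dist tendsto_const_nhds (h.1 r hr)
    · exact Continuous.continuousOn (by fun_prop)
  refine le_on_closure (f := fun s => dist (γ s) (γ t)) (g := fun s => v * |s - t|)
    (fun s hs => h3 s hs t ht) ?_ ?_ (by rwa [hcl])
  · rw [hcl]
    exact fun r hr => Filter.Tendsto.dist (h.1 r hr) tendsto_const_nhds
  · exact Continuous.continuousOn (by fun_prop)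

/-- In a complete Riemannian manifold, any two points are joined by a length-minimizing
geodesic. -/
theorem exists_isGeodesicOn (E : Type*) [NormedAddCommGroup E] [NormedSpace ℝ E]
    [FiniteDimensional ℝ E] {M : Type*} [MetricSpace M] [ChartedSpace E M]
    [IsManifold 𝓘(ℝ, E) ∞ M] [RiemannianBundle (fun x : M => TangentSpace 𝓘(ℝ, E) x)]
    [IsContMDiffRiemannianBundle 𝓘(ℝ, E) ∞ E (fun x : M => TangentSpace 𝓘(ℝ, E) x)]
    [IsRiemannianManifold 𝓘(ℝ, E) M] [CompleteSpace M] (p q : M) :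
    ∃ σ : ℝ → M, IsGeodesicOn E σ 0 1 ∧ σ 0 = p ∧ σ 1 = q ∧
      ∀ t ∈ Ioo (0 : ℝ) 1, curveSpeed E σ t = dist p q := by
  rcases eq_or_ne p q with rfl | hpq
  · exact ⟨fun _ => p, isGeodesicOn_const p 0 1, rfl, rfl, fun t _ => by
      rw [curveSpeed_const, dist_self]⟩
  obtain ⟨z, h0, h1, hz⟩ := exists_minimizing_curve E p q
  have hd : 0 < dist p q := dist_pos.2 hpq
  obtain ⟨hg, hsp⟩ := isGeodesicOn_of_dist_eq (E := E) hz
  refine ⟨fun t => z (dist p q * t + 0), IsGeodesicOn.comp_mul_add hd (by simpa using hg),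
    by simpa using h0, by simpa using h1, fun t ht => ?_⟩
  have ht' : dist p q * t + 0 ∈ Ioo 0 (dist p q) := by
    rw [add_zero]
    exact ⟨mul_pos hd ht.1, mul_lt_of_lt_one_right hd ht.2⟩
  rw [curveSpeed_comp_mul_add hd.le (hg.mdifferentiableAt ht'), hsp _ ht', mul_one]

end GeodesicBasics

/-! ### Limits of solutions of second order differential equations -/

section LimitODE

variable {E : Type*} [NormedAddCommGroup E] [NormedSpace ℝ E]

/-- By the mean value inequality for `f k s - s • g k t`, the error of the linear approximation is
at most `ε |s - t|` for almost all `k`, and this passes to the limit. Pointwise convergence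
suffices, since the derivatives are equicontinuous at `t`. -/
theorem hasDerivAt_of_tendsto_of_equicontinuous {ι : Type*} {l : Filter ι} [l.NeBot]
    {f g : ι → ℝ → E} {F : ℝ → E} {G : E} {t : ℝ}
    (hf : ∀ᶠ s in 𝓝 t, Filter.Tendsto (fun k => f k s) l (𝓝 (F s)))
    (hg : Filter.Tendsto (fun k => g k t) l (𝓝 G))
    (hd : ∀ ε > 0, ∃ δ > 0, ∀ᶠ k in l, ∀ s ∈ Metric.ball t δ,
      HasDerivAt (f k) (g k s) s ∧ ‖g k s - g k t‖ ≤ ε) : HasDerivAt F G t := by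
  rw [hasDerivAt_iff_isLittleO, Asymptotics.isLittleO_iff]
  intro ε hε
  obtain ⟨δ, hδ, h⟩ := hd ε hε
  filter_upwards [hf, Metric.ball_mem_nhds t hδ] with s hs hsδ
  have h1 : Filter.Tendsto (fun k => ‖f k s - f k t - (s - t) • g k t‖) l
      (𝓝 ‖F s - F t - (s - t) • G‖) :=
    ((hs.sub hf.self_of_nhds).sub (hg.const_smul (s - t))).norm
  refine le_of_tendsto h1 (h.mono fun k hk => ?_)
  have h2 := (convex_ball t δ).norm_image_sub_le_of_norm_hasDerivWithin_le
    (f := fun s => f k s - s • g k t) (f' := fun s => g k s - g k t) (C := ε)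
    (fun r hr => by
      have := (hk r hr).1.sub ((hasDerivAt_id r).smul_const (g k t))
      rw [one_smul] at this
      exact this.hasDerivWithinAt)
    (fun r hr => (hk r hr).2) (Metric.mem_ball_self hδ) hsδ
  have h3 : f k s - f k t - (s - t) • g k t = f k s - s • g k t - (f k t - t • g k t) := by
    module
  rw [h3]
  exact h2

/-- Limits of solutions of a second order differential equation are solutions. -/
theorem exists_hasDerivAt_of_tendsto {ι : Type*} (U : Ultrafilter ι) {Ω : E × E → E}
    {S : Set (E × E)} (hS : IsCompact S) (hΩ : ContinuousOn Ω S) {x v : ι → ℝ → E} {X : ℝ → E}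
    {α β : ℝ} (hx : ∀ᶠ k in U, ∀ s ∈ Ioo α β, HasDerivAt (x k) (v k s) s ∧
      HasDerivAt (v k) (Ω (x k s, v k s)) s ∧ (x k s, v k s) ∈ S)
    (hX : ∀ s ∈ Ioo α β, Filter.Tendsto (fun k => x k s) U (𝓝 (X s))) :
    ∃ V : ℝ → E, ∀ s ∈ Ioo α β, Filter.Tendsto (fun k => v k s) U (𝓝 (V s)) ∧
      (X s, V s) ∈ S ∧ HasDerivAt X (V s) s ∧ HasDerivAt V (Ω (X s, V s)) s := by
  -- Only the positions are assumed to converge; compactness of `S` makes the velocities converge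
  -- along the ultrafilter.
  have hV : ∀ s, ∃ V, s ∈ Ioo α β → Filter.Tendsto (fun k => v k s) U (𝓝 V) ∧ (X s, V) ∈ S := by
    intro s
    by_cases hs : s ∈ Ioo α β
    · obtain ⟨y, hyS, hy⟩ := hS.ultrafilter_le_nhds (U.map fun k => (x k s, v k s))
        (Filter.le_principal_iff.2 (Filter.mem_map.2 (hx.mono fun k hk => (hk s hs).2.2)))
      have hy' : Filter.Tendsto (fun k => (x k s, v k s)) U (𝓝 y) := hy
      have h1 : y.1 = X s := tendsto_nhds_unique ((continuous_fst.tendsto y).comp hy') (hX s hs)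
      refine ⟨y.2, fun _ => ⟨(continuous_snd.tendsto y).comp hy', ?_⟩⟩
      rw [← h1]
      exact hyS
    · exact ⟨0, fun h => absurd h hs⟩
  choose V hV using hV
  obtain ⟨A, hA⟩ := hS.exists_bound_of_continuousOn hΩ
  obtain ⟨B, hB⟩ := hS.isBounded.exists_norm_le
  -- On an empty interval `S` may be empty too, and then `A` and `B` can be negative.
  have hpos : 0 < max A B + 1 ∨ ∀ s, s ∉ Ioo α β := by
    by_cases h : ∃ s, s ∈ Ioo α β
    · obtain ⟨s, hs⟩ := h
      have := (norm_nonneg _).trans (hB _ (hV s hs).2)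
      left
      linarith [le_max_right A B]
    · right
      exact not_exists.1 h
  rcases hpos with hpos | hemp
  swap
  · exact ⟨V, fun s hs => absurd hs (hemp s)⟩
  set L := max A B + 1 with hL
  have hlip : ∀ᶠ k in U, ∀ s ∈ Ioo α β, ∀ t ∈ Ioo α β,
      ‖x k s - x k t‖ ≤ L * |s - t| ∧ ‖v k s - v k t‖ ≤ L * |s - t| := by
    filter_upwards [hx] with k hk s hs t ht
    constructor
    · refine (convex_Ioo α β).norm_image_sub_le_of_norm_hasDerivWithin_le
        (f' := v k) (fun r hr => (hk r hr).1.hasDerivWithinAt) (fun r hr => ?_) ht hs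
      have h1 := (norm_snd_le (x k r, v k r)).trans (hB _ (hk r hr).2.2)
      exact h1.trans (by linarith [le_max_right A B])
    · refine (convex_Ioo α β).norm_image_sub_le_of_norm_hasDerivWithin_le
        (f' := fun r => Ω (x k r, v k r)) (fun r hr => (hk r hr).2.1.hasDerivWithinAt)
        (fun r hr => ?_) ht hs
      exact (hA _ (hk r hr).2.2).trans (by linarith [le_max_left A B])
  refine ⟨V, fun t ht => ⟨(hV t ht).1, (hV t ht).2, ?_, ?_⟩⟩
  · obtain ⟨η, hη, hηs⟩ := Metric.isOpen_iff.1 isOpen_Ioo t ht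
    refine hasDerivAt_of_tendsto_of_equicontinuous (f := x) (g := v) (l := U) ?_ (hV t ht).1
      fun ε hε => ⟨min η (ε / L), by positivity, ?_⟩
    · filter_upwards [isOpen_Ioo.mem_nhds ht] with s hs using hX s hs
    · filter_upwards [hx, hlip] with k hk hk' s hs
      have hs' := hηs (Metric.ball_subset_ball (min_le_left _ _) hs)
      refine ⟨(hk s hs').1, (hk' s hs' t ht).2.trans ?_⟩
      have h2 : |s - t| < ε / L := (Metric.mem_ball.1 hs).trans_le (min_le_right _ _)
      rw [lt_div_iff₀ hpos] at h2
      linarith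
  · obtain ⟨η, hη, hηs⟩ := Metric.isOpen_iff.1 isOpen_Ioo t ht
    have hlim : Filter.Tendsto (fun k => Ω (x k t, v k t)) U (𝓝 (Ω (X t, V t))) := by
      refine Filter.Tendsto.comp (hΩ _ (hV t ht).2) (tendsto_nhdsWithin_iff.2 ⟨?_, ?_⟩)
      · exact (hX t ht).prodMk_nhds (hV t ht).1
      · filter_upwards [hx] with k hk using (hk t ht).2.2
    refine hasDerivAt_of_tendsto_of_equicontinuous (f := v) (g := fun k s => Ω (x k s, v k s))
      (l := U) ?_ hlim fun ε hε => ?_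
    · filter_upwards [isOpen_Ioo.mem_nhds ht] with s hs using (hV s hs).1
    · obtain ⟨δ, hδ, huc⟩ := Metric.uniformContinuousOn_iff.1
        (hS.uniformContinuousOn_of_continuous hΩ) ε hε
      refine ⟨min η (δ / L), by positivity, ?_⟩
      filter_upwards [hx, hlip] with k hk hk' s hs
      have hs' := hηs (Metric.ball_subset_ball (min_le_left _ _) hs)
      have h2 : |s - t| < δ / L := (Metric.mem_ball.1 hs).trans_le (min_le_right _ _)
      rw [lt_div_iff₀ hpos, mul_comm] at h2
      refine ⟨(hk s hs').2.1, ?_⟩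
      rw [← dist_eq_norm]
      refine (huc _ (hk s hs').2.2 _ (hk t ht).2.2 ?_).le
      rw [Prod.dist_eq, max_lt_iff, dist_eq_norm, dist_eq_norm]
      exact ⟨(hk' s hs' t ht).1.trans_lt h2, (hk' s hs' t ht).2.trans_lt h2⟩

end LimitODE

/-! ### The geodesic equation solved for the acceleration -/

section Spray

variable {E : Type*} [NormedAddCommGroup E] [NormedSpace ℝ E]

/-- The acceleration `x''` of a geodesic of the metric `G` with position `x` and velocity `v`. -/
noncomputable def geodesicSpray (G : E → E →L[ℝ] E →L[ℝ] ℝ) (q : E × E) : E :=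
  (G q.1).inverse ((1 / 2 : ℝ) • ((fderiv ℝ G q.1).flip q.2).flip q.2 - (fderiv ℝ G q.1).flip q.2 q.2)

theorem eq_inverse_apply_iff {g : E →L[ℝ] E →L[ℝ] ℝ} (hg : g.IsInvertible) {a : E}
    {f : E →L[ℝ] ℝ} : a = g.inverse f ↔ ∀ w, g a w = f w := by
  rw [eq_comm, hg.inverse_apply_eq, eq_comm, ContinuousLinearMap.ext_iff]

theorem eq_geodesicSpray_iff {G : E → E →L[ℝ] E →L[ℝ] ℝ} {x v a : E}
    (hG : (G x).IsInvertible) :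
    a = geodesicSpray G (x, v) ↔ ∀ w, G x a w + fderiv ℝ G x v v w - fderiv ℝ G x w v v / 2 = 0 := by
  refine (eq_inverse_apply_iff hG).trans (forall_congr' fun w => ?_)
  have h1 : ((1 / 2 : ℝ) • ((fderiv ℝ G x).flip v).flip v - (fderiv ℝ G x).flip v v) w =
      1 / 2 * fderiv ℝ G x w v v - fderiv ℝ G x v v w := rfl
  rw [h1]
  constructor <;> intro h <;> linarith

theorem continuousAt_flip_apply {X F H W : Type*} [TopologicalSpace X] [NormedAddCommGroup F]
    [NormedSpace ℝ F] [NormedAddCommGroup H] [NormedSpace ℝ H] [NormedAddCommGroup W]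
    [NormedSpace ℝ W] {A : X → W →L[ℝ] F →L[ℝ] H} {v : X → F} {x : X}
    (hA : ContinuousAt A x) (hv : ContinuousAt v x) :
    ContinuousAt (fun q => (A q).flip (v q)) x :=
  ((ContinuousLinearMap.flipₗᵢ ℝ W F H).continuous.continuousAt.comp hA).clm_apply hv

theorem continuousAt_sub_flip {D : E → E →L[ℝ] E →L[ℝ] E →L[ℝ] ℝ} {q : E × E}
    (hD : ContinuousAt D q.1) :
    ContinuousAt (fun q : E × E => (1 / 2 : ℝ) • ((D q.1).flip q.2).flip q.2 -
      (D q.1).flip q.2 q.2) q := by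
  have hD' : ContinuousAt (fun q : E × E => D q.1) q :=
    ContinuousAt.comp (g := D) hD continuousAt_fst
  have h2 : ContinuousAt (fun q : E × E => q.2) q := continuousAt_snd
  have h3 : ContinuousAt (fun q : E × E => (D q.1).flip q.2) q :=
    continuousAt_flip_apply (H := E →L[ℝ] ℝ) (W := E) (F := E) hD' h2
  have h4 : ContinuousAt (fun q : E × E => ((D q.1).flip q.2).flip q.2) q :=
    continuousAt_flip_apply (H := ℝ) (W := E) h3 h2
  have h5 : ContinuousAt (fun q : E × E => (D q.1).flip q.2 q.2) q :=
    ContinuousAt.clm_apply (E := E) (F := E →L[ℝ] ℝ) h3 h2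
  have h6 : ContinuousAt (fun q : E × E => (1 / 2 : ℝ) • ((D q.1).flip q.2).flip q.2) q :=
    Filter.Tendsto.const_smul h4 _
  exact h6.sub h5

theorem continuousAt_inverse_apply {X F H : Type*} [TopologicalSpace X] [NormedAddCommGroup F]
    [NormedSpace ℝ F] [NormedAddCommGroup H] [NormedSpace ℝ H] [CompleteSpace F]
    {A : X → F →L[ℝ] H} {f : X → H} {x : X} (hA : ContinuousAt A x) (hi : (A x).IsInvertible)
    (hf : ContinuousAt f x) : ContinuousAt (fun q => (A q).inverse (f q)) x := by
  obtain ⟨e, he⟩ := hi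
  have h3 := (contDiffAt_map_inverse (n := 1) e).continuousAt
  rw [he] at h3
  exact (ContinuousAt.comp (g := ContinuousLinearMap.inverse) h3 hA).clm_apply hf

/-- Continuity is all that `exists_hasDerivAt_of_tendsto` requires; it follows from that of `G`, of
its derivative, and of inversion at invertible maps. -/
theorem continuousOn_geodesicSpray [FiniteDimensional ℝ E] {G : E → E →L[ℝ] E →L[ℝ] ℝ} {T : Set E}
    (hT : IsOpen T) (hG : ContDiffOn ℝ 1 G T) (hpos : ∀ x ∈ T, ∀ v, v ≠ 0 → 0 < G x v v) :
    ContinuousOn (geodesicSpray G) (T ×ˢ univ) := by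
  have := FiniteDimensional.complete ℝ E
  rintro q ⟨hx, -⟩
  have hD : ContinuousAt (fderiv ℝ G) q.1 :=
    (hG.continuousOn_fderiv_of_isOpen hT le_rfl).continuousAt (hT.mem_nhds hx)
  have hG' : ContinuousAt (fun q : E × E => G q.1) q :=
    ContinuousAt.comp (g := G) (hG.continuousOn.continuousAt (hT.mem_nhds hx)) continuousAt_fst
  exact (continuousAt_inverse_apply hG' (isInvertible_of_pos (G q.1) (hpos q.1 hx))
    (continuousAt_sub_flip hD)).continuousWithinAt

end Spray

/-! ### Limits of geodesics -/

section GeodesicLimit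

variable {E : Type*} [NormedAddCommGroup E] [NormedSpace ℝ E] [FiniteDimensional ℝ E]
  {M : Type*} [MetricSpace M] [ChartedSpace E M] [IsManifold 𝓘(ℝ, E) ∞ M]
  [RiemannianBundle (fun x : M => TangentSpace 𝓘(ℝ, E) x)]
  [IsContMDiffRiemannianBundle 𝓘(ℝ, E) ∞ E (fun x : M => TangentSpace 𝓘(ℝ, E) x)]
  [IsRiemannianManifold 𝓘(ℝ, E) M]

theorem contDiffAt_one_of_hasDerivAt {v f : ℝ → E} {α β t : ℝ} (ht : t ∈ Ioo α β)
    (hv : ∀ s ∈ Ioo α β, HasDerivAt v (f s) s) (hf : ContinuousOn f (Ioo α β)) :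
    ContDiffAt ℝ 1 v t := by
  have h4 : ContDiffOn ℝ (0 + 1) v (Ioo α β) := by
    rw [contDiffOn_succ_iff_deriv_of_isOpen isOpen_Ioo]
    refine ⟨fun s hs => (hv s hs).differentiableAt.differentiableWithinAt, by simp, ?_⟩
    rw [contDiffOn_zero]
    exact hf.congr fun s hs => (hv s hs).deriv
  rw [zero_add] at h4
  exact h4.contDiffAt (isOpen_Ioo.mem_nhds ht)

/-- Curves that converge pointwise and are uniformly Lipschitz eventually stay, uniformly for a
short time, in a given neighbourhood. -/
theorem exists_forall_mem_of_tendsto {ι X : Type*} [PseudoMetricSpace X] {l : Filter ι}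
    {γ : ι → ℝ → X} {Γ : ℝ → X} {a b V t : ℝ} (ht : t ∈ Ioo a b) (hV : 0 ≤ V)
    (hγ : ∀ k, ∀ s ∈ Ioo a b, dist (γ k s) (γ k t) ≤ V * |s - t|)
    (hΓ : Filter.Tendsto (fun k => γ k t) l (𝓝 (Γ t))) {N : Set X} (hN : N ∈ 𝓝 (Γ t)) :
    ∃ ε > 0, Ioo (t - ε) (t + ε) ⊆ Ioo a b ∧
      ∀ᶠ k in l, ∀ s ∈ Ioo (t - ε) (t + ε), γ k s ∈ N := by
  obtain ⟨ρ, hρ, hρN⟩ := Metric.mem_nhds_iff.1 hN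
  obtain ⟨η, hη, hηs⟩ := Metric.isOpen_iff.1 isOpen_Ioo t ht
  refine ⟨min η (ρ / (2 * (V + 1))), by positivity, ?_, ?_⟩
  · rw [← Real.ball_eq_Ioo]
    exact (Metric.ball_subset_ball (min_le_left _ _)).trans hηs
  · filter_upwards [(tendsto_iff_dist_tendsto_zero.1 hΓ).eventually (gt_mem_nhds (half_pos hρ))]
      with k hk s hs
    rw [← Real.ball_eq_Ioo] at hs
    have h1 := hγ k s (hηs (Metric.ball_subset_ball (min_le_left _ _) hs))
    have h2 : |s - t| < ρ / (2 * (V + 1)) := (Metric.mem_ball.1 hs).trans_le (min_le_right _ _)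
    rw [lt_div_iff₀ (by positivity)] at h2
    have h3 := dist_triangle (γ k s) (γ k t) (Γ t)
    have h4 := abs_nonneg (s - t)
    exact hρN (Metric.mem_ball.2 (by nlinarith))

/-- Pointwise limits of geodesics of bounded speed are geodesics. -/
theorem isGeodesicOn_of_tendsto {ι : Type*} (U : Ultrafilter ι) {γ : ι → ℝ → M} {Γ : ℝ → M}
    {a b V : ℝ} {v : ι → ℝ} (hγ : ∀ k, IsGeodesicOn E (γ k) a b)
    (hv : ∀ k, 0 ≤ v k) (hvV : ∀ k, v k ≤ V)
    (hspeed : ∀ k, ∀ t ∈ Ioo a b, curveSpeed E (γ k) t = v k)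
    (hΓ : ∀ t ∈ Icc a b, Filter.Tendsto (fun k => γ k t) U (𝓝 (Γ t))) :
    IsGeodesicOn E Γ a b ∧ ∀ t ∈ Ioo a b, Filter.Tendsto v U (𝓝 (curveSpeed E Γ t)) := by
  obtain ⟨k₀⟩ : Nonempty ι := Filter.nonempty_of_neBot (U : Filter ι)
  have hV : 0 ≤ V := (hv k₀).trans (hvV k₀)
  have hlip : ∀ k, ∀ s ∈ Icc a b, ∀ t ∈ Icc a b, dist (γ k s) (γ k t) ≤ V * |s - t| :=
    fun k s hs t ht => ((hγ k).dist_le (hv k) (hspeed k) hs ht).trans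
      (mul_le_mul_of_nonneg_right (hvV k) (abs_nonneg _))
  have hΓc : ContinuousOn Γ (Icc a b) := by
    have h1 : LipschitzOnWith V.toNNReal Γ (Icc a b) :=
      LipschitzOnWith.of_dist_le_mul fun s hs t ht => by
        rw [Real.dist_eq, Real.coe_toNNReal _ hV]
        exact le_of_tendsto ((hΓ s hs).dist (hΓ t ht))
          (Filter.Eventually.of_forall fun k => hlip k s hs t ht)
    exact h1.continuousOn
  have key : ∀ t ∈ Ioo a b, ∀ p : M, Γ t ∈ (chartAt E p).source → ∃ w : ℝ → E,
      (∀ᶠ s in 𝓝 t, HasDerivAt (chartCurve E p Γ) (w s) s) ∧ ContDiffAt ℝ 1 w t ∧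
      (∀ e, metricForm p (chartCurve E p Γ t) (deriv w t) e +
        fderiv ℝ (metricForm p) (chartCurve E p Γ t) (w t) (w t) e -
        fderiv ℝ (metricForm p) (chartCurve E p Γ t) e (w t) (w t) / 2 = 0) ∧
      Filter.Tendsto (fun k => v k ^ 2) U
        (𝓝 (metricForm p (chartCurve E p Γ t) (w t) (w t))) := by
    intro t ht p hp
    have hp' : Γ t ∈ (extChartAt 𝓘(ℝ, E) p).source := by simpa using hp
    have hT : chartCurve E p Γ t ∈ (extChartAt 𝓘(ℝ, E) p).target :=
      (extChartAt 𝓘(ℝ, E) p).map_source hp'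
    obtain ⟨r, c, C, hb⟩ := exists_chartBounds p hT
    have hc := hb.c_pos
    set N : Set M := (chartAt E p).source ∩
      extChartAt 𝓘(ℝ, E) p ⁻¹' Metric.closedBall (chartCurve E p Γ t) r with hN
    have hNn : N ∈ 𝓝 (Γ t) := Filter.inter_mem ((chartAt E p).open_source.mem_nhds hp)
      ((continuousAt_extChartAt' hp').preimage_mem_nhds
        (Metric.closedBall_mem_nhds _ hb.r_pos))
    -- A closed neighbourhood keeps the limit curve in the chart as well, which is needed for its
    -- coordinates to be limits of coordinates.
    obtain ⟨N', hN', hN'c, hN'N⟩ := exists_mem_nhds_isClosed_subset hNn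
    obtain ⟨ε, hε, hsub, hev'⟩ := exists_forall_mem_of_tendsto ht hV
      (fun k s hs => hlip k s (Ioo_subset_Icc_self hs) t (Ioo_subset_Icc_self ht))
      (hΓ t (Ioo_subset_Icc_self ht)) hN'
    have hev : ∀ᶠ k in U, ∀ s ∈ Ioo (t - ε) (t + ε), γ k s ∈ N :=
      hev'.mono fun k hk s hs => hN'N (hk s hs)
    have htε : t ∈ Ioo (t - ε) (t + ε) := by constructor <;> linarith
    -- The velocity bound: `c ‖x'‖² ≤ g(x', x') = (v k)² ≤ V²`.
    set S : Set (E × E) := Metric.closedBall (chartCurve E p Γ t) r ×ˢ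
      Metric.closedBall 0 (V / √c) with hS
    have hΩ := continuousOn_geodesicSpray (isOpen_extChartAt_target (I := 𝓘(ℝ, E)) p)
      ((contDiffOn_metricForm p).of_le (by simp)) fun x hx e he => metricForm_pos p hx he
    have hST : S ⊆ (extChartAt 𝓘(ℝ, E) p).target ×ˢ univ := prod_mono hb.subset (subset_univ _)
    have hSc : IsCompact S := (isCompact_closedBall _ _).prod (isCompact_closedBall _ _)
    have hspeed2 : ∀ k, ∀ s ∈ Ioo a b, γ k s ∈ (chartAt E p).source →
        v k ^ 2 = metricForm p (chartCurve E p (γ k) s) (deriv (chartCurve E p (γ k)) s)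
          (deriv (chartCurve E p (γ k)) s) := fun k s hs hs' => by
      rw [← hspeed k s hs]
      exact (curveSpeed_sq_eq p ((hγ k).mdifferentiableAt hs) hs').2
    have hmem : ∀ k, ∀ s ∈ Ioo a b, γ k s ∈ N →
        (chartCurve E p (γ k) s, deriv (chartCurve E p (γ k)) s) ∈ S := by
      intro k s hs hsN
      refine ⟨hsN.2, mem_closedBall_zero_iff.2 ?_⟩
      have h1 := hb.lower _ hsN.2 (deriv (chartCurve E p (γ k)) s)
      change _ ≤ metricForm p (chartCurve E p (γ k) s) _ _ at h1
      rw [← hspeed2 k s hs hsN.1] at h1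
      have h2 : √c ^ 2 = c := Real.sq_sqrt hc.le
      have h3 : 0 < √c := Real.sqrt_pos.2 hc
      rw [le_div_iff₀ h3]
      refine abs_le_of_sq_le_sq' ?_ hV |>.2
      rw [mul_pow, h2, mul_comm]
      exact h1.trans (pow_le_pow_left₀ (hv k) (hvV k) 2)
    obtain ⟨w, hw⟩ := exists_hasDerivAt_of_tendsto U hSc (hΩ.mono hST)
      (x := fun k => chartCurve E p (γ k)) (v := fun k => deriv (chartCurve E p (γ k)))
      (X := chartCurve E p Γ) (α := t - ε) (β := t + ε)
      (hev.mono fun k hk s hs => by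
        obtain ⟨h1, h2, h3⟩ := (hγ k).hasDerivAt_chartCurve (hsub hs) (hk s hs).1
        have hm := hmem k s (hsub hs) (hk s hs)
        refine ⟨h1, ?_, hm⟩
        rwa [(eq_geodesicSpray_iff (isInvertible_of_pos (metricForm p (chartCurve E p (γ k) s))
          fun e he => metricForm_pos p (hST hm).1 he)).2 h3] at h2)
      (fun s hs => by
        have h1 := hΓ s (Ioo_subset_Icc_self (hsub hs))
        have h2 : Γ s ∈ (extChartAt 𝓘(ℝ, E) p).source := by
          have h3 := hN'N (hN'c.mem_of_tendsto h1 (hev'.mono fun k hk => hk s hs))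
          simpa using h3.1
        exact (continuousAt_extChartAt' h2).tendsto.comp h1)
    have hwc : ContinuousOn (fun s => geodesicSpray (metricForm p) (chartCurve E p Γ s, w s))
        (Ioo (t - ε) (t + ε)) := by
      refine (hΩ.mono hST).comp (ContinuousOn.prodMk ?_ ?_) fun s hs => (hw s hs).2.1
      · exact fun s hs => (hw s hs).2.2.1.continuousAt.continuousWithinAt
      · exact fun s hs => (hw s hs).2.2.2.continuousAt.continuousWithinAt
    refine ⟨w, ?_, contDiffAt_one_of_hasDerivAt htε (fun s hs => (hw s hs).2.2.2) hwc, ?_, ?_⟩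
    · filter_upwards [isOpen_Ioo.mem_nhds htε] with s hs using (hw s hs).2.2.1
    · rw [(hw t htε).2.2.2.deriv]
      exact (eq_geodesicSpray_iff (isInvertible_of_pos (metricForm p (chartCurve E p Γ t))
          fun e he => metricForm_pos p hT he)).1 rfl
    · have h1 : ContinuousAt (fun q : E × E => metricForm p q.1 q.2 q.2)
          (chartCurve E p Γ t, w t) := by
        have h2 : ContinuousAt (fun q : E × E => metricForm p q.1) (chartCurve E p Γ t, w t) :=
          ContinuousAt.comp (g := metricForm p) (differentiableAt_metricForm hT).continuousAt
            continuousAt_fst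
        exact (h2.clm_apply continuousAt_snd).clm_apply continuousAt_snd
      have h3 : Filter.Tendsto
          (fun k => (chartCurve E p (γ k) t, deriv (chartCurve E p (γ k)) t)) U
          (𝓝 (chartCurve E p Γ t, w t)) :=
        ((continuousAt_extChartAt' hp').tendsto.comp (hΓ t (Ioo_subset_Icc_self ht))).prodMk_nhds
          (hw t htε).1
      refine (h1.tendsto.comp h3).congr' (hev.mono fun k hk => ?_)
      exact (hspeed2 k t ht (hk t htε).1).symm
  have hgeo : IsGeodesicOn E Γ a b := isGeodesicOn_of_chart hΓc fun t ht p hp => by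
    obtain ⟨w, h1, h2, h3, -⟩ := key t ht p hp
    exact ⟨w, h1, h2, h3⟩
  refine ⟨hgeo, fun t ht => ?_⟩
  obtain ⟨w, h1, -, -, h4⟩ := key t ht (Γ t) (mem_chart_source E (Γ t))
  have h5 := (curveSpeed_sq_eq (Γ t) (hgeo.mdifferentiableAt ht) (mem_chart_source E (Γ t))).2
  rw [h1.self_of_nhds.deriv] at h5
  rw [← h5] at h4
  have h6 := (Real.continuous_sqrt.tendsto _).comp h4
  rw [Real.sqrt_sq (curveSpeed_nonneg _ _)] at h6
  exact h6.congr fun k => Real.sqrt_sq (hv k)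

end GeodesicLimit

/-! ### Limits of Schild's construction -/

section SchildLimit

variable {E : Type*} [NormedAddCommGroup E] [NormedSpace ℝ E] [FiniteDimensional ℝ E]
  {M : Type*} [MetricSpace M] [ChartedSpace E M] [IsManifold 𝓘(ℝ, E) ∞ M]
  [RiemannianBundle (fun x : M => TangentSpace 𝓘(ℝ, E) x)]
  [IsContMDiffRiemannianBundle 𝓘(ℝ, E) ∞ E (fun x : M => TangentSpace 𝓘(ℝ, E) x)]

/-- The geodesics in the definition of `geodesicPoints` are those whose speed is the distance of
the two points. -/
theorem mem_geodesicPoints_iff {a b z : M} {t : ℝ} :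
    z ∈ geodesicPoints E a b t ↔ ∃ γ : ℝ → M, IsGeodesicOn E γ (min 0 t) (max 1 t) ∧ γ 0 = a ∧
      γ 1 = b ∧ γ t = z ∧ ∀ s ∈ Ioo (min 0 t) (max 1 t), curveSpeed E γ s = dist a b := by
  have hsub : Ioo (0 : ℝ) 1 ⊆ Ioo (min 0 t) (max 1 t) :=
    Ioo_subset_Ioo (min_le_left _ _) (le_max_left _ _)
  constructor
  · rintro ⟨γ, hγ, h0, h1, hl, ht⟩
    refine ⟨γ, hγ, h0, h1, ht, fun s hs => ?_⟩
    have h2 : ∀ r ∈ Ioo (0 : ℝ) 1, curveSpeed E γ r = curveSpeed E γ s := fun r hr =>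
      hγ.curveSpeed_eq (hsub hr) hs
    rw [pathELength_eq_of_curveSpeed h2 (curveSpeed_nonneg _ _), edist_dist, sub_zero, mul_one,
      ENNReal.ofReal_eq_ofReal_iff (curveSpeed_nonneg _ _) dist_nonneg] at hl
    exact hl
  · rintro ⟨γ, hγ, h0, h1, ht, hs⟩
    refine ⟨γ, hγ, h0, h1, ?_, ht⟩
    rw [pathELength_eq_of_curveSpeed (fun r hr => hs r (hsub hr)) dist_nonneg, edist_dist, sub_zero,
      mul_one]

variable [IsRiemannianManifold 𝓘(ℝ, E) M]

theorem dist_le_of_mem_geodesicPoints {a b z : M} {t : ℝ} (ht : t ∈ Icc (0 : ℝ) 1)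
    (h : z ∈ geodesicPoints E a b t) : dist a z ≤ dist a b := by
  obtain ⟨γ, hγ, rfl, rfl, rfl, hs⟩ := mem_geodesicPoints_iff.1 h
  rw [min_eq_left ht.1, max_eq_left ht.2] at hγ hs
  have h1 := hγ.dist_le dist_nonneg hs (s := 0) (t := t) (by simp) ht
  refine h1.trans (mul_le_of_le_one_right dist_nonneg ?_)
  rw [zero_sub, abs_neg, abs_of_nonneg ht.1]
  exact ht.2

/-- If the distances `D_S([x, yₖ], [u, vₖ])` tend to `0` while `vₖ → x` and `yₖ → y`, then `u`,
`x` and `y` are equidistant points of a geodesic, whose first half has the length of a minimal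
geodesic. -/
theorem exists_isGeodesicOn_of_schildDist_tendsto [CompleteSpace M] {x y u : M} {v w : ℕ → M}
    {ε : ℕ → ℝ} {R : ℝ} (hε : Filter.Tendsto ε Filter.atTop (𝓝 0)) (hR : ∀ k, ε k ≤ R)
    (hv : ∀ k, dist x (v k) ≤ ε k) (hw : ∀ k, dist (w k) y ≤ ε k)
    (hS : ∀ k, schildDist E x (w k) u (v k) < ENNReal.ofReal (ε k)) :
    ∃ Γ : ℝ → M, IsGeodesicOn E Γ 0 2 ∧ Γ 0 = u ∧ Γ 1 = x ∧ Γ 2 = y ∧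
      ∀ t ∈ Ioo (0 : ℝ) 2, curveSpeed E Γ t = dist u x := by
  have := properSpace_of_complete E (M := M)
  have hS' : ∀ k, ∃ (c y' : M) (γ : ℝ → M), dist x c ≤ ε k ∧ dist y' (w k) ≤ ε k ∧
      IsGeodesicOn E γ 0 2 ∧ γ 0 = u ∧ γ 1 = c ∧ γ 2 = y' ∧
      ∀ s ∈ Ioo (0 : ℝ) 2, curveSpeed E γ s = dist u c := by
    intro k
    have h1 := hS k
    simp only [schildDist, iInf_lt_iff] at h1
    obtain ⟨c, hc, y', hy', h2⟩ := h1
    obtain ⟨γ, hγ, h3, h4, h5, h6⟩ := mem_geodesicPoints_iff.1 hy'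
    rw [min_eq_left zero_le_two, max_eq_right one_le_two] at hγ h6
    -- The midpoint `c` lies on a minimal geodesic from `x` to `v k`, hence no farther from `x` than
    -- `v k`.
    refine ⟨c, y', γ, (dist_le_of_mem_geodesicPoints (by norm_num) hc).trans (hv k), ?_, hγ, h3,
      h4, h5, h6⟩
    rw [edist_dist, ENNReal.ofReal_lt_ofReal_iff_of_nonneg dist_nonneg] at h2
    exact h2.le
  choose c y' γ hc hy' hγ h0 h1 h2 hspeed using hS'
  set U := Filter.hyperfilter ℕ with hU
  have hεU : Filter.Tendsto ε U (𝓝 0) := hε.mono_left Nat.hyperfilter_le_atTop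
  have hV : ∀ k, dist u (c k) ≤ dist u x + R := fun k =>
    (dist_triangle u x (c k)).trans (add_le_add_right ((hc k).trans (hR k)) _)
  have hV0 : 0 ≤ dist u x + R := dist_nonneg.trans (hV 0)
  have hlim : ∀ t, ∃ z, t ∈ Icc (0 : ℝ) 2 → Filter.Tendsto (fun k => γ k t) U (𝓝 z) := by
    intro t
    by_cases ht : t ∈ Icc (0 : ℝ) 2
    · obtain ⟨z, hz⟩ := exists_tendsto_ultrafilter U (fun k => γ k t) u ((dist u x + R) * 2)
        (Filter.Eventually.of_forall fun k => by
          have h3 := (hγ k).dist_le dist_nonneg (hspeed k) (s := t) (t := 0) ht (by simp)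
          rw [h0, sub_zero, abs_of_nonneg ht.1] at h3
          exact h3.trans (mul_le_mul (hV k) ht.2 ht.1 hV0))
      exact ⟨z, fun _ => hz⟩
    · exact ⟨u, fun h => absurd h ht⟩
  choose Γ hΓ using hlim
  obtain ⟨hg, hsp⟩ := isGeodesicOn_of_tendsto U hγ (fun k => dist_nonneg) hV hspeed hΓ
  have hcx : Filter.Tendsto c U (𝓝 x) := by
    rw [tendsto_iff_dist_tendsto_zero]
    exact squeeze_zero (fun k => dist_nonneg) (fun k => by rw [dist_comm]; exact hc k) hεU
  have hyy : Filter.Tendsto y' U (𝓝 y) := by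
    rw [tendsto_iff_dist_tendsto_zero]
    have h3 := hεU.add hεU
    rw [add_zero] at h3
    exact squeeze_zero (fun k => dist_nonneg)
      (fun k => (dist_triangle (y' k) (w k) y).trans (add_le_add (hy' k) (hw k))) h3
  refine ⟨Γ, hg, ?_, ?_, ?_, fun t ht => ?_⟩
  · have h3 := hΓ 0 (by simp)
    simp only [h0] at h3
    exact tendsto_nhds_unique h3 tendsto_const_nhds
  · have h3 := hΓ 1 (by simp)
    simp only [h1] at h3
    exact tendsto_nhds_unique h3 hcx
  · have h3 := hΓ 2 (by simp)
    simp only [h2] at h3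
    exact tendsto_nhds_unique h3 hyy
  · exact tendsto_nhds_unique (hsp t ht) (Filter.Tendsto.dist tendsto_const_nhds hcx)

/-- Every summand of a small energy is small, so near-minimizers force `yᵢ` towards `uᵢ₊₁` and each
`D_S` term towards `0`, although a minimizer may be unavailable. -/
theorem exists_isGeodesicOn_of_schildTGV_eq_zero [CompleteSpace M] {α₀ α₁ : ℝ} (hα₀ : 0 < α₀)
    (hα₁ : 0 < α₁) {n : ℕ} {u : ℕ → M} (h : schildTGV E α₀ α₁ n u = 0) {i : ℕ} (hi : i + 2 ≤ n) :
    ∃ Γ : ℝ → M, IsGeodesicOn E Γ 0 2 ∧ Γ 0 = u i ∧ Γ 1 = u (i + 1) ∧ Γ 2 = u (i + 2) ∧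
      ∀ t ∈ Ioo (0 : ℝ) 2, curveSpeed E Γ t = dist (u i) (u (i + 1)) := by
  have h1 : ∀ k : ℕ, ∃ y : ℕ → M,
      schildEnergy E α₀ α₁ n u y < ENNReal.ofReal (1 / ((k : ℝ) + 1)) := by
    intro k
    rw [← iInf_lt_iff]
    change schildTGV E α₀ α₁ n u < _
    rw [h, ENNReal.ofReal_pos]
    positivity
  choose y hy using h1
  have hd : ∀ k, ∀ j < n, dist (u (j + 1)) (y k j) ≤ 1 / α₁ * (1 / ((k : ℝ) + 1)) := by
    intro k j hj
    have h2 : ENNReal.ofReal α₁ * edist (u (j + 1)) (y k j) < ENNReal.ofReal (1 / ((k : ℝ) + 1)) := by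
      refine lt_of_le_of_lt ?_ (hy k)
      exact (Finset.single_le_sum (f := fun i => ENNReal.ofReal α₁ * edist (u (i + 1)) (y k i))
        (fun _ _ => zero_le) (Finset.mem_range.2 hj)).trans le_self_add
    rw [edist_dist, ← ENNReal.ofReal_mul hα₁.le,
      ENNReal.ofReal_lt_ofReal_iff_of_nonneg (by positivity)] at h2
    rw [one_div_mul_eq_div, le_div_iff₀ hα₁]
    linarith
  have hs : ∀ k, schildDist E (u (i + 1)) (y k (i + 1)) (u i) (y k i) <
      ENNReal.ofReal (1 / α₀ * (1 / ((k : ℝ) + 1))) := by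
    intro k
    have h2 : ENNReal.ofReal α₀ * schildDist E (u (i + 1)) (y k (i + 1)) (u i) (y k i) <
        ENNReal.ofReal (1 / ((k : ℝ) + 1)) := by
      refine lt_of_le_of_lt ?_ (hy k)
      exact (Finset.single_le_sum (f := fun i => ENNReal.ofReal α₀ *
        schildDist E (u i) (y k i) (u (i - 1)) (y k (i - 1))) (fun _ _ => zero_le)
        (Finset.mem_Ico.2 (⟨by omega, by omega⟩ : 1 ≤ i + 1 ∧ i + 1 < n))).trans le_add_self
    rw [one_div_mul_eq_div, ENNReal.ofReal_div_of_pos hα₀, ENNReal.lt_div_iff_mul_lt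
      (Or.inl (ENNReal.ofReal_pos.2 hα₀).ne') (Or.inl ENNReal.ofReal_ne_top), mul_comm]
    exact h2
  have hA : 0 ≤ 1 / α₀ := by positivity
  have hB : 0 ≤ 1 / α₁ := by positivity
  refine exists_isGeodesicOn_of_schildDist_tendsto (w := fun k => y k (i + 1))
    -- One sequence that dominates the bounds from both kinds of summands.
    (v := fun k => y k i) (ε := fun k : ℕ => (1 / α₀ + 1 / α₁) * (1 / ((k : ℝ) + 1)))
    (R := 1 / α₀ + 1 / α₁) ?_ (fun k => ?_) (fun k => ?_) (fun k => ?_) (fun k => ?_)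
  · have := tendsto_one_div_add_atTop_nhds_zero_nat (𝕜 := ℝ).const_mul (1 / α₀ + 1 / α₁)
    rwa [mul_zero] at this
  · refine mul_le_of_le_one_right (by positivity) ?_
    rw [div_le_one (by positivity)]
    linarith [(Nat.cast_nonneg k : (0 : ℝ) ≤ k)]
  · refine (hd k i (by omega)).trans ?_
    gcongr
    linarith
  · rw [dist_comm]
    refine (hd k (i + 1) (by omega)).trans ?_
    gcongr
    linarith
  · refine (hs k).trans_le (ENNReal.ofReal_le_ofReal ?_)
    gcongr
    linarith

end SchildLimit

/-! ### Gluing geodesics -/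

section Gluing

variable {E : Type*} [NormedAddCommGroup E] [NormedSpace ℝ E] [FiniteDimensional ℝ E]
  {M : Type*} [MetricSpace M] [ChartedSpace E M] [IsManifold 𝓘(ℝ, E) ∞ M]
  [RiemannianBundle (fun x : M => TangentSpace 𝓘(ℝ, E) x)]
  [IsContMDiffRiemannianBundle 𝓘(ℝ, E) ∞ E (fun x : M => TangentSpace 𝓘(ℝ, E) x)]

theorem chartAcceleration_congr {γ σ : ℝ → M} {t : ℝ} (h : γ =ᶠ[𝓝 t] σ) (p : M) (w : E) :
    chartAcceleration E p γ t w = chartAcceleration E p σ t w := by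
  have h1 : chartCurve E p γ =ᶠ[𝓝 t] chartCurve E p σ := h.fun_comp (extChartAt 𝓘(ℝ, E) p)
  rw [chartAcceleration, chartAcceleration, h1.deriv.deriv_eq, h1.deriv_eq, h1.self_of_nhds]

theorem Set.EqOn.eventuallyEq_of_mem_Ioo {X : Type*} {γ σ : ℝ → X} {a b t : ℝ}
    (h : EqOn γ σ (Icc a b)) (ht : t ∈ Ioo a b) : γ =ᶠ[𝓝 t] σ :=
  h.eventuallyEq_of_mem (Icc_mem_nhds ht.1 ht.2)

theorem IsGeodesicOn.congr {γ σ : ℝ → M} {a b : ℝ} (h : IsGeodesicOn E γ a b)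
    (hσ : EqOn σ γ (Icc a b)) : IsGeodesicOn E σ a b := by
  refine ⟨h.1.congr hσ, h.2.1.congr (hσ.mono Ioo_subset_Icc_self), fun t ht p hp w => ?_⟩
  have h1 : σ =ᶠ[𝓝 t] γ := hσ.eventuallyEq_of_mem_Ioo ht
  rw [h1.self_of_nhds] at hp
  rw [chartAcceleration_congr h1]
  exact h.2.2 t ht p hp w

/-- A curve that is a geodesic near each point of an interval is a geodesic on the interval. -/
theorem isGeodesicOn_of_locally {γ : ℝ → M} {A B : ℝ}
    (h : ∀ t ∈ Icc A B, ∃ a b, IsGeodesicOn E γ a b ∧ Icc a b ∈ 𝓝[Icc A B] t) :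
    IsGeodesicOn E γ A B := by
  have key : ∀ t ∈ Ioo A B, ∃ a b, IsGeodesicOn E γ a b ∧ t ∈ Ioo a b := by
    intro t ht
    obtain ⟨a, b, hab, hn⟩ := h t (Ioo_subset_Icc_self ht)
    rw [nhdsWithin_eq_nhds.2 (Icc_mem_nhds ht.1 ht.2)] at hn
    exact ⟨a, b, hab, by rw [← interior_Icc]; exact mem_interior_iff_mem_nhds.2 hn⟩
  refine ⟨fun t ht => ?_, fun t ht => ?_, fun t ht => ?_⟩
  · obtain ⟨a, b, hab, hn⟩ := h t ht
    exact (hab.1 t (mem_of_mem_nhdsWithin ht hn)).mono_of_mem_nhdsWithin hn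
  · obtain ⟨a, b, hab, hn⟩ := key t ht
    exact (hab.2.1.contMDiffAt (isOpen_Ioo.mem_nhds hn)).contMDiffWithinAt
  · obtain ⟨a, b, hab, hn⟩ := key t ht
    exact hab.2.2 t hn

theorem Icc_mem_nhdsWithin_Icc_of_or {a b A B t : ℝ} (ha : a < t ∨ a ≤ A) (hb : t < b ∨ B ≤ b) :
    Icc a b ∈ 𝓝[Icc A B] t := by
  have h1 : ∀ᶠ s in 𝓝[Icc A B] t, a ≤ s := by
    rcases ha with ha | ha
    · exact ((lt_mem_nhds ha).mono fun s hs => hs.le).filter_mono nhdsWithin_le_nhds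
    · filter_upwards [self_mem_nhdsWithin] with s hs using ha.trans hs.1
  have h2 : ∀ᶠ s in 𝓝[Icc A B] t, s ≤ b := by
    rcases hb with hb | hb
    · exact ((gt_mem_nhds hb).mono fun s hs => hs.le).filter_mono nhdsWithin_le_nhds
    · filter_upwards [self_mem_nhdsWithin] with s hs using hs.2.trans hb
  filter_upwards [h1, h2] with s hs1 hs2 using ⟨hs1, hs2⟩

/-- The curve on `[0, n]` that consists of the curves `σ i`, translated to `[i, i + 1]`. -/
noncomputable def concatCurve (n : ℕ) (σ : ℕ → ℝ → M) (t : ℝ) : M :=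
  -- The cap at `n - 1` assigns `t = n` to the last curve.
  σ (min ⌊t⌋₊ (n - 1)) (t - (min ⌊t⌋₊ (n - 1) : ℕ))

theorem concatCurve_eq {n : ℕ} {σ : ℕ → ℝ → M} (hσ : ∀ i, i + 2 ≤ n → σ i 1 = σ (i + 1) 0)
    {i : ℕ} (hi : i < n) {t : ℝ} (ht : t ∈ Icc (i : ℝ) (i + 1)) :
    concatCurve n σ t = σ i (t - i) := by
  have ht0 : 0 ≤ t := i.cast_nonneg.trans ht.1
  rcases eq_or_lt_of_le ht.2 with rfl | hlt
  · have h1 : ⌊(i : ℝ) + 1⌋₊ = i + 1 := by exact_mod_cast Nat.floor_natCast (R := ℝ) (i + 1)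
    rw [concatCurve, h1]
    rcases (show i + 1 = n ∨ i + 2 ≤ n by omega) with h2 | h2
    · rw [show min (i + 1) (n - 1) = i by omega]
    · rw [show min (i + 1) (n - 1) = i + 1 by omega, Nat.cast_add, Nat.cast_one, sub_self,
        ← hσ i h2, add_sub_cancel_left]
  · have h1 : ⌊t⌋₊ = i := (Nat.floor_eq_iff ht0).2 ⟨ht.1, hlt⟩
    rw [concatCurve, h1, show min i (n - 1) = i by omega]

/-- Geodesics that fit together, two by two, fit together to one geodesic. -/
theorem isGeodesicOn_concatCurve {n : ℕ} {σ Γ : ℕ → ℝ → M}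
    (hσ : ∀ i, i + 2 ≤ n → σ i 1 = σ (i + 1) 0) (hg : ∀ i < n, IsGeodesicOn E (σ i) 0 1)
    (hΓ : ∀ i, i + 2 ≤ n → IsGeodesicOn E (Γ i) 0 2)
    (hΓσ : ∀ i, i + 2 ≤ n → EqOn (Γ i) (σ i) (Icc 0 1))
    (hΓσ' : ∀ i, i + 2 ≤ n → EqOn (fun t => Γ i (t + 1)) (σ (i + 1)) (Icc 0 1)) (hn : 0 < n) :
    IsGeodesicOn E (concatCurve n σ) 0 n := by
  have h1 : ∀ i < n, IsGeodesicOn E (concatCurve n σ) i (i + 1) := by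
    intro i hi
    have h2 : IsGeodesicOn E (fun t => σ i (1 * t + -(i : ℝ))) i (i + 1) :=
      IsGeodesicOn.comp_mul_add one_pos (by convert hg i hi using 1 <;> ring)
    refine h2.congr fun t ht => ?_
    simp only [concatCurve_eq hσ hi ht, one_mul, sub_eq_add_neg]
  -- The curves `Γ i` run across the joint `i + 1`, so no corner can occur there.
  have h2 : ∀ i, i + 2 ≤ n → IsGeodesicOn E (concatCurve n σ) i (i + 2) := by
    intro i hi
    have h2 : IsGeodesicOn E (fun t => Γ i (1 * t + -(i : ℝ))) i (i + 2) :=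
      IsGeodesicOn.comp_mul_add one_pos (by convert hΓ i hi using 1 <;> ring)
    refine h2.congr fun t ht => ?_
    simp only [one_mul]
    rcases le_total t (i + 1) with h | h
    · rw [concatCurve_eq hσ (i := i) (by omega) ⟨ht.1, h⟩, sub_eq_add_neg]
      exact (hΓσ i hi ⟨by linarith [ht.1], by linarith⟩).symm
    · have h3 := concatCurve_eq hσ (i := i + 1) (by omega) (t := t)
        ⟨by push_cast; exact h, by push_cast; linarith [ht.2]⟩
      rw [h3, Nat.cast_add, Nat.cast_one]
      have h4 := hΓσ' i hi (x := t - (i + 1)) ⟨by linarith, by linarith [ht.2]⟩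
      rw [← h4, show t + -(i : ℝ) = t - (i + 1) + 1 by ring]
  refine isGeodesicOn_of_locally fun t ht => ?_
  have hfl := Nat.floor_le ht.1
  have hfl' := Nat.lt_floor_add_one t
  have hfn : ⌊t⌋₊ ≤ n := by exact_mod_cast hfl.trans ht.2
  -- At integer times a joint interval of length `2` is a neighbourhood, except at the ends `0` and
  -- `n`; at other times one piece suffices.
  rcases eq_or_lt_of_le hfl with he | hlt
  · rcases Nat.eq_zero_or_pos ⌊t⌋₊ with h0 | hpos
    · refine ⟨_, _, h1 0 hn, Icc_mem_nhdsWithin_Icc_of_or (Or.inr (by simp)) (Or.inl ?_)⟩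
      rw [h0] at hfl'
      exact hfl'
    · obtain ⟨i, hi⟩ : ∃ i, ⌊t⌋₊ = i + 1 := ⟨⌊t⌋₊ - 1, by omega⟩
      rw [hi] at he hfn
      push_cast at he
      rcases (show i + 1 = n ∨ i + 2 ≤ n by omega) with h2' | h2'
      · refine ⟨_, _, h1 i (by omega), Icc_mem_nhdsWithin_Icc_of_or (Or.inl (by linarith))
          (Or.inr ?_)⟩
        rw [← h2']
        push_cast
        rfl
      · exact ⟨_, _, h2 i h2', Icc_mem_nhdsWithin_Icc_of_or (Or.inl (by linarith))
          (Or.inl (by linarith))⟩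
  · have hlt' : ⌊t⌋₊ < n := by exact_mod_cast hlt.trans_le ht.2
    exact ⟨_, _, h1 _ hlt', Icc_mem_nhdsWithin_Icc_of_or (Or.inl hlt) (Or.inl hfl')⟩

variable [IsRiemannianManifold 𝓘(ℝ, E) M]

theorem isGeodesicSeq_of_forall_eq {n : ℕ} {u : ℕ → M} (h : ∀ i ≤ n, u i = u 0) :
    IsGeodesicSeq E n u := by
  refine ⟨0, fun _ => u 0, le_rfl, isGeodesicOn_const _ _ _, fun t ht => ?_, fun i hi => (h i hi).symm,
    fun i hi => ?_⟩
  · exact absurd (ht.1.trans ht.2) (lt_irrefl _)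
  · rw [h i hi.le, h (i + 1) hi, dist_self, zero_div]

/-- Uniqueness is used for both halves of each limit geodesic `Γ i`: they are the minimal geodesics
`σ i` and `σ (i + 1)`. This provides equal distances as well as the overlaps required for gluing. -/
theorem isGeodesicSeq_of_schildTGV_eq_zero [CompleteSpace M] {α₀ α₁ : ℝ} (hα₀ : 0 < α₀)
    (hα₁ : 0 < α₁) {n : ℕ} {u : ℕ → M} (h : schildTGV E α₀ α₁ n u = 0)
    (huniq : ∀ i < n, UniqueGeodesic E (u i) (u (i + 1))) : IsGeodesicSeq E n u := by
  choose σ hσ hσ0 hσ1 hσs using fun i => exists_isGeodesicOn E (u i) (u (i + 1))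
  have hΓ : ∀ i, ∃ Γ : ℝ → M, i + 2 ≤ n → IsGeodesicOn E Γ 0 2 ∧ Γ 0 = u i ∧ Γ 1 = u (i + 1) ∧
      Γ 2 = u (i + 2) ∧ ∀ t ∈ Ioo (0 : ℝ) 2, curveSpeed E Γ t = dist (u i) (u (i + 1)) := by
    intro i
    by_cases hi : i + 2 ≤ n
    · obtain ⟨Γ, hΓ⟩ := exists_isGeodesicOn_of_schildTGV_eq_zero hα₀ hα₁ h hi
      exact ⟨Γ, fun _ => hΓ⟩
    · exact ⟨σ i, fun h => absurd h hi⟩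
  choose Γ hΓ using hΓ
  have hΓσ : ∀ i, i + 2 ≤ n → EqOn (Γ i) (σ i) (Icc 0 1) := by
    intro i hi
    obtain ⟨hg, h0, h1, -, -⟩ := hΓ i hi
    exact huniq i (by omega) _ _ (hg.mono le_rfl one_le_two) h0 h1 (hσ i) (hσ0 i) (hσ1 i)
  have hshift : ∀ i, i + 2 ≤ n → IsGeodesicOn E (fun t => Γ i (1 * t + 1)) 0 1 := fun i hi =>
    IsGeodesicOn.comp_mul_add one_pos ((hΓ i hi).1.mono (by norm_num) (by norm_num))
  have hΓσ' : ∀ i, i + 2 ≤ n → EqOn (fun t => Γ i (1 * t + 1)) (σ (i + 1)) (Icc 0 1) := by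
    intro i hi
    obtain ⟨hg, -, h1, h2, -⟩ := hΓ i hi
    refine huniq (i + 1) (by omega) _ _ (hshift i hi) ?_ ?_ (hσ _) (hσ0 _) (hσ1 _)
    · simpa using h1
    · norm_num
      exact h2
  -- The second half of `Γ i` has the speed of the first, `d(uᵢ, uᵢ₊₁)`, and being the minimal
  -- geodesic `σ (i + 1)` it also has speed `d(uᵢ₊₁, uᵢ₊₂)`.
  have hdist : ∀ i, i + 2 ≤ n → dist (u (i + 1)) (u (i + 2)) = dist (u i) (u (i + 1)) := by
    intro i hi
    obtain ⟨hg, -, -, -, hs⟩ := hΓ i hi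
    have hhalf : (1 / 2 : ℝ) ∈ Ioo (0 : ℝ) 1 := by norm_num
    have hhalf' : (1 * (1 / 2) + 1 : ℝ) ∈ Ioo (0 : ℝ) 2 := by norm_num
    rw [← hσs (i + 1) _ hhalf, ← curveSpeed_congr ((hΓσ' i hi).eventuallyEq_of_mem_Ioo hhalf),
      curveSpeed_comp_mul_add zero_le_one (hg.mdifferentiableAt hhalf'), hs _ hhalf', one_mul]
  have hdist' : ∀ i < n, dist (u i) (u (i + 1)) = dist (u 0) (u 1) := by
    intro i
    induction i with
    | zero => exact fun _ => rfl
    | succ i ih => exact fun hi => (hdist i (by omega)).trans (ih (by omega))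
  rcases Nat.eq_zero_or_pos n with rfl | hn
  · exact isGeodesicSeq_of_forall_eq fun i hi => by rw [Nat.le_zero.1 hi]
  set ℓ := dist (u 0) (u 1) with hℓ
  rcases eq_or_lt_of_le (dist_nonneg (x := u 0) (y := u 1)) with h0 | hpos
  · refine isGeodesicSeq_of_forall_eq fun i => ?_
    induction i with
    | zero => exact fun _ => rfl
    | succ i ih =>
      intro hi
      rw [← ih (by omega)]
      exact (dist_eq_zero.1 ((hdist' i (by omega)).trans h0.symm)).symm
  replace hpos : 0 < ℓ := hpos
  have hσσ : ∀ i, i + 2 ≤ n → σ i 1 = σ (i + 1) 0 := fun i _ => by rw [hσ0, hσ1]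
  have hg : IsGeodesicOn E (concatCurve n σ) 0 n := isGeodesicOn_concatCurve hσσ
    (fun i _ => hσ i) (fun i hi => (hΓ i hi).1) hΓσ
    (fun i hi => by simpa only [one_mul] using hΓσ' i hi) hn
  have hn' : (1 : ℝ) ≤ n := by exact_mod_cast hn
  have hsp : ∀ t ∈ Ioo (0 : ℝ) n, curveSpeed E (concatCurve n σ) t = ℓ := by
    intro t ht
    have hhalf : (1 / 2 : ℝ) ∈ Ioo (0 : ℝ) 1 := by norm_num
    rw [hg.curveSpeed_eq ht (show (1 / 2 : ℝ) ∈ Ioo (0 : ℝ) n from ⟨by norm_num, by linarith⟩),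
      show ℓ = dist (u 0) (u (0 + 1)) from rfl, ← hσs 0 _ hhalf]
    refine curveSpeed_congr (EqOn.eventuallyEq_of_mem_Ioo (fun s hs => ?_) hhalf)
    have h3 := concatCurve_eq hσσ hn (t := s) (by simpa using hs)
    simpa using h3
  have hmem : ∀ t ∈ Ioo 0 (n * ℓ), ℓ⁻¹ * t + 0 ∈ Ioo (0 : ℝ) n := by
    intro t ht
    rw [add_zero, inv_mul_eq_div]
    exact ⟨div_pos ht.1 hpos, by rw [div_lt_iff₀ hpos]; exact ht.2⟩
  -- The glued curve on `[0, n]` has speed `ℓ`; slowing it by `ℓ⁻¹` gives unit speed on `[0, n ℓ]`.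
  refine ⟨n * ℓ, fun t => concatCurve n σ (ℓ⁻¹ * t + 0), by positivity,
    IsGeodesicOn.comp_mul_add (by positivity) ?_, fun t ht => ?_, fun i hi => ?_, fun i hi => ?_⟩
  · rw [mul_zero, zero_add, add_zero, mul_comm, mul_assoc, mul_inv_cancel₀ hpos.ne', mul_one]
    exact hg
  · change curveSpeed E _ t = 1
    rw [curveSpeed_comp_mul_add (by positivity) (hg.mdifferentiableAt (hmem t ht)),
      hsp _ (hmem t ht), inv_mul_cancel₀ hpos.ne']
  · have h3 : ℓ⁻¹ * (i * (n * ℓ) / n) + 0 = i := by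
      have h4 : (n : ℝ) ≠ 0 := by positivity
      rw [add_zero, mul_div_assoc, mul_div_cancel_left₀ _ h4, mul_comm, mul_assoc,
        mul_inv_cancel₀ hpos.ne', mul_one]
    change concatCurve n σ (ℓ⁻¹ * (i * (n * ℓ) / n) + 0) = u i
    rw [h3]
    rcases eq_or_lt_of_le hi with rfl | hi
    · obtain ⟨j, rfl⟩ : ∃ j, i = j + 1 := ⟨i - 1, by omega⟩
      rw [concatCurve_eq hσσ (i := j) (by omega) (by push_cast; simp)]
      push_cast
      rw [add_sub_cancel_left, hσ1]
    · rw [concatCurve_eq hσσ hi (by simp), sub_self, hσ0]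
  · rw [hdist' i hi, mul_div_cancel_left₀ _ (by positivity)]

end Gluing

/-! ### The choice `yᵢ = uᵢ₊₁` and locally geodesic sequences -/

section LocallyGeodesic

variable {E : Type*} [NormedAddCommGroup E] [NormedSpace ℝ E]
  {M : Type*} [MetricSpace M] [ChartedSpace E M]
  [RiemannianBundle (fun x : M => TangentSpace 𝓘(ℝ, E) x)]

theorem schildEnergy_succ (α₀ α₁ : ℝ) (n : ℕ) (u : ℕ → M) :
    schildEnergy E α₀ α₁ n u (fun i => u (i + 1)) = ENNReal.ofReal α₀ * schildTV2 E n u := by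
  rw [schildEnergy, schildTV2, Finset.mul_sum]
  simp only [edist_self, mul_zero, Finset.sum_const_zero, zero_add]
  refine Finset.sum_congr rfl fun i hi => ?_
  rw [Nat.sub_add_cancel (Finset.mem_Ico.1 hi).1]

theorem schildTGV_eq_of_forall_le {α₀ α₁ : ℝ} {n : ℕ} {u : ℕ → M}
    (h : ∀ y : ℕ → M, schildEnergy E α₀ α₁ n u (fun i => u (i + 1)) ≤ schildEnergy E α₀ α₁ n u y) :
    schildTGV E α₀ α₁ n u = ENNReal.ofReal α₀ * schildTV2 E n u := by
  rw [← schildEnergy_succ α₀ α₁]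
  exact le_antisymm (iInf_le _ _) (le_iInf h)

variable [FiniteDimensional ℝ E] [IsManifold 𝓘(ℝ, E) ∞ M]
  [IsContMDiffRiemannianBundle 𝓘(ℝ, E) ∞ E (fun x : M => TangentSpace 𝓘(ℝ, E) x)]

theorem mem_geodesicPoints_self (x : M) (t : ℝ) : x ∈ geodesicPoints E x x t :=
  mem_geodesicPoints_iff.2 ⟨fun _ => x, isGeodesicOn_const _ _ _, rfl, rfl, rfl, fun s _ => by
    rw [curveSpeed_const, dist_self]⟩

/-- The admissible choice is `c = u 1`, from the constant geodesic, and `y' = u 2`. The given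
geodesic, run at speed `L / 2`, is minimal on `[0, 1]` because `d(u 0, u 1) = L / 2`; it need not be
minimal up to time `2`. -/
theorem schildDist_eq_zero_of_isGeodesicSeq {u : ℕ → M} (h : IsGeodesicSeq E 2 u) :
    schildDist E (u 1) (u 2) (u 0) (u 1) = 0 := by
  suffices h2 : u 2 ∈ geodesicPoints E (u 0) (u 1) 2 by
    refine le_antisymm ?_ zero_le
    refine (iInf₂_le (u 1) (mem_geodesicPoints_self (u 1) (1 / 2))).trans ?_
    exact (iInf₂_le (u 2) h2).trans (edist_self _).le
  obtain ⟨L, γ, hL, hγ, hs, hu, hd⟩ := h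
  have h0 := hu 0 (by norm_num)
  have h1 := hu 1 (by norm_num)
  have h2 := hu 2 (by norm_num)
  have hd0 : dist (u 0) (u 1) = L / 2 := by simpa using hd 0 (by norm_num)
  norm_num at h0 h1 h2
  rcases eq_or_lt_of_le hL with rfl | hL
  · rw [zero_div] at h1
    rw [← h0, ← h1, ← h2]
    exact mem_geodesicPoints_self _ _
  · have hmaps : ∀ s ∈ Ioo (0 : ℝ) 2, L / 2 * s + 0 ∈ Ioo 0 L := fun s hs =>
      ⟨by have := hs.1; positivity, by nlinarith [hs.2]⟩
    refine mem_geodesicPoints_iff.2 ⟨fun t => γ (L / 2 * t + 0), ?_, ?_, ?_, ?_, ?_⟩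
    · rw [min_eq_left zero_le_two, max_eq_right one_le_two]
      refine IsGeodesicOn.comp_mul_add (by positivity) ?_
      convert hγ using 1 <;> ring
    · simpa using h0
    · simpa using h1
    · rw [← h2]
      simp
    · rw [min_eq_left zero_le_two, max_eq_right one_le_two]
      intro s hs'
      rw [curveSpeed_comp_mul_add (by positivity) (hγ.mdifferentiableAt (hmaps s hs')), hd0]
      have h3 : curveSpeed E γ (L / 2 * s + 0) = 1 := hs _ (hmaps s hs')
      rw [h3, mul_one]

theorem schildTGV_eq_zero_of_isLocallyGeodesicSeq (α₀ α₁ : ℝ) {n : ℕ} {u : ℕ → M}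
    (h : IsLocallyGeodesicSeq E n u) : schildTGV E α₀ α₁ n u = 0 := by
  refine le_antisymm ((iInf_le _ fun i => u (i + 1)).trans ?_) zero_le
  rw [schildEnergy_succ, schildTV2, Finset.sum_eq_zero, mul_zero]
  intro i hi
  obtain ⟨j, rfl⟩ : ∃ j, i = j + 1 := ⟨i - 1, by have := (Finset.mem_Ico.1 hi).1; omega⟩
  exact schildDist_eq_zero_of_isGeodesicSeq (h j (Finset.mem_Ico.1 hi).2)

end LocallyGeodesic

/-! ### The chart and the metric of a Euclidean space -/

section Euclidean

variable {F : Type*} [NormedAddCommGroup F] [InnerProductSpace ℝ F]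

theorem chartCurve_self (p : F) (γ : ℝ → F) : chartCurve F p γ = γ := by
  funext t
  simp [chartCurve, chartAt_self_eq]

theorem mfderiv_extChartAt_symm_self (p x v : F) :
    (show F from mfderiv 𝓘(ℝ, F) 𝓘(ℝ, F) (extChartAt 𝓘(ℝ, F) p).symm x v) = v := by
  have h : ((extChartAt 𝓘(ℝ, F) p).symm : F → F) = id := by
    rw [extChartAt_model_space_eq_id]
    rfl
  rw [h, mfderiv_id]
  rfl

theorem chartMetric_self (p x v w : F) : chartMetric F p x v w = inner ℝ v w := by
  conv_rhs => rw [← mfderiv_extChartAt_symm_self p x v, ← mfderiv_extChartAt_symm_self p x w]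
  rfl

variable [FiniteDimensional ℝ F]

theorem metricForm_self_eq (p : F) : metricForm (E := F) p = fun _ => innerSL ℝ := by
  funext x
  refine ContinuousLinearMap.ext fun v => ContinuousLinearMap.ext fun w => ?_
  rw [metricForm_apply]
  exact chartMetric_self p x v w

end Euclidean

/-! ### Geodesics and total variation in a Euclidean space -/

section EuclideanTGV

variable {F : Type*} [NormedAddCommGroup F] [InnerProductSpace ℝ F] [FiniteDimensional ℝ F]

/-- Geodesics in a Euclidean space are affine. -/
theorem IsGeodesicOn.eq_add_smul {γ : ℝ → F} {a b : ℝ} (h : IsGeodesicOn F γ a b)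
    (h0 : (0 : ℝ) ∈ Icc a b) (h1 : (1 : ℝ) ∈ Icc a b) {t : ℝ} (ht : t ∈ Icc a b) :
    γ t = γ 0 + t • (γ 1 - γ 0) := by
  have hab : a < b := lt_of_le_of_lt h0.1 (one_pos.trans_le h1.2)
  have hd : ∀ t ∈ Ioo a b, HasDerivAt γ (deriv γ t) t ∧ HasDerivAt (deriv γ) 0 t := by
    intro t ht
    obtain ⟨e1, e2, e3⟩ := h.hasDerivAt_chartCurve ht (p := γ t) (mem_chart_source F (γ t))
    rw [chartCurve_self] at e1 e2 e3
    -- The metric is constant, so the geodesic equation paired with `w = γ''` says `‖γ''‖² = 0`.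
    have e4 := e3 (deriv (deriv γ) t)
    rw [metricForm_self_eq, fderiv_const_apply] at e4
    have e5 : inner ℝ (deriv (deriv γ) t) (deriv (deriv γ) t) = (0 : ℝ) := by
      simp at e4
      exact e4
    rw [inner_self_eq_zero.1 e5] at e2
    exact ⟨e1, e2⟩
  obtain ⟨m, hm⟩ := nonempty_Ioo.2 hab
  have h2 : ∀ t ∈ Ioo a b, deriv γ t = deriv γ m := fun t ht =>
    isOpen_Ioo.is_const_of_deriv_eq_zero isPreconnected_Ioo
      (fun s hs => (hd s hs).2.differentiableAt.differentiableWithinAt)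
      (fun s hs => (hd s hs).2.deriv) ht hm
  set v := deriv γ m with hv
  have h3 : ∀ t ∈ Ioo a b, HasDerivAt (fun t => γ t - t • v) 0 t := by
    intro t ht
    have h4 := (hd t ht).1.sub ((hasDerivAt_id t).smul_const v)
    rw [h2 t ht, one_smul, sub_self] at h4
    exact h4
  have h4 : ∀ t ∈ Ioo a b, γ t - t • v = γ m - m • v := fun t ht =>
    isOpen_Ioo.is_const_of_deriv_eq_zero (f := fun t => γ t - t • v) isPreconnected_Ioo
      (fun s hs => (h3 s hs).differentiableAt.differentiableWithinAt)
      (fun s hs => (h3 s hs).deriv) ht hm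
  have hcl : closure (Ioo a b) = Icc a b := closure_Ioo hab.ne
  have h5 : ∀ t ∈ Icc a b, γ t - t • v = γ m - m • v := by
    have h6 : EqOn (fun t => γ t - t • v) (fun _ => γ m - m • v) (closure (Ioo a b)) := by
      refine EqOn.of_subset_closure (s := Ioo a b) h4 ?_ continuousOn_const subset_closure le_rfl
      rw [hcl]
      exact h.1.sub (Continuous.continuousOn (by fun_prop))
    rw [hcl] at h6
    exact h6
  have e0 := h5 0 h0
  have e1 := h5 1 h1
  have et := h5 t ht
  rw [zero_smul, sub_zero] at e0
  rw [one_smul, ← e0] at e1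
  have e2 : v = γ 1 - γ 0 := by
    rw [← e1]
    abel
  rw [← e2, e0, ← et]
  abel

theorem isGeodesicOn_add_smul (x v : F) (a b : ℝ) :
    IsGeodesicOn F (fun t => x + t • v) a b ∧ ∀ t, curveSpeed F (fun t => x + t • v) t = ‖v‖ := by
  have hd : ∀ s : ℝ, HasDerivAt (fun t : ℝ => x + t • v) v s := fun s => by
    have := ((hasDerivAt_id s).smul_const v).const_add x
    rwa [one_smul] at this
  refine ⟨isGeodesicOn_of_chart (Continuous.continuousOn (by fun_prop)) fun t ht p hp =>
    ⟨fun _ => v, ?_, contDiffAt_const, fun w => ?_⟩, fun t => ?_⟩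
  · rw [chartCurve_self]
    exact Filter.Eventually.of_forall hd
  · rw [metricForm_self_eq, fderiv_const_apply, deriv_const]
    simp
  · have h1 := (curveSpeed_sq_eq (E := F) (x + t • v) (γ := fun t => x + t • v) (t := t)
      (hd t).differentiableAt.mdifferentiableAt (mem_chart_source F (x + t • v))).2
    rw [chartCurve_self, (hd t).deriv, metricForm_self_eq] at h1
    have h2 : curveSpeed F (fun t => x + t • v) t ^ 2 = ‖v‖ ^ 2 := by
      rw [h1]
      exact real_inner_self_eq_norm_sq v
    rwa [sq_eq_sq₀ (curveSpeed_nonneg _ _) (norm_nonneg _)] at h2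

theorem geodesicPoints_eq_singleton (a b : F) (t : ℝ) :
    geodesicPoints F a b t = {a + t • (b - a)} := by
  ext z
  rw [mem_geodesicPoints_iff, mem_singleton_iff]
  constructor
  · rintro ⟨γ, hγ, rfl, rfl, rfl, -⟩
    exact hγ.eq_add_smul (by simp) (by simp) (by simp)
  · rintro rfl
    obtain ⟨h1, h2⟩ := isGeodesicOn_add_smul a (b - a) (min 0 t) (max 1 t)
    refine ⟨_, h1, by simp, by simp, rfl, fun s hs => ?_⟩
    rw [h2, dist_comm, dist_eq_norm]

/-- The only midpoint is `c = (x + v) / 2`, and `2 c - u = x + v - u` is the fourth vertex of the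
parallelogram. -/
theorem schildDist_eq_edist (x y u v : F) : schildDist F x y u v = edist (x + v - u) y := by
  rw [schildDist, geodesicPoints_eq_singleton, iInf_singleton, geodesicPoints_eq_singleton,
    iInf_singleton]
  congr 1
  module

theorem schildTV2_eq_ofReal (n : ℕ) (u : ℕ → F) :
    schildTV2 F n u = ENNReal.ofReal (vectorTV2 n u) := by
  rw [schildTV2, vectorTV2, ENNReal.ofReal_sum_of_nonneg fun _ _ => norm_nonneg _]
  refine Finset.sum_congr rfl fun i _ => ?_
  rw [schildDist_eq_edist, edist_dist, dist_comm, dist_eq_norm]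
  congr 2
  module

theorem schildEnergy_eq_ofReal {α₀ α₁ : ℝ} (hα₀ : 0 ≤ α₀) (hα₁ : 0 ≤ α₁) (n : ℕ) (u w : ℕ → F) :
    schildEnergy F α₀ α₁ n u (u + w) =
      ENNReal.ofReal ((∑ i ∈ Finset.range n, α₁ * ‖(u (i + 1) - u i) - w i‖)
        + ∑ i ∈ Finset.Ico 1 n, α₀ * ‖w i - w (i - 1)‖) := by
  rw [schildEnergy, ENNReal.ofReal_add (Finset.sum_nonneg fun _ _ => by positivity)
    (Finset.sum_nonneg fun _ _ => by positivity),
    ENNReal.ofReal_sum_of_nonneg fun _ _ => by positivity,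
    ENNReal.ofReal_sum_of_nonneg fun _ _ => by positivity]
  congr 1
  · refine Finset.sum_congr rfl fun i _ => ?_
    rw [ENNReal.ofReal_mul hα₁, edist_dist, dist_eq_norm, Pi.add_apply, sub_sub]
  · refine Finset.sum_congr rfl fun i _ => ?_
    rw [ENNReal.ofReal_mul hα₀, schildDist_eq_edist, edist_dist, dist_comm, dist_eq_norm,
      Pi.add_apply, Pi.add_apply]
    congr 3
    module

theorem schildTGV_eq_ofReal {α₀ α₁ : ℝ} (hα₀ : 0 ≤ α₀) (hα₁ : 0 ≤ α₁) (n : ℕ) (u : ℕ → F) :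
    schildTGV F α₀ α₁ n u = ENNReal.ofReal (vectorTGV α₀ α₁ n u) := by
  -- The substitution `y = u + w` is a bijection between auxiliary points and tangent vectors.
  rw [schildTGV, vectorTGV, ENNReal.ofReal_iInf, ← (Equiv.addLeft u).iInf_comp]
  exact iInf_congr fun w => schildEnergy_eq_ofReal hα₀ hα₁ n u w

end EuclideanTGV

theorem theorem2p9 (α₀ α₁ : ℝ) (hα₀ : 0 < α₀) (hα₁ : 0 < α₁) :
    -- in `ℝ^K`, `S-TGV²` is the vector space `TGV²` and `schildTV2` is the vector space `TV²`
    (∀ (K n : ℕ) (u : ℕ → EuclideanSpace ℝ (Fin K)),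
      schildTGV (EuclideanSpace ℝ (Fin K)) α₀ α₁ n u = ENNReal.ofReal (vectorTGV α₀ α₁ n u) ∧
      schildTV2 (EuclideanSpace ℝ (Fin K)) n u = ENNReal.ofReal (vectorTV2 n u)) ∧
    -- in every complete Riemannian manifold `M`
    (∀ (E : Type*) [NormedAddCommGroup E] [NormedSpace ℝ E] [FiniteDimensional ℝ E]
      (M : Type*) [MetricSpace M] [ChartedSpace E M] [IsManifold 𝓘(ℝ, E) ∞ M]
      [RiemannianBundle (fun x : M => TangentSpace 𝓘(ℝ, E) x)]
      [IsContMDiffRiemannianBundle 𝓘(ℝ, E) ∞ E (fun x : M => TangentSpace 𝓘(ℝ, E) x)]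
      [IsRiemannianManifold 𝓘(ℝ, E) M] [CompleteSpace M]
      (n : ℕ) (u : ℕ → M),
      -- if the minimum is attained at `yᵢ = uᵢ₊₁`, then `S-TGV² = α₀ TV²`
      ((∀ y : ℕ → M, schildEnergy E α₀ α₁ n u (fun i => u (i + 1)) ≤ schildEnergy E α₀ α₁ n u y) →
        schildTGV E α₀ α₁ n u = ENNReal.ofReal α₀ * schildTV2 E n u) ∧
      (IsLocallyGeodesicSeq E n u → schildTGV E α₀ α₁ n u = 0) ∧
      (schildTGV E α₀ α₁ n u = 0 → (∀ i < n, UniqueGeodesic E (u i) (u (i + 1))) →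
        IsGeodesicSeq E n u)) := by
  refine ⟨fun K n u => ⟨schildTGV_eq_ofReal hα₀.le hα₁.le n u, schildTV2_eq_ofReal n u⟩, ?_⟩
  intro E _ _ _ M _ _ _ _ _ _ _ n u
  exact ⟨schildTGV_eq_of_forall_le, schildTGV_eq_zero_of_isLocallyGeodesicSeq α₀ α₁,
    isGeodesicSeq_of_schildTGV_eq_zero hα₀ hα₁⟩
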